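/- Let $d\ge 1$, let $B\subset\mathbb C^d$ be an open Euclidean ball of radius $R>0$, and let $0<r<1$. Let $\mathcal I$ be a countable index set. For each $i\in\mathcal I$ let $w_i:B\to\mathbb C$ be holomorphic, with $\sum_{i\in\mathcal I}\sup_{z\in B}|w_i(z)|<\infty$, and let $T_i:B\to B$ be holomorphic, with $\bigcup_{i\in\mathcal I}T_i(B)$ contained in the (closed) ball concentric with $B$ of radius $rR$. Put $W:=\sup_{z\in B}\sum_{i\in\mathcal I}|w_i(z)|$. Let $\sigma$ be the $(2d-1)$-dimensional Lebesgue measure on $\partial B$, normalised so that $\sigma(\partial B)=1$, and let the Hardy space $H^2(B)$ be the closure in $L^2(\partial B,\sigma)$ of the set of (boundary values of) functions that are holomorphic on $B$ and continuous on $\overline B$; each $f\in H^2(B)$ has a natural holomorphic extension to $B$, namely the pointwise limit on $B$ of any sequence of such functions whose boundary values converge to $f$ in $L^2(\partial B,\sigma)$. Then the transfer operator $\mathcal Lf=\sum_{i\in\mathcal I}w_i\cdot f\circ T_i$ (an identity between holomorphic extensions to $B$) is a well-defined compact linear operator $\mathcal L:H^2(B)\to H^2(B)$. Let $(\lambda_n)_{n\ge1}$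 be its eigenvalues, counted with algebraic multiplicity and ordered by decreasing modulus (continued by zeros if there are only finitely many nonzero eigenvalues; eigenvalues of the same modulus may be written in any order). If the $w_i$ do not all vanish identically on $B$, then $$|\lambda_n| < \frac{W\sqrt d}{r^d(1-r^2)^{d/2}}\; n^{(d-1)/(2d)}\; r^{\frac{d}{d+1}(d!)^{1/d}n^{1/d}}\qquad\text{for all } n\ge1,$$ and in any case this holds with $\le$ in place of $<$. If $d=1$, then moreover $$|\lambda_n|\le \frac{W}{\sqrt{1-r^2}}\; r^{(n-1)/2}\qquad\text{for all } n\ge1 .$$ -/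

import Mathlib

open MeasureTheory Metric Filter Topology
open scoped ENNReal

noncomputable section

/-- `ℂ^d` with the Euclidean norm. -/
abbrev Cd (d : ℕ) : Type := EuclideanSpace ℂ (Fin d)

/-- The rotation-invariant `(2d-1)`-dimensional Lebesgue measure on the boundary sphere of the ball
with centre `c` and radius `R`, normalised to have total mass `1` (for `1 ≤ d`, `0 < R`). It is
regarded as a measure on `ℂ^d` that is concentrated on the sphere: the normalised surface measure
of the unit sphere is transported by `x ↦ c + R x`. -/
def sphereMeasure {d : ℕ} (c : Cd d) (R : ℝ) : Measure (Cd d) :=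
  (((volume : Measure (Cd d)).toSphere Set.univ)⁻¹ • (volume : Measure (Cd d)).toSphere).map
    (fun x : sphere (0 : Cd d) 1 => c + R • (x : Cd d))

/-- Classes in `L²(∂B, σ)` of boundary values of functions that are holomorphic on the open ball
`B = ball c R` and continuous on its closure. -/
def ballAlgebraBoundary {d : ℕ} (c : Cd d) (R : ℝ) :
    Submodule ℂ (Lp ℂ 2 (sphereMeasure c R)) where
  carrier := {f | ∃ u : Cd d → ℂ, DiffContOnCl ℂ u (ball c R) ∧ f =ᵐ[sphereMeasure c R] u}
  zero_mem' := ⟨0, diffContOnCl_const, Lp.coeFn_zero _ _ _⟩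
  add_mem' := by
    rintro f g ⟨u, hu, hfu⟩ ⟨v, hv, hgv⟩
    exact ⟨u + v, hu.add hv, (Lp.coeFn_add f g).trans (hfu.add hgv)⟩
  smul_mem' := by
    rintro a f ⟨u, hu, hfu⟩
    exact ⟨a • u, hu.const_smul a, (Lp.coeFn_smul a f).trans (hfu.const_smul a)⟩

/-- The Hardy space `H²(B)` of the ball `B = ball c R`: the closure of the above in
`L²(∂B, σ)`. -/
abbrev HardySpace {d : ℕ} (c : Cd d) (R : ℝ) : Submodule ℂ (Lp ℂ 2 (sphereMeasure c R)) :=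
  (ballAlgebraBoundary c R).topologicalClosure

/-- `F` is, on `B = ball c R`, the natural holomorphic extension of `f ∈ L²(∂B, σ)`: it is
holomorphic on `B`, and some sequence of functions holomorphic on `B` and continuous on the closure
converges to `f` in `L²(∂B, σ)` and to `F` pointwise on `B`. Values of `F` outside `B` are
irrelevant. -/
def IsHolomorphicExtension {d : ℕ} (c : Cd d) (R : ℝ) (f : Lp ℂ 2 (sphereMeasure c R))
    (F : Cd d → ℂ) : Prop :=
  DifferentiableOn ℂ F (ball c R) ∧
    ∃ u : ℕ → Cd d → ℂ, (∀ n, DiffContOnCl ℂ (u n) (ball c R)) ∧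
      Tendsto (fun n => eLpNorm (fun z => u n z - f z) 2 (sphereMeasure c R)) atTop (𝓝 0) ∧
      ∀ z ∈ ball c R, Tendsto (fun n => u n z) atTop (𝓝 (F z))

/-- `L : H²(B) → H²(B)` is the transfer operator `f ↦ ∑ i, w i · (f ∘ T i)`: every `f ∈ H²(B)` has
a holomorphic extension to `B`, and whenever `F` is one, `∑ i, w i · (F ∘ T i)` is a holomorphic
extension of `L f`. -/
def IsTransferOperator {d : ℕ} (c : Cd d) (R : ℝ) {ι : Type*} (w : ι → Cd d → ℂ)
    (T : ι → Cd d → Cd d) (L : HardySpace c R → HardySpace c R) : Prop :=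
  ∀ f : HardySpace c R, (∃ F : Cd d → ℂ, IsHolomorphicExtension c R f F) ∧
    ∀ F : Cd d → ℂ, IsHolomorphicExtension c R f F →
      IsHolomorphicExtension c R (L f) (fun z => ∑' i, w i z * F (T i z))

/-- Algebraic multiplicity of `μ` as an eigenvalue of `A`: the dimension of the generalised
eigenspace `⋃ k, ker (A - μ)^k`, as an extended natural number (`0` if `μ` is no eigenvalue). -/
def algMultiplicity {V : Type*} [AddCommGroup V] [Module ℂ V] (A : Module.End ℂ V) (μ : ℂ) : ℕ∞ :=
  Cardinal.toENat (Module.rank ℂ (A.maxGenEigenspace μ))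

/-- `ev 0, ev 1, …` lists the eigenvalues of `A` with algebraic multiplicities, by decreasing
modulus: every nonzero `μ` occurs as often as its algebraic multiplicity says. If there are only
finitely many nonzero eigenvalues, the list is continued by zeros. -/
def IsEigenvalueSequence {V : Type*} [AddCommGroup V] [Module ℂ V] (A : Module.End ℂ V)
    (ev : ℕ → ℂ) : Prop :=
  Antitone (fun n => ‖ev n‖) ∧ ∀ μ : ℂ, μ ≠ 0 → {n | ev n = μ}.encard = algMultiplicity A μ

/-- `sup_{z ∈ B} ∑ i, |w i z|`, a supremum in `[0, ∞]` turned into a real number (it is finite as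
soon as `∑ i, sup_B |w i|` is). -/
def weightSup {d : ℕ} (c : Cd d) (R : ℝ) {ι : Type*} (w : ι → Cd d → ℂ) : ℝ :=
  (⨆ z ∈ ball c R, ∑' i, ‖w i z‖ₑ).toReal

/-- The right-hand side of the eigenvalue estimate in dimension `d`. -/
def eigenvalueBound (d : ℕ) (W r : ℝ) (n : ℕ) : ℝ :=
  W * √(d : ℝ) / (r ^ d * (1 - r ^ 2) ^ ((d : ℝ) / 2)) * (n : ℝ) ^ (((d : ℝ) - 1) / (2 * d)) *
    r ^ ((d : ℝ) / (d + 1) * (d.factorial : ℝ) ^ (1 / (d : ℝ)) * (n : ℝ) ^ (1 / (d : ℝ)))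

end

/-!
After rescaling to the unit ball, the normalised monomials `z ^ α` form an orthonormal basis of
`H²(B)`: they are orthogonal because the sphere is invariant under rotations of each coordinate,
and they are total because a function of the ball algebra is a uniform limit of its dilations,
which are uniform limits of their homogeneous expansions. For every degree `m`, unitary invariance
forces `∑ |z ^ α|²` over the normalised monomials of degree `m` to be a multiple of `‖z‖ ^ (2 m)`,
and integration over the sphere identifies the factor as the number `(m + d - 1).choose (d - 1)` of
these monomials.

Hence a function `f` orthogonal to all polynomials of degree less than `m` satisfies
`|f z|² ≤ (∑ k ≥ m, (k + d - 1).choose (d - 1) * r ^ (2 k)) * ‖f‖²` on the ball of radius `r R`.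
Since every `T i` maps into that ball, `|L f|` is at most `W` times the resulting bound, on all of
`B`, and a bounded holomorphic function belongs to `H²(B)` with norm at most its supremum. So `L`
is small on subspaces of finite codimension, which makes it compact. Weyl's inequality bounds the
product of the moduli of the first `n` eigenvalues by the product of the corresponding approximation
bounds; the estimate for `|λ_n|` is the geometric mean of the latter, computed from the size of the
tails and from the number of polynomials of each degree.
-/

/-! ### Weyl's inequality for determinants -/

section Determinant

variable {𝕜 E : Type*} [RCLike 𝕜] [NormedAddCommGroup E] [InnerProductSpace 𝕜 E]

theorem norm_det_le_prod_norm {ι : Type*} [Fintype ι] [DecidableEq ι]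
    (b : OrthonormalBasis ι 𝕜 E) (v : ι → E) : ‖b.toBasis.det v‖ ≤ ∏ i, ‖v i‖ := by
  let e := Fintype.equivFin ι
  let b' := b.reindex e
  let v' := v ∘ e.symm
  have : FiniteDimensional 𝕜 E := b.toBasis.finiteDimensional_of_finite
  let g := InnerProductSpace.gramSchmidtOrthonormalBasis
    (Module.finrank_eq_card_basis b'.toBasis) v'
  have det_eq : b.toBasis.det v = b'.toBasis.det g * g.toBasis.det v' := by
    rw [← b.toBasis.det_reindex_symm v e.symm, e.symm_symm, ← b.reindex_toBasis,
      Module.Basis.det_apply, Module.Basis.det_apply, Module.Basis.det_apply, ← Matrix.det_mul,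
      ← OrthonormalBasis.coe_toBasis g, Module.Basis.toMatrix_mul_toMatrix]
  calc ‖b.toBasis.det v‖ = ∏ i, ‖inner 𝕜 (g i) (v' i)‖ := by
        rw [det_eq, norm_mul, OrthonormalBasis.det_to_matrix_orthonormalBasis, one_mul,
          InnerProductSpace.gramSchmidtOrthonormalBasis_det, norm_prod]
    _ ≤ ∏ i, ‖v' i‖ := Finset.prod_le_prod (fun _ _ => norm_nonneg _) fun i _ => by
        simpa only [g.orthonormal.1 i, one_mul] using norm_inner_le_norm (𝕜 := 𝕜) (g i) (v' i)
    _ = ∏ i, ‖v i‖ := e.symm.prod_comp fun i => ‖v i‖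

theorem exists_norm_eq_one_mem_orthogonal (V Q : Submodule 𝕜 E) [FiniteDimensional 𝕜 V]
    [FiniteDimensional 𝕜 Q] (h : Module.finrank 𝕜 Q < Module.finrank 𝕜 V) :
    ∃ x ∈ V, x ∈ Qᗮ ∧ ‖x‖ = 1 := by
  let proj : V →ₗ[𝕜] Q := (Q.orthogonalProjectionOnto : E →ₗ[𝕜] Q) ∘ₗ V.subtype
  obtain ⟨x, hx, hx0⟩ :=
    (Submodule.ne_bot_iff _).1 (LinearMap.ker_ne_bot_of_finrank_lt (f := proj) h)
  have hxQ : (x : E) ∈ Qᗮ := Submodule.orthogonalProjectionOnto_eq_zero_iff.1 hx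
  refine ⟨((‖(x : E)‖⁻¹ : ℝ) : 𝕜) • (x : E), V.smul_mem _ x.2, Qᗮ.smul_mem _ hxQ, ?_⟩
  rw [norm_smul, RCLike.norm_ofReal, abs_inv, abs_norm,
    inv_mul_cancel₀ (norm_ne_zero_iff.2 (by simpa using hx0))]

theorem orthonormal_snoc {n : ℕ} {e : Fin n → E} {x : E} (he : Orthonormal 𝕜 e) (hx : ‖x‖ = 1)
    (hex : ∀ k, inner 𝕜 (e k) x = 0) : Orthonormal 𝕜 (Fin.snoc e x : Fin (n + 1) → E) := by
  refine ⟨Fin.lastCases ?_ fun j => ?_, Fin.lastCases ?_ fun i => ?_⟩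
  · simpa using hx
  · simpa using he.1 j
  · refine Fin.lastCases (by simp) fun j _ => ?_
    simpa using inner_eq_zero_symm.1 (hex j)
  · refine Fin.lastCases (fun _ => by simpa using hex i) fun j hij => ?_
    simpa using he.2 fun h => hij (congrArg Fin.castSucc h)

theorem exists_orthonormal_mem_orthogonal (Q : ℕ → Submodule 𝕜 E) [∀ k, FiniteDimensional 𝕜 (Q k)]
    (hQ : ∀ k, Module.finrank 𝕜 (Q k) ≤ k) {n : ℕ} (V : Submodule 𝕜 E) [FiniteDimensional 𝕜 V]
    (hV : Module.finrank 𝕜 V = n) :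
    ∃ e : Fin n → E, Orthonormal 𝕜 e ∧ ∀ k, e k ∈ V ∧ e k ∈ (Q k)ᗮ := by
  induction n generalizing V with
  | zero => exact ⟨Fin.elim0, ⟨fun i => i.elim0, fun i => i.elim0⟩, fun i => i.elim0⟩
  | succ n ih =>
    obtain ⟨x, hxV, hxQ, hx⟩ := exists_norm_eq_one_mem_orthogonal V (Q n)
      (by rw [hV]; exact Nat.lt_succ_of_le (hQ n))
    have hfin := Submodule.finrank_add_inf_finrank_orthogonal
      ((Submodule.span_singleton_le_iff_mem x V).2 hxV)
    rw [finrank_span_singleton (norm_ne_zero_iff.1 (hx ▸ one_ne_zero)), hV] at hfin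
    obtain ⟨e, he, heV⟩ := ih ((𝕜 ∙ x)ᗮ ⊓ V) (by omega)
    refine ⟨Fin.snoc e x, orthonormal_snoc he hx fun k =>
      Submodule.mem_orthogonal_singleton_iff_inner_left.1 (heV k).1.1, Fin.lastCases ?_ fun k => ?_⟩
    · simpa using ⟨hxV, hxQ⟩
    · simpa using ⟨(heV k).1.2, (heV k).2⟩

/-- Weyl's inequality: expand the determinant in an orthonormal basis whose `k`-th vector is
orthogonal to `Q k`. -/
theorem norm_det_restrict_le_prod (A : Module.End 𝕜 E) (Q : ℕ → Submodule 𝕜 E)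
    [∀ k, FiniteDimensional 𝕜 (Q k)] (hQ : ∀ k, Module.finrank 𝕜 (Q k) ≤ k) (s : ℕ → ℝ)
    (hs : ∀ k, ∀ x ∈ (Q k)ᗮ, ‖A x‖ ≤ s k * ‖x‖) (V : Submodule 𝕜 E) [FiniteDimensional 𝕜 V]
    (hV : ∀ x ∈ V, A x ∈ V) :
    ‖LinearMap.det (A.restrict hV)‖ ≤ ∏ k ∈ Finset.range (Module.finrank 𝕜 V), s k := by
  obtain ⟨e, he, heV⟩ := exists_orthonormal_mem_orthogonal Q hQ V rfl
  let e' : Fin (Module.finrank 𝕜 V) → V := fun k => ⟨e k, (heV k).1⟩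
  have he' : Orthonormal 𝕜 e' := ⟨he.1, fun _ _ hij => he.2 hij⟩
  let b : OrthonormalBasis (Fin (Module.finrank 𝕜 V)) 𝕜 V :=
    OrthonormalBasis.mk he'
      (he'.linearIndependent.span_eq_top_of_card_eq_finrank' (Fintype.card_fin _)).ge
  have hb : ⇑b = e' := OrthonormalBasis.coe_mk he' _
  calc ‖LinearMap.det (A.restrict hV)‖ = ‖b.toBasis.det fun k => A.restrict hV (b k)‖ := by
        rw [← LinearMap.det_toMatrix b.toBasis, Module.Basis.det_apply]
        congr 2
        ext i j
        simp [LinearMap.toMatrix_apply, Module.Basis.toMatrix_apply]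
    _ ≤ ∏ k, ‖A.restrict hV (b k)‖ := norm_det_le_prod_norm b _
    _ ≤ ∏ k : Fin (Module.finrank 𝕜 V), s k :=
        Finset.prod_le_prod (fun _ _ => norm_nonneg _) fun k _ => by
          simpa [hb, e', he.1 k] using hs k (e k) (heV k).2
    _ = ∏ k ∈ Finset.range (Module.finrank 𝕜 V), s k := Fin.prod_univ_eq_prod_range s _

end Determinant

/-! ### Eigenvalue sequences -/

theorem pow_card_le_norm_prod {K : Type*} [NormedField K] {t : ℝ} (ht : 0 ≤ t) (m : Multiset K)
    (hm : ∀ μ ∈ m, t ≤ ‖μ‖) : t ^ m.card ≤ ‖m.prod‖ := by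
  induction m using Multiset.induction_on with
  | empty => simp
  | cons a m ih =>
    rw [Multiset.card_cons, Multiset.prod_cons, norm_mul, pow_succ']
    exact mul_le_mul (hm a (m.mem_cons_self a)) (ih fun μ hμ => hm μ (Multiset.mem_cons_of_mem hμ))
      (by positivity) (norm_nonneg _)

theorem pow_finrank_le_norm_det {K V : Type*} [NormedField K] [IsAlgClosed K] [AddCommGroup V]
    [Module K V] [FiniteDimensional K V] (A : Module.End K V) {t : ℝ} (ht : 0 ≤ t)
    (h : ∀ μ, A.HasEigenvalue μ → t ≤ ‖μ‖) : t ^ Module.finrank K V ≤ ‖LinearMap.det A‖ := by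
  have hsplits : A.charpoly.Splits := IsAlgClosed.splits _
  rw [Module.End.det_eq_prod_roots_charpoly_of_splits hsplits, ← LinearMap.charpoly_natDegree A,
    hsplits.natDegree_eq_card_roots]
  exact pow_card_le_norm_prod ht _ fun μ hμ =>
    h μ ((A.hasEigenvalue_iff_isRoot_charpoly μ).2 (Polynomial.mem_roots'.1 hμ).2)

theorem finrank_biSup_of_iSupIndep {K V ι : Type*} [Field K] [AddCommGroup V] [Module K V]
    {p : ι → Submodule K V} (hp : iSupIndep p) (S : Finset ι)
    (hS : ∀ i ∈ S, FiniteDimensional K (p i)) :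
    Module.finrank K (⨆ i ∈ S, p i : Submodule K V) = ∑ i ∈ S, Module.finrank K (p i) := by
  classical
  induction S using Finset.induction_on with
  | empty =>
    have : (⨆ i ∈ (∅ : Finset ι), p i) = ⊥ := by simp
    rw [this, finrank_bot, Finset.sum_empty]
  | insert a S ha ih =>
    have hS' : ∀ i ∈ S, FiniteDimensional K (p i) := fun i hi => hS i (Finset.mem_insert_of_mem hi)
    have : FiniteDimensional K (p a) := hS a (Finset.mem_insert_self a S)
    have : FiniteDimensional K (⨆ i ∈ S, p i : Submodule K V) :=
      Module.Finite.iff_fg.2 (Submodule.fg_biSup S p fun i hi => Module.Finite.iff_fg.1 (hS' i hi))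
    have hdisj : Disjoint (p a) (⨆ i ∈ S, p i) := hp.disjoint_biSup (y := (S : Set ι)) ha
    rw [Finset.iSup_insert, Finset.sum_insert ha, ← ih hS',
      ← Submodule.finrank_sup_add_finrank_inf_eq, hdisj.eq_bot, finrank_bot, add_zero]

section GenEigenspace

variable {K V : Type*} [Field K] [AddCommGroup V] [Module K V] (A : Module.End K V)

theorem apply_mem_biSup_maxGenEigenspace (S : Finset K) {x : V}
    (hx : x ∈ (⨆ μ ∈ S, A.maxGenEigenspace μ : Submodule K V)) :
    A x ∈ (⨆ μ ∈ S, A.maxGenEigenspace μ : Submodule K V) := by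
  suffices (⨆ μ ∈ S, A.maxGenEigenspace μ : Submodule K V) ≤
      (⨆ μ ∈ S, A.maxGenEigenspace μ : Submodule K V).comap A from this hx
  exact iSup₂_le fun μ hμ x hx => le_iSup₂_of_le (f := fun μ (_ : μ ∈ S) => A.maxGenEigenspace μ)
    μ hμ le_rfl (Module.End.mapsTo_maxGenEigenspace_of_comm (Commute.refl A) μ hx)

variable {A} in
theorem mem_of_mem_biSup_maxGenEigenspace {S : Finset K} {x : V}
    (hx : x ∈ ⨆ μ ∈ S, A.maxGenEigenspace μ) (hx0 : x ≠ 0) {ν : K} (hν : A x = ν • x) :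
    ν ∈ S := by
  by_contra hνS
  exact hx0 (Submodule.disjoint_def.1
    (A.independent_maxGenEigenspace.disjoint_biSup (y := (S : Set K)) hνS) x
    (Module.End.eigenspace_le_maxGenEigenspace (Module.End.mem_eigenspace_iff.2 hν)) hx)

variable {A} in
theorem exists_invariant_of_mem_maxGenEigenspace {μ : K} {x : V} (hx : x ∈ A.maxGenEigenspace μ) :
    ∃ U : Submodule K V, FiniteDimensional K U ∧ (∀ y ∈ U, A y ∈ U) ∧ x ∈ U ∧
      U ≤ A.maxGenEigenspace μ := by
  let B := A - μ • (1 : Module.End K V)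
  obtain ⟨k, hk⟩ := (Module.End.mem_maxGenEigenspace A μ x).1 hx
  let orbit : ℕ → V := fun j => (B ^ j) x
  have orbit_eq_zero : ∀ j, k ≤ j → orbit j = 0 := fun j hj => by
    change (B ^ j) x = 0
    rw [← Nat.sub_add_cancel hj, pow_add, Module.End.mul_apply, hk, map_zero]
  have orbit_succ : ∀ j, B (orbit j) = orbit (j + 1) := fun j => by
    simp only [orbit, pow_succ', Module.End.mul_apply]
  have finite_range : (Set.range orbit).Finite :=
    (((Set.finite_Iio k).image orbit).insert 0).subset <| Set.range_subset_iff.2 fun j =>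
      (lt_or_ge j k).elim (fun hj => .inr ⟨j, hj, rfl⟩) fun hj => .inl (orbit_eq_zero j hj)
  have B_mem : Submodule.span K (Set.range orbit) ≤ (Submodule.span K (Set.range orbit)).comap B :=
    Submodule.span_le.2 <| Set.range_subset_iff.2 fun j =>
      Submodule.subset_span ⟨j + 1, (orbit_succ j).symm⟩
  refine ⟨Submodule.span K (Set.range orbit), FiniteDimensional.span_of_finite K finite_range,
    fun y hy => ?_, Submodule.subset_span ⟨0, rfl⟩, Submodule.span_le.2 <| Set.range_subset_iff.2
    fun j => ?_⟩
  · have : A y = B y + μ • y := by simp [B]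
    exact this ▸ add_mem (B_mem hy) (Submodule.smul_mem _ μ hy)
  · have comm : Commute A (B ^ j) :=
      (((Commute.refl A).sub_right ((Commute.one_right A).smul_right μ))).pow_right j
    exact Module.End.mapsTo_maxGenEigenspace_of_comm comm μ hx

variable {A} in
theorem exists_invariant_of_subset_maxGenEigenspace {μ : K} (S : Finset V)
    (hS : (S : Set V) ⊆ A.maxGenEigenspace μ) :
    ∃ U : Submodule K V, FiniteDimensional K U ∧ (∀ y ∈ U, A y ∈ U) ∧ (S : Set V) ⊆ U ∧
      U ≤ A.maxGenEigenspace μ := by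
  classical
  induction S using Finset.induction_on with
  | empty => exact ⟨⊥, inferInstance, by simp, by simp, bot_le⟩
  | insert x S _ ih =>
    rw [Finset.coe_insert, Set.insert_subset_iff] at hS
    obtain ⟨U, _, hAU, hSU, hU⟩ := ih hS.2
    obtain ⟨U', _, hAU', hxU', hU'⟩ := exists_invariant_of_mem_maxGenEigenspace hS.1
    refine ⟨U' ⊔ U, inferInstance, fun y hy => ?_, ?_, sup_le hU' hU⟩
    · obtain ⟨a, ha, b, hb, rfl⟩ := Submodule.mem_sup.1 hy
      rw [map_add]
      exact Submodule.add_mem_sup (hAU' a ha) (hAU b hb)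
    · rw [Finset.coe_insert, Set.insert_subset_iff]
      exact ⟨le_sup_left (a := U') hxU', hSU.trans (le_sup_right (a := U'))⟩

variable {A} in
theorem finiteDimensional_maxGenEigenspace_of_finrank_le {μ : K} {N : ℕ}
    (hN : ∀ (U : Submodule K V) [FiniteDimensional K U], (∀ x ∈ U, A x ∈ U) →
      U ≤ A.maxGenEigenspace μ → Module.finrank K U ≤ N) :
    FiniteDimensional K (A.maxGenEigenspace μ) := by
  refine Module.rank_lt_aleph0_iff.1 (lt_of_le_of_lt (rank_le fun S hS => ?_)
    (Cardinal.natCast_lt_aleph0 (n := N)))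
  obtain ⟨U, _, hAU, hSU, hU⟩ := exists_invariant_of_subset_maxGenEigenspace (A := A) (μ := μ)
    (S.map (Function.Embedding.subtype _)) fun _ hx => by
      obtain ⟨y, -, rfl⟩ := Finset.mem_map.1 hx
      exact y.2
  have hlin : LinearIndependent K fun x : S =>
      (⟨(x : A.maxGenEigenspace μ), hSU (by simp)⟩ : U) :=
    LinearIndependent.of_comp U.subtype
      (hS.map' (A.maxGenEigenspace μ).subtype (Submodule.ker_subtype _))
  calc S.card = Fintype.card S := (Fintype.card_coe S).symm
    _ ≤ Module.finrank K U := hlin.fintype_card_le_finrank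
    _ ≤ N := hN U hAU hU

end GenEigenspace

/-- Weyl's bound with the numbers `s k`, as a property of the abstract endomorphism `A`: the
determinant of `A` on an `N`-dimensional invariant subspace is at most `s 0 * ⋯ * s (N - 1)`. This
is all that the eigenvalue estimates use of approximation numbers. -/
def HasWeylBound {V : Type*} [AddCommGroup V] [Module ℂ V] (A : Module.End ℂ V) (s : ℕ → ℝ) :
    Prop :=
  ∀ (U : Submodule ℂ V) [FiniteDimensional ℂ U] (hU : ∀ x ∈ U, A x ∈ U),
    ‖LinearMap.det (A.restrict hU)‖ ≤ ∏ k ∈ Finset.range (Module.finrank ℂ U), s k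

theorem pow_le_prod_of_antitone {s : ℕ → ℝ} (hs0 : ∀ k, 0 ≤ s k) (hs : Antitone s) {t : ℝ}
    (ht : 0 < t) {n N : ℕ} (hn : n ≤ N) (h : t ^ N ≤ ∏ k ∈ Finset.range N, s k) :
    t ^ n ≤ ∏ k ∈ Finset.range n, s k := by
  rcases le_total t (s n) with hts | hst
  · simpa using Finset.prod_le_prod (s := Finset.range n) (fun _ _ => ht.le) fun k hk =>
      hts.trans (hs (Finset.mem_range.1 hk).le)
  · obtain ⟨j, rfl⟩ := Nat.exists_eq_add_of_le hn
    have tail_le : ∏ k ∈ Finset.range j, s (n + k) ≤ t ^ j := by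
      simpa using Finset.prod_le_prod (s := Finset.range j) (fun k _ => hs0 (n + k)) fun k _ =>
        (hs (Nat.le_add_right n k)).trans hst
    refine le_of_mul_le_mul_right ?_ (pow_pos ht j)
    calc t ^ n * t ^ j = t ^ (n + j) := (pow_add t n j).symm
      _ ≤ (∏ k ∈ Finset.range n, s k) * ∏ k ∈ Finset.range j, s (n + k) := by
        rwa [← Finset.prod_range_add]
      _ ≤ (∏ k ∈ Finset.range n, s k) * t ^ j :=
        mul_le_mul_of_nonneg_left tail_le (Finset.prod_nonneg fun k _ => hs0 k)

theorem exists_prod_range_lt_pow {s : ℕ → ℝ} (hs0 : ∀ k, 0 ≤ s k) (hs : Tendsto s atTop (𝓝 0))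
    {t : ℝ} (ht : 0 < t) : ∃ N, ∀ n, N < n → ∏ k ∈ Finset.range n, s k < t ^ n := by
  obtain ⟨K, hK⟩ := eventually_atTop.1 (hs.eventually (gt_mem_nhds (half_pos ht)))
  obtain ⟨M, hM⟩ := pow_unbounded_of_one_lt ((∏ k ∈ Finset.range K, s k) / t ^ K) one_lt_two
  rw [div_lt_iff₀ (pow_pos ht K)] at hM
  refine ⟨K + M, fun n hn => ?_⟩
  obtain ⟨j, rfl⟩ := Nat.exists_eq_add_of_le ((Nat.le_add_right K M).trans hn.le)
  calc ∏ k ∈ Finset.range (K + j), s k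
      = (∏ k ∈ Finset.range K, s k) * ∏ k ∈ Finset.range j, s (K + k) :=
        Finset.prod_range_add s K j
    _ ≤ (∏ k ∈ Finset.range K, s k) * ∏ _k ∈ Finset.range j, t / 2 := by
        gcongr
        · exact Finset.prod_nonneg fun k _ => hs0 k
        · exact fun k _ => hs0 (K + k)
        · exact (hK _ (Nat.le_add_right K _)).le
    _ < 2 ^ M * t ^ K * (t / 2) ^ j := by
        rw [Finset.prod_const, Finset.card_range]
        gcongr
    _ ≤ 2 ^ j * t ^ K * (t / 2) ^ j := by
        gcongr
        · exact one_le_two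
        · omega
    _ = t ^ (K + j) := by rw [div_pow, pow_add]; field_simp

section WeylBound

variable {V : Type*} [AddCommGroup V] [Module ℂ V] {A : Module.End ℂ V} {s : ℕ → ℝ}

theorem HasWeylBound.pow_finrank_le (h : HasWeylBound A s) (U : Submodule ℂ V)
    [FiniteDimensional ℂ U] (hU : ∀ x ∈ U, A x ∈ U) {t : ℝ} (ht : 0 ≤ t)
    (hUt : ∀ μ : ℂ, ∀ x ∈ U, x ≠ 0 → A x = μ • x → t ≤ ‖μ‖) :
    t ^ Module.finrank ℂ U ≤ ∏ k ∈ Finset.range (Module.finrank ℂ U), s k := by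
  refine (pow_finrank_le_norm_det (A.restrict hU) ht fun μ hμ => ?_).trans (h U hU)
  obtain ⟨x, hx⟩ := hμ.exists_hasEigenvector
  exact hUt μ x x.2 (Submodule.coe_eq_zero.not.2 hx.2) (congrArg Subtype.val hx.apply_eq_smul)

theorem HasWeylBound.exists_finrank_le (h : HasWeylBound A s) (hs0 : ∀ k, 0 ≤ s k)
    (hs : Tendsto s atTop (𝓝 0)) {t : ℝ} (ht : 0 < t) :
    ∃ N : ℕ, ∀ (U : Submodule ℂ V) [FiniteDimensional ℂ U], (∀ x ∈ U, A x ∈ U) →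
      (∀ μ : ℂ, ∀ x ∈ U, x ≠ 0 → A x = μ • x → t ≤ ‖μ‖) → Module.finrank ℂ U ≤ N := by
  obtain ⟨N, hN⟩ := exists_prod_range_lt_pow hs0 hs ht
  exact ⟨N, fun U _ hU hUt => not_lt.1 fun hlt =>
    (hN _ hlt).not_ge (h.pow_finrank_le U hU ht.le hUt)⟩

theorem HasWeylBound.finiteDimensional_maxGenEigenspace (h : HasWeylBound A s)
    (hs0 : ∀ k, 0 ≤ s k) (hs : Tendsto s atTop (𝓝 0)) {μ : ℂ} (hμ : μ ≠ 0) :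
    FiniteDimensional ℂ (A.maxGenEigenspace μ) := by
  obtain ⟨N, hN⟩ := h.exists_finrank_le hs0 hs (norm_pos_iff.2 hμ)
  refine finiteDimensional_maxGenEigenspace_of_finrank_le fun U _ hAU hU =>
    hN U hAU fun ν x hx hx0 hν => ?_
  have hmem : x ∈ ⨆ κ ∈ ({μ} : Finset ℂ), A.maxGenEigenspace κ := by simpa using hU hx
  rw [Finset.mem_singleton.1 (mem_of_mem_biSup_maxGenEigenspace hmem hx0 hν)]

theorem HasWeylBound.finite_setOf_le_norm (h : HasWeylBound A s)
    (hs0 : ∀ k, 0 ≤ s k) (hs : Tendsto s atTop (𝓝 0)) {t : ℝ} (ht : 0 < t) :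
    {μ : ℂ | t ≤ ‖μ‖ ∧ Module.finrank ℂ (A.maxGenEigenspace μ) ≠ 0}.Finite := by
  obtain ⟨N, hN⟩ := h.exists_finrank_le hs0 hs ht
  by_contra hinf
  obtain ⟨S, hS, hcard⟩ := Set.Infinite.exists_subset_card_eq hinf (N + 1)
  have hfd : ∀ μ ∈ S, FiniteDimensional ℂ (A.maxGenEigenspace μ) := fun μ hμ =>
    h.finiteDimensional_maxGenEigenspace hs0 hs (norm_pos_iff.1 (ht.trans_le (hS hμ).1))
  have : FiniteDimensional ℂ (⨆ μ ∈ S, A.maxGenEigenspace μ : Submodule ℂ V) :=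
    Module.Finite.iff_fg.2 (Submodule.fg_biSup S _ fun μ hμ => Module.Finite.iff_fg.1 (hfd μ hμ))
  have card_le : S.card ≤ N := calc
    S.card = ∑ μ ∈ S, 1 := by simp
    _ ≤ ∑ μ ∈ S, Module.finrank ℂ (A.maxGenEigenspace μ) :=
      Finset.sum_le_sum fun μ hμ => Nat.one_le_iff_ne_zero.2 (hS hμ).2
    _ = Module.finrank ℂ (⨆ μ ∈ S, A.maxGenEigenspace μ : Submodule ℂ V) :=
      (finrank_biSup_of_iSupIndep A.independent_maxGenEigenspace S hfd).symm
    _ ≤ N := hN _ (fun _ => apply_mem_biSup_maxGenEigenspace A S) fun ν x hx hx0 hν =>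
      (hS (mem_of_mem_biSup_maxGenEigenspace hx hx0 hν)).1
  omega

theorem algMultiplicity_eq_finrank (A : Module.End ℂ V) (μ : ℂ)
    [FiniteDimensional ℂ (A.maxGenEigenspace μ)] :
    algMultiplicity A μ = Module.finrank ℂ (A.maxGenEigenspace μ) := by
  rw [algMultiplicity, ← Module.finrank_eq_rank, Cardinal.toENat_nat]

theorem card_le_sum_finrank_of_isEigenvalueSequence {ev : ℕ → ℂ} (hev : IsEigenvalueSequence A ev)
    (I : Finset ℕ) (h0 : ∀ n ∈ I, ev n ≠ 0)
    (hfd : ∀ n ∈ I, FiniteDimensional ℂ (A.maxGenEigenspace (ev n))) :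
    I.card ≤ ∑ μ ∈ I.image ev, Module.finrank ℂ (A.maxGenEigenspace μ) := by
  rw [Finset.card_eq_sum_card_image ev]
  refine Finset.sum_le_sum fun μ hμ => ?_
  obtain ⟨n, hn, rfl⟩ := Finset.mem_image.1 hμ
  have := hfd n hn
  have hle : (({k ∈ I | ev k = ev n} : Finset ℕ) : Set ℕ).encard ≤ {k | ev k = ev n}.encard :=
    Set.encard_le_encard fun k hk => (Finset.mem_filter.1 hk).2
  rw [hev.2 _ (h0 n hn), algMultiplicity_eq_finrank, Set.encard_coe_eq_coe_finsetCard] at hle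
  exact_mod_cast hle

theorem HasWeylBound.norm_pow_le_prod (h : HasWeylBound A s) (hs0 : ∀ k, 0 ≤ s k)
    (hsa : Antitone s) (hs : Tendsto s atTop (𝓝 0)) {ev : ℕ → ℂ} (hev : IsEigenvalueSequence A ev)
    (n : ℕ) : ‖ev n‖ ^ (n + 1) ≤ ∏ k ∈ Finset.range (n + 1), s k := by
  rcases eq_or_ne (ev n) 0 with h0 | h0
  · rw [h0, norm_zero, zero_pow n.succ_ne_zero]
    exact Finset.prod_nonneg fun k _ => hs0 k
  have ht : 0 < ‖ev n‖ := norm_pos_iff.2 h0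
  have norm_le : ∀ k ∈ Finset.range (n + 1), ‖ev n‖ ≤ ‖ev k‖ := fun k hk =>
    hev.1 (Nat.lt_succ_iff.1 (Finset.mem_range.1 hk))
  have ne_zero : ∀ k ∈ Finset.range (n + 1), ev k ≠ 0 := fun k hk =>
    norm_pos_iff.1 (ht.trans_le (norm_le k hk))
  have hfd : ∀ k ∈ Finset.range (n + 1), FiniteDimensional ℂ (A.maxGenEigenspace (ev k)) :=
    fun k hk => h.finiteDimensional_maxGenEigenspace hs0 hs (ne_zero k hk)
  let S := (Finset.range (n + 1)).image ev
  have hfdS : ∀ μ ∈ S, FiniteDimensional ℂ (A.maxGenEigenspace μ) :=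
    Finset.forall_mem_image.2 hfd
  let U : Submodule ℂ V := ⨆ μ ∈ S, A.maxGenEigenspace μ
  have : FiniteDimensional ℂ U :=
    Module.Finite.iff_fg.2 (Submodule.fg_biSup S _ fun μ hμ => Module.Finite.iff_fg.1 (hfdS μ hμ))
  have le_finrank : n + 1 ≤ Module.finrank ℂ U := calc
    n + 1 = (Finset.range (n + 1)).card := (Finset.card_range _).symm
    _ ≤ ∑ μ ∈ S, Module.finrank ℂ (A.maxGenEigenspace μ) :=
      card_le_sum_finrank_of_isEigenvalueSequence hev _ ne_zero hfd
    _ = Module.finrank ℂ U :=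
      (finrank_biSup_of_iSupIndep A.independent_maxGenEigenspace S hfdS).symm
  exact pow_le_prod_of_antitone hs0 hsa ht le_finrank <|
    h.pow_finrank_le U (fun _ => apply_mem_biSup_maxGenEigenspace A S) ht.le fun ν x hx hx0 hν =>
      (Finset.forall_mem_image (p := fun μ => ‖ev n‖ ≤ ‖μ‖)).2 norm_le ν
        (mem_of_mem_biSup_maxGenEigenspace hx hx0 hν)

end WeylBound

theorem exists_strictMono_isLowerSet_range {α : Type*} [LinearOrder α]
    (h : ∀ a : α, (Set.Iio a).Finite) :
    ∃ rank : α → ℕ, StrictMono rank ∧ IsLowerSet (Set.range rank) := by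
  let rank : α → ℕ := fun a => (Set.Iio a).ncard
  have hmono : StrictMono rank := fun a b hab =>
    Set.ncard_lt_ncard (Set.Iio_ssubset_Iio_iff.2 hab) (h b)
  have image_Iio : ∀ a, rank '' Set.Iio a = Set.Iio (rank a) := fun a =>
    Set.eq_of_subset_of_ncard_le (Set.image_subset_iff.2 fun _ hb => hmono hb) <| by
      rw [Set.ncard_image_of_injective _ hmono.injective, Set.ncard_Iio_nat]
  refine ⟨rank, hmono, ?_⟩
  rintro _ n hn ⟨a, rfl⟩
  rcases hn.eq_or_lt with rfl | hlt
  · exact ⟨a, rfl⟩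
  · obtain ⟨b, -, rfl⟩ := (image_Iio a).ge hlt
    exact ⟨b, rfl⟩

/- Ties of `f` are broken by an arbitrary well-ordering. -/
theorem exists_injective_rank_of_finite_setOf_le {α : Type*} (f : α → ℝ)
    (hf : ∀ a, {b | f a ≤ f b}.Finite) :
    ∃ rank : α → ℕ, Function.Injective rank ∧ IsLowerSet (Set.range rank) ∧
      ∀ a b, rank a ≤ rank b → f b ≤ f a := by
  let key : α → ℝ ×ₗ Cardinal := fun a => toLex (-f a, embeddingToCardinal a)
  have key_injective : Function.Injective key := fun a b hab =>
    embeddingToCardinal.injective (congrArg Prod.snd (toLex.injective hab))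
  let _ : LinearOrder α := LinearOrder.lift' key key_injective
  have antitone_f : Antitone f := fun a b hab =>
    neg_le_neg_iff.1 (Prod.Lex.monotone_fst (key a) (key b) hab)
  obtain ⟨rank, hrank, hrange⟩ := exists_strictMono_isLowerSet_range fun a : α =>
    (hf a).subset fun b hb => antitone_f (le_of_lt hb)
  exact ⟨rank, hrank.injective, hrange, fun a b hab => antitone_f (hrank.le_iff_le.1 hab)⟩

theorem exists_antitone_norm_encard_eq {E : Type*} [NormedAddCommGroup E] (m : E → ℕ)
    (hm : ∀ t : ℝ, 0 < t → {x : E | t ≤ ‖x‖ ∧ m x ≠ 0}.Finite) :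
    ∃ ev : ℕ → E, Antitone (fun n => ‖ev n‖) ∧ ∀ x : E, x ≠ 0 → {n | ev n = x}.encard = m x := by
  let S := Σ x : {x : E // x ≠ 0}, Fin (m x)
  have finite_superlevel : ∀ p : S, {q : S | ‖(p.1 : E)‖ ≤ ‖(q.1 : E)‖}.Finite := fun p => by
    have hfin : {x : {x : E // x ≠ 0} | ‖(p.1 : E)‖ ≤ ‖(x : E)‖ ∧ m x ≠ 0}.Finite :=
      (hm _ (norm_pos_iff.2 p.1.2)).preimage Subtype.val_injective.injOn
    exact (hfin.preimage' (f := Sigma.fst) fun x _ =>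
      Set.range_sigmaMk (α := fun x : {x : E // x ≠ 0} => Fin (m x)) x ▸
        Set.finite_range (Sigma.mk x)).subset fun q hq => ⟨hq, q.2.pos.ne'⟩
  obtain ⟨rank, rank_injective, range_lower, norm_le⟩ :=
    exists_injective_rank_of_finite_setOf_le (fun p : S => ‖(p.1 : E)‖) finite_superlevel
  let ev : ℕ → E := Function.extend rank (fun p => (p.1 : E)) 0
  have ev_rank : ∀ p, ev (rank p) = p.1 := rank_injective.extend_apply _ _
  have ev_eq_zero : ∀ n, n ∉ Set.range rank → ev n = 0 := Function.extend_apply' _ _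
  refine ⟨ev, fun k n hkn => ?_, fun x hx => ?_⟩
  · by_cases hn : n ∈ Set.range rank
    · obtain ⟨q, rfl⟩ := hn
      obtain ⟨p, rfl⟩ := range_lower hkn ⟨q, rfl⟩
      simpa only [ev_rank] using norm_le p q hkn
    · simp only [ev_eq_zero n hn, norm_zero, norm_nonneg]
  · have fiber : {n | ev n = x} = Set.range fun k : Fin (m x) => rank ⟨⟨x, hx⟩, k⟩ := by
      refine Set.Subset.antisymm (fun n hn => ?_) (Set.range_subset_iff.2 fun k => ev_rank _)
      have : n ∈ Set.range rank := not_not.1 fun h => hx (hn.symm.trans (ev_eq_zero n h))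
      obtain ⟨⟨⟨y, hy⟩, k⟩, rfl⟩ := this
      obtain rfl : y = x := (ev_rank _).symm.trans hn
      exact ⟨k, rfl⟩
    have : Function.Injective fun k : Fin (m x) => rank ⟨⟨x, hx⟩, k⟩ :=
      rank_injective.comp sigma_mk_injective
    rw [fiber, ← Set.image_univ, this.encard_image, Set.encard_univ, ENat.card_eq_coe_fintype_card,
      Fintype.card_fin]

theorem HasWeylBound.exists_isEigenvalueSequence {V : Type*} [AddCommGroup V] [Module ℂ V]
    {A : Module.End ℂ V} {s : ℕ → ℝ} (h : HasWeylBound A s) (hs0 : ∀ k, 0 ≤ s k)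
    (hs : Tendsto s atTop (𝓝 0)) : ∃ ev : ℕ → ℂ, IsEigenvalueSequence A ev := by
  obtain ⟨ev, hanti, hev⟩ := exists_antitone_norm_encard_eq
    (fun μ => Module.finrank ℂ (A.maxGenEigenspace μ)) fun t ht => h.finite_setOf_le_norm hs0 hs ht
  refine ⟨ev, hanti, fun μ hμ => ?_⟩
  have := h.finiteDimensional_maxGenEigenspace hs0 hs hμ
  rw [hev μ hμ, algMultiplicity_eq_finrank]

/-! ### Estimates for the approximation numbers -/

/- Bernoulli's inequality for the base `1 - 1 / (x + 1)`. -/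
theorem rpow_add_one_div_lt {p : ℝ} (hp : 0 < p) {x : ℝ} (hx : 0 ≤ x) :
    (x + 1) ^ (1 + p) / (1 + p) < x ^ (1 + p) / (1 + p) + (x + 1) ^ p := by
  have hx1 : 0 < x + 1 := by linarith
  have bernoulli : 1 + (1 + p) * -(1 / (x + 1)) < (1 + -(1 / (x + 1))) ^ (1 + p) :=
    one_add_mul_self_lt_rpow_one_add (by rw [neg_le_neg_iff, div_le_one hx1]; linarith)
      (neg_ne_zero.2 (one_div_ne_zero hx1.ne')) (by linarith)
  have base_eq : 1 + -(1 / (x + 1)) = x / (x + 1) := by field_simp; ring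
  have rpow_succ : (x + 1) ^ (1 + p) = (x + 1) * (x + 1) ^ p := by
    rw [Real.rpow_add hx1, Real.rpow_one]
  rw [base_eq, Real.div_rpow hx hx1.le, lt_div_iff₀ (by positivity)] at bernoulli
  have lhs_eq : (1 + (1 + p) * -(1 / (x + 1))) * (x + 1) ^ (1 + p) =
      (x + 1) ^ (1 + p) - (1 + p) * (x + 1) ^ p := by
    rw [rpow_succ]; field_simp; ring
  rw [div_lt_iff₀ (by linarith), add_mul, div_mul_cancel₀ _ (by linarith)]
  linarith

theorem rpow_div_lt_sum_rpow {p : ℝ} (hp : 0 < p) {n : ℕ} (hn : 1 ≤ n) :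
    (n : ℝ) ^ (1 + p) / (1 + p) < ∑ k ∈ Finset.range n, ((k : ℝ) + 1) ^ p := by
  induction n, hn using Nat.le_induction with
  | base =>
    have h := rpow_add_one_div_lt hp le_rfl
    simpa [Real.zero_rpow (show 1 + p ≠ 0 by linarith)] using h
  | succ n _ ih =>
    have h := rpow_add_one_div_lt hp n.cast_nonneg
    rw [Finset.sum_range_succ]
    push_cast
    linarith

theorem choose_add_add_le_mul (j m e : ℕ) :
    (j + m + e).choose e ≤ (m + e).choose e * (j + e).choose e := by
  induction e with
  | zero => simp
  | succ e ih =>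
    have choose_succ : ∀ a : ℕ,
        (a + (e + 1)).choose (e + 1) * (e + 1) = (a + e + 1) * (a + e).choose e :=
      fun a => (Nat.add_one_mul_choose_eq (a + e) e).symm
    refine le_of_mul_le_mul_right ?_ (show 0 < (e + 1) * (e + 1) by positivity)
    calc (j + m + (e + 1)).choose (e + 1) * ((e + 1) * (e + 1))
        = (j + m + e + 1) * (e + 1) * (j + m + e).choose e := by
          rw [← mul_assoc, choose_succ]; ring
      _ ≤ ((m + e + 1) * (j + e + 1)) * ((m + e).choose e * (j + e).choose e) := by
          refine Nat.mul_le_mul ?_ ih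
          nlinarith [Nat.zero_le (j * m)]
      _ = ((m + (e + 1)).choose (e + 1) * (e + 1)) * ((j + (e + 1)).choose (e + 1) * (e + 1)) := by
          rw [choose_succ, choose_succ]; ring
      _ = _ := by ring

theorem choose_add_le_mul_pow {m : ℕ} (hm : 1 ≤ m) (e : ℕ) :
    (m + e).choose e ≤ (e + 1) * m ^ e := by
  induction e with
  | zero => simp
  | succ e ih =>
    refine le_of_mul_le_mul_right ?_ (show 0 < e + 1 by positivity)
    calc (m + (e + 1)).choose (e + 1) * (e + 1)
        = (m + e + 1) * (m + e).choose e := (Nat.add_one_mul_choose_eq (m + e) e).symm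
      _ ≤ ((e + 2) * m) * ((e + 1) * m ^ e) := by
          refine Nat.mul_le_mul ?_ ih
          nlinarith
      _ = _ := by ring

theorem choose_pow_le {m e N : ℕ} (hN : (m + e).choose (e + 1) < N) :
    (m + e).choose e ^ (e + 1) ≤ (e + 1) ^ (e + 1) * N ^ e := by
  rcases Nat.eq_zero_or_pos m with rfl | hm
  · simp only [zero_add, Nat.choose_self, one_pow]
    exact Nat.one_le_iff_ne_zero.2 (Nat.mul_ne_zero (by positivity) (pow_ne_zero e (by omega)))
  · have choose_succ : (m + e).choose (e + 1) * (e + 1) = (m + e).choose e * m := by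
      rw [Nat.choose_succ_right_eq, Nat.add_sub_cancel]
    calc (m + e).choose e ^ (e + 1) = (m + e).choose e ^ e * (m + e).choose e := pow_succ _ _
      _ ≤ (m + e).choose e ^ e * ((e + 1) * m ^ e) :=
          Nat.mul_le_mul le_rfl (choose_add_le_mul_pow hm e)
      _ = (e + 1) * ((m + e).choose e * m) ^ e := by rw [mul_pow]; ring
      _ = (e + 1) * ((m + e).choose (e + 1) * (e + 1)) ^ e := by rw [choose_succ]
      _ ≤ (e + 1) * (N * (e + 1)) ^ e := by gcongr
      _ = _ := by rw [mul_pow]; ring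

/-- The tail `∑_{j ≥ m} (j + e choose e) r ^ (2 j)` of the series of `(1 - r²)^{-(e + 1)}`. It is
the squared norm of the evaluation functional at a point of norm `r`, on the functions in the Hardy
space of the unit ball of `ℂ^(e + 1)` that vanish to order `m` at the origin. -/
noncomputable def kernelTail (e : ℕ) (r : ℝ) (m : ℕ) : ℝ :=
  ∑' j : ℕ, ((j + m + e).choose e : ℝ) * r ^ (2 * (j + m))

/-- The largest `m` such that the polynomials of degree less than `m` in `e + 1` variables form a
space of dimension at most `k`; the search may end at `k`, since that dimension is at least `m`. -/
def degreeBelow (e k : ℕ) : ℕ := Nat.findGreatest (fun m => (m + e).choose (e + 1) ≤ k) k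

section Estimates

variable {e : ℕ} {r W : ℝ}

theorem hasSum_choose_mul_sq_pow (e : ℕ) (hr0 : 0 ≤ r) (hr1 : r < 1) :
    HasSum (fun j : ℕ => ((j + e).choose e : ℝ) * r ^ (2 * j)) (1 / (1 - r ^ 2) ^ (e + 1)) := by
  have hr : ‖r ^ 2‖ < 1 := by
    rw [Real.norm_of_nonneg (sq_nonneg r)]
    exact pow_lt_one₀ hr0 hr1 two_ne_zero
  simpa only [pow_mul] using hasSum_choose_mul_geometric_of_norm_lt_one e hr

theorem kernelTail_nonneg (e : ℕ) (hr0 : 0 ≤ r) (m : ℕ) : 0 ≤ kernelTail e r m :=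
  tsum_nonneg fun _ => by positivity

theorem kernelTail_eq_sub (e : ℕ) (hr0 : 0 ≤ r) (hr1 : r < 1) (m : ℕ) :
    kernelTail e r m = (∑' j : ℕ, ((j + e).choose e : ℝ) * r ^ (2 * j)) -
      ∑ j ∈ Finset.range m, ((j + e).choose e : ℝ) * r ^ (2 * j) := by
  rw [← (hasSum_choose_mul_sq_pow e hr0 hr1).summable.sum_add_tsum_nat_add m, kernelTail]
  ring

theorem kernelTail_antitone (e : ℕ) (hr0 : 0 ≤ r) (hr1 : r < 1) : Antitone (kernelTail e r) := by
  refine antitone_nat_of_succ_le fun m => ?_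
  rw [kernelTail_eq_sub e hr0 hr1, kernelTail_eq_sub e hr0 hr1, Finset.sum_range_succ]
  have : 0 ≤ ((m + e).choose e : ℝ) * r ^ (2 * m) := by positivity
  linarith

theorem tendsto_kernelTail (e : ℕ) (r : ℝ) :
    Tendsto (kernelTail e r) atTop (𝓝 0) :=
  tendsto_sum_nat_add fun j : ℕ => ((j + e).choose e : ℝ) * r ^ (2 * j)

theorem kernelTail_le (e : ℕ) (hr0 : 0 ≤ r) (hr1 : r < 1) (m : ℕ) :
    kernelTail e r m ≤ ((m + e).choose e : ℝ) * r ^ (2 * m) / (1 - r ^ 2) ^ (e + 1) := by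
  have hsum := hasSum_choose_mul_sq_pow e hr0 hr1
  have term_le : ∀ j : ℕ, ((j + m + e).choose e : ℝ) * r ^ (2 * (j + m)) ≤
      ((m + e).choose e : ℝ) * r ^ (2 * m) * (((j + e).choose e : ℝ) * r ^ (2 * j)) := fun j => calc
    ((j + m + e).choose e : ℝ) * r ^ (2 * (j + m))
      ≤ ((m + e).choose e * (j + e).choose e) * r ^ (2 * (j + m)) := by
        gcongr
        exact_mod_cast choose_add_add_le_mul j m e
    _ = _ := by rw [mul_add, pow_add]; ring
  calc kernelTail e r m
      ≤ ∑' j : ℕ, ((m + e).choose e : ℝ) * r ^ (2 * m) *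
          (((j + e).choose e : ℝ) * r ^ (2 * j)) :=
        Summable.tsum_le_tsum term_le ((summable_nat_add_iff m).2 hsum.summable)
          (hsum.summable.mul_left _)
    _ = ((m + e).choose e : ℝ) * r ^ (2 * m) / (1 - r ^ 2) ^ (e + 1) := by
        rw [tsum_mul_left, hsum.tsum_eq, mul_one_div]

theorem le_choose_add_succ (m e : ℕ) : m ≤ (m + e).choose (e + 1) := by
  induction e with
  | zero => simp
  | succ e ih =>
    refine ih.trans ?_
    rw [← add_assoc, Nat.choose_succ_succ]
    exact Nat.le_add_right _ _

theorem choose_degreeBelow_le (e k : ℕ) : (degreeBelow e k + e).choose (e + 1) ≤ k :=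
  Nat.findGreatest_spec (P := fun m => (m + e).choose (e + 1) ≤ k) (Nat.zero_le k) (by simp)

theorem le_degreeBelow {k m : ℕ} (h : (m + e).choose (e + 1) ≤ k) : m ≤ degreeBelow e k :=
  Nat.le_findGreatest ((le_choose_add_succ m e).trans h) h

theorem lt_choose_degreeBelow (e k : ℕ) : k < (degreeBelow e k + (e + 1)).choose (e + 1) := by
  by_contra! h
  have : degreeBelow e k + 1 ≤ degreeBelow e k := le_degreeBelow (by rwa [add_assoc, add_comm 1 e])
  omega

theorem degreeBelow_mono (e : ℕ) : Monotone (degreeBelow e) := fun _ _ h =>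
  le_degreeBelow ((choose_degreeBelow_le e _).trans h)

theorem tendsto_degreeBelow (e : ℕ) : Tendsto (degreeBelow e) atTop atTop :=
  tendsto_atTop_atTop.2 fun m => ⟨(m + e).choose (e + 1), fun _ h => le_degreeBelow h⟩

theorem degreeBelow_zero (k : ℕ) : degreeBelow 0 k = k :=
  le_antisymm (Nat.findGreatest_le k) (le_degreeBelow (by simp))

theorem sqrt_kernelTail_le (hr0 : 0 ≤ r) (hr1 : r < 1) (m : ℕ) :
    √(kernelTail e r m) ≤
      √((m + e).choose e) * r ^ m / (1 - r ^ 2) ^ (((e + 1 : ℕ) : ℝ) / 2) := by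
  have hr2 : 0 < 1 - r ^ 2 := by nlinarith
  refine (Real.sqrt_le_sqrt (kernelTail_le e hr0 hr1 m)).trans (le_of_eq ?_)
  rw [Real.sqrt_div (by positivity), Real.sqrt_mul (by positivity), mul_comm 2 m, pow_mul,
    Real.sqrt_sq (by positivity), Real.sqrt_eq_rpow ((1 - r ^ 2) ^ (e + 1)),
    ← Real.rpow_natCast (1 - r ^ 2) (e + 1), ← Real.rpow_mul hr2.le]
  congr 2
  ring

theorem sqrt_choose_le {m N : ℕ} (hN : (m + e).choose (e + 1) < N) :
    √((m + e).choose e) ≤ √((e + 1 : ℕ) : ℝ) * (N : ℝ) ^ ((e : ℝ) / (2 * ((e + 1 : ℕ) : ℝ))) := by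
  have choose_le : (((m + e).choose e : ℕ) : ℝ) ≤
      ((e + 1 : ℕ) : ℝ) * (N : ℝ) ^ ((e : ℝ) / ((e + 1 : ℕ) : ℝ)) := by
    refine le_of_pow_le_pow_left₀ (n := e + 1) (Nat.succ_ne_zero e) (by positivity) ?_
    rw [mul_pow, ← Real.rpow_natCast ((N : ℝ) ^ _), ← Real.rpow_mul N.cast_nonneg,
      div_mul_cancel₀ _ (Nat.cast_ne_zero.2 (Nat.succ_ne_zero e)), Real.rpow_natCast]
    exact_mod_cast choose_pow_le hN
  refine (Real.sqrt_le_sqrt choose_le).trans_eq ?_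
  rw [Real.sqrt_mul (Nat.cast_nonneg _), Real.sqrt_eq_rpow ((N : ℝ) ^ _),
    ← Real.rpow_mul N.cast_nonneg]
  congr 2
  field_simp

theorem factorial_rpow_mul_rpow_le {m N d : ℕ} (hd : d ≠ 0) (hN : N ≤ (m + d).choose d) :
    (d.factorial : ℝ) ^ (1 / (d : ℝ)) * (N : ℝ) ^ (1 / (d : ℝ)) ≤ (m + d : ℕ) := by
  have factorial_mul_le : d.factorial * N ≤ (m + d) ^ d := calc
    d.factorial * N ≤ d.factorial * (m + d).choose d := Nat.mul_le_mul le_rfl hN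
    _ = (m + d).descFactorial d := (Nat.descFactorial_eq_factorial_mul_choose _ _).symm
    _ ≤ (m + d) ^ d := Nat.descFactorial_le_pow _ _
  calc (d.factorial : ℝ) ^ (1 / (d : ℝ)) * (N : ℝ) ^ (1 / (d : ℝ))
      = ((d.factorial : ℝ) * N) ^ (1 / (d : ℝ)) :=
        (Real.mul_rpow (Nat.cast_nonneg _) (Nat.cast_nonneg _)).symm
    _ ≤ (((m + d : ℕ) : ℝ) ^ d) ^ (1 / (d : ℝ)) := by
        gcongr
        exact_mod_cast factorial_mul_le
    _ = (m + d : ℕ) := by rw [one_div, Real.pow_rpow_inv_natCast (Nat.cast_nonneg _) hd]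

theorem pow_le_rpow_of_le_choose (hr0 : 0 < r) (hr1 : r < 1) {m N d : ℕ} (hd : d ≠ 0)
    (hN : N ≤ (m + d).choose d) :
    r ^ m ≤ (r ^ d)⁻¹ * r ^ ((d.factorial : ℝ) ^ (1 / (d : ℝ)) * (N : ℝ) ^ (1 / (d : ℝ))) := by
  rw [le_inv_mul_iff₀ (pow_pos hr0 d), mul_comm, ← pow_add, ← Real.rpow_natCast]
  exact Real.rpow_le_rpow_of_exponent_ge hr0 hr1.le (factorial_rpow_mul_rpow_le hd hN)

theorem sqrt_kernelTail_degreeBelow_le (hr0 : 0 < r) (hr1 : r < 1) (k : ℕ) :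
    √(kernelTail e r (degreeBelow e k)) ≤
      √((e + 1 : ℕ) : ℝ) / (r ^ (e + 1) * (1 - r ^ 2) ^ (((e + 1 : ℕ) : ℝ) / 2)) *
        ((k + 1 : ℕ) : ℝ) ^ ((e : ℝ) / (2 * ((e + 1 : ℕ) : ℝ))) *
          r ^ (((e + 1).factorial : ℝ) ^ (1 / ((e + 1 : ℕ) : ℝ)) *
            ((k + 1 : ℕ) : ℝ) ^ (1 / ((e + 1 : ℕ) : ℝ))) := by
  have hr2 : 0 < 1 - r ^ 2 := by nlinarith
  have choose_le := sqrt_choose_le (Nat.lt_succ_of_le (choose_degreeBelow_le e k))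
  have pow_le :=
    pow_le_rpow_of_le_choose hr0 hr1 (Nat.succ_ne_zero e) (lt_choose_degreeBelow e k)
  refine (sqrt_kernelTail_le hr0.le hr1 _).trans <| (div_le_div_of_nonneg_right
    (mul_le_mul choose_le pow_le (by positivity) (by positivity)) (by positivity)).trans_eq ?_
  simp only [Nat.succ_eq_add_one]
  rw [div_mul_eq_mul_div, div_mul_eq_mul_div]
  field_simp

/-- The bound for the `k`-th approximation number of the transfer operator in dimension `e + 1`
that comes from the orthogonal complement of the polynomials of degree less than
`degreeBelow e k`. -/
noncomputable def approxBound (e : ℕ) (W r : ℝ) (k : ℕ) : ℝ :=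
  W * √(kernelTail e r (degreeBelow e k))

theorem approxBound_nonneg (hW : 0 ≤ W) (k : ℕ) : 0 ≤ approxBound e W r k :=
  mul_nonneg hW (Real.sqrt_nonneg _)

theorem approxBound_antitone (hW : 0 ≤ W) (hr0 : 0 ≤ r) (hr1 : r < 1) :
    Antitone (approxBound e W r) := fun _ _ h =>
  mul_le_mul_of_nonneg_left
    (Real.sqrt_le_sqrt (kernelTail_antitone e hr0 hr1 (degreeBelow_mono e h))) hW

theorem tendsto_approxBound (e : ℕ) (W r : ℝ) : Tendsto (approxBound e W r) atTop (𝓝 0) := by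
  have tendsto_const_mul_sqrt :=
    ((tendsto_kernelTail e r).comp (tendsto_degreeBelow e)).sqrt.const_mul W
  rwa [Real.sqrt_zero, mul_zero] at tendsto_const_mul_sqrt

theorem prod_approxBound_le (hW : 0 ≤ W) (hr0 : 0 < r) (hr1 : r < 1) (n : ℕ) :
    ∏ k ∈ Finset.range n, approxBound e W r k ≤
      (W * √((e + 1 : ℕ) : ℝ) / (r ^ (e + 1) * (1 - r ^ 2) ^ (((e + 1 : ℕ) : ℝ) / 2)) *
        (n : ℝ) ^ ((e : ℝ) / (2 * ((e + 1 : ℕ) : ℝ)))) ^ n *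
          r ^ (((e + 1).factorial : ℝ) ^ (1 / ((e + 1 : ℕ) : ℝ)) *
            ∑ k ∈ Finset.range n, ((k : ℝ) + 1) ^ (1 / ((e + 1 : ℕ) : ℝ))) := by
  have hr2 : 0 < 1 - r ^ 2 := by nlinarith
  rw [Finset.mul_sum, Real.rpow_sum_of_pos hr0, ← Finset.card_range n, ← Finset.prod_const,
    Finset.card_range, ← Finset.prod_mul_distrib]
  refine Finset.prod_le_prod (fun k _ => approxBound_nonneg hW k) fun k hk => ?_
  have hkn : ((k + 1 : ℕ) : ℝ) ≤ n := by exact_mod_cast Finset.mem_range.1 hk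
  refine (mul_le_mul_of_nonneg_left (sqrt_kernelTail_degreeBelow_le hr0 hr1 k) hW).trans ?_
  rw [← mul_assoc, ← mul_assoc, ← mul_div_assoc]
  push_cast at hkn ⊢
  gcongr

theorem lt_eigenvalueBound (hW : 0 < W) (hr0 : 0 < r) (hr1 : r < 1) {n : ℕ} (hn : 1 ≤ n) {t : ℝ}
    (h : t ^ n ≤ ∏ k ∈ Finset.range n, approxBound e W r k) :
    t < eigenvalueBound (e + 1) W r n := by
  have hr2 : 0 < 1 - r ^ 2 := by nlinarith
  have hn0 : (0 : ℝ) < n := by exact_mod_cast hn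
  have hB : 0 ≤ eigenvalueBound (e + 1) W r n := by unfold eigenvalueBound; positivity
  refine lt_of_pow_lt_pow_left₀ n hB ((h.trans (prod_approxBound_le hW.le hr0 hr1 n)).trans_lt ?_)
  have exponent_eq : (((e + 1 : ℕ) : ℝ) - 1) / (2 * ((e + 1 : ℕ) : ℝ)) =
      e / (2 * ((e + 1 : ℕ) : ℝ)) := by
    push_cast; ring
  rw [eigenvalueBound, mul_pow _ (r ^ _), exponent_eq]
  refine mul_lt_mul_of_pos_left ?_ (by positivity)
  rw [← Real.rpow_natCast (r ^ _), ← Real.rpow_mul hr0.le]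
  refine Real.rpow_lt_rpow_of_exponent_gt hr0 hr1 ?_
  have sum_gt := rpow_div_lt_sum_rpow (p := 1 / ((e + 1 : ℕ) : ℝ)) (by positivity) hn
  refine lt_of_eq_of_lt ?_ (mul_lt_mul_of_pos_left sum_gt
    (show 0 < ((e + 1).factorial : ℝ) ^ (1 / ((e + 1 : ℕ) : ℝ)) by positivity))
  rw [Real.rpow_add hn0, Real.rpow_one]
  field_simp

theorem le_eigenvalueBound (hW : 0 ≤ W) (hr0 : 0 < r) (hr1 : r < 1) {n : ℕ} (hn : 1 ≤ n) {t : ℝ}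
    (ht : 0 ≤ t) (h : t ^ n ≤ ∏ k ∈ Finset.range n, approxBound e W r k) :
    t ≤ eigenvalueBound (e + 1) W r n := by
  rcases hW.eq_or_lt with rfl | hW
  · rw [Finset.prod_eq_zero (Finset.mem_range.2 hn) (by simp [approxBound])] at h
    have t_eq : t = 0 := eq_zero_of_pow_eq_zero (h.antisymm (by positivity))
    simp [t_eq, eigenvalueBound]
  · exact (lt_eigenvalueBound hW hr0 hr1 hn h).le

theorem approxBound_zero_le (hW : 0 ≤ W) (hr0 : 0 ≤ r) (hr1 : r < 1) (k : ℕ) :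
    approxBound 0 W r k ≤ W / √(1 - r ^ 2) * r ^ k := calc
  approxBound 0 W r k = W * √(kernelTail 0 r k) := by rw [approxBound, degreeBelow_zero]
  _ ≤ W * (√((k + 0).choose 0) * r ^ k / (1 - r ^ 2) ^ (((0 + 1 : ℕ) : ℝ) / 2)) :=
    mul_le_mul_of_nonneg_left (sqrt_kernelTail_le hr0 hr1 k) hW
  _ = W / √(1 - r ^ 2) * r ^ k := by
    rw [Nat.choose_zero_right, Nat.cast_one, Real.sqrt_one, one_mul, Real.sqrt_eq_rpow,
      mul_div_assoc', div_mul_eq_mul_div]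

theorem prod_range_pow_eq_rpow (hr0 : 0 < r) {n : ℕ} (hn : 1 ≤ n) :
    ∏ k ∈ Finset.range n, r ^ k = (r ^ (((n : ℝ) - 1) / 2)) ^ n := by
  have sum_mul_two : ((∑ k ∈ Finset.range n, k : ℕ) : ℝ) * 2 = n * (n - 1) := by
    rw [← Nat.cast_pred hn]
    exact_mod_cast Finset.sum_range_id_mul_two n
  rw [Finset.prod_pow_eq_pow_sum, ← Real.rpow_natCast (r ^ _) n, ← Real.rpow_mul hr0.le,
    ← Real.rpow_natCast r]
  congr 1
  linarith

theorem le_of_pow_le_prod_approxBound_zero (hW : 0 ≤ W) (hr0 : 0 < r) (hr1 : r < 1) {n : ℕ}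
    (hn : 1 ≤ n) {t : ℝ} (h : t ^ n ≤ ∏ k ∈ Finset.range n, approxBound 0 W r k) :
    t ≤ W / √(1 - r ^ 2) * r ^ (((n : ℝ) - 1) / 2) := by
  refine le_of_pow_le_pow_left₀ (Nat.one_le_iff_ne_zero.1 hn) (by positivity) (h.trans ?_)
  calc ∏ k ∈ Finset.range n, approxBound 0 W r k
      ≤ ∏ k ∈ Finset.range n, W / √(1 - r ^ 2) * r ^ k :=
        Finset.prod_le_prod (fun k _ => approxBound_nonneg hW k) fun k _ =>
          approxBound_zero_le hW hr0.le hr1 k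
    _ = (W / √(1 - r ^ 2) * r ^ (((n : ℝ) - 1) / 2)) ^ n := by
        rw [Finset.prod_mul_distrib, Finset.prod_const, Finset.card_range,
          prod_range_pow_eq_rpow hr0 hn, mul_pow]

end Estimates

/-! ### Holomorphic functions on normed spaces -/

section UniformLimit

variable {E G : Type*} [NormedAddCommGroup E] [NormedSpace ℂ E] [NormedAddCommGroup G]
  [NormedSpace ℂ G]

theorem norm_fderiv_le_of_forall_mem_ball_norm_le {u : E → G} {z : E} {δ M : ℝ} (hδ : 0 < δ)
    (hu : DifferentiableOn ℂ u (ball z δ)) (hM : ∀ y ∈ ball z δ, ‖u y‖ ≤ M) :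
    ‖fderiv ℂ u z‖ ≤ 2 * M / δ := by
  refine Complex.norm_fderiv_le_div_of_mapsTo_ball hu (fun y hy => ?_) hδ
  rw [mem_closedBall, dist_eq_norm]
  linarith [norm_sub_le (u y) (u z), hM y hy, hM z (mem_ball_self hδ)]

variable {κ : Type*} {l : Filter κ} {F : κ → E → G} {f : E → G} {s U : Set E}

theorem uniformCauchySeqOn_fderiv {δ : ℝ} (hδ : 0 < δ)
    (hsU : ∀ y ∈ s, ball y δ ⊆ U) (hF : ∀ᶠ n in l, DifferentiableOn ℂ (F n) U)
    (h : UniformCauchySeqOn F l U) : UniformCauchySeqOn (fun n => fderiv ℂ (F n)) l s := by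
  intro V hV
  obtain ⟨ε, hε, hεV⟩ := Metric.mem_uniformity_dist.1 hV
  have hη : 0 < ε * δ / 4 := by positivity
  filter_upwards [h _ (Metric.dist_mem_uniformity hη), hF.prod_mk hF] with p hp hdiff y hy
  refine hεV ?_
  have hdiffAt {n : κ} (hn : DifferentiableOn ℂ (F n) U) : DifferentiableAt ℂ (F n) y :=
    (hn.mono (hsU y hy)).differentiableAt (ball_mem_nhds y hδ)
  rw [dist_eq_norm, ← fderiv_sub (hdiffAt hdiff.1) (hdiffAt hdiff.2)]
  calc ‖fderiv ℂ (F p.1 - F p.2) y‖ ≤ 2 * (ε * δ / 4) / δ :=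
        norm_fderiv_le_of_forall_mem_ball_norm_le hδ ((hdiff.1.sub hdiff.2).mono (hsU y hy))
          fun w hw => by
            rw [Pi.sub_apply, ← dist_eq_norm]
            exact (hp w (hsU y hy hw)).le
    _ = ε / 2 := by field_simp; norm_num
    _ < ε := half_lt_self hε

theorem differentiableOn_of_tendstoUniformlyOn [CompleteSpace G] [l.NeBot] (hU : IsOpen U)
    (hF : ∀ᶠ n in l, DifferentiableOn ℂ (F n) U) (h : TendstoUniformlyOn F f l U) :
    DifferentiableOn ℂ f U := by
  intro x hx
  obtain ⟨ρ, hρ, hball⟩ := Metric.isOpen_iff.1 hU x hx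
  have hnhds : ball x (ρ / 2) ∈ 𝓝 x := ball_mem_nhds x (half_pos hρ)
  have hsU : ∀ y ∈ ball x (ρ / 2), ball y (ρ / 2) ⊆ U := fun y hy =>
    (ball_subset_ball' (by linarith [mem_ball.1 hy])).trans hball
  have hcauchy : UniformCauchySeqOn (fun n => fderiv ℂ (F n)) l (ball x (ρ / 2)) :=
    uniformCauchySeqOn_fderiv (half_pos hρ) hsU hF h.uniformCauchySeqOn
  choose! g hg using fun y (hy : y ∈ ball x (ρ / 2)) =>
    CompleteSpace.complete (hcauchy.cauchy_map hy)
  have hlim : TendstoUniformlyOnFilter (fun n => fderiv ℂ (F n)) g l (𝓝 x) :=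
    (hcauchy.tendstoUniformlyOn_of_tendsto hg).tendstoUniformlyOnFilter.mono_right
      (le_principal_iff.2 hnhds)
  refine DifferentiableAt.differentiableWithinAt <| HasFDerivAt.differentiableAt <|
    hasFDerivAt_of_tendstoUniformlyOnFilter (f := F) hlim ?_ ?_
  · filter_upwards [hF.prod_mk (hU.mem_nhds hx)] with p hp
    exact (hp.1.differentiableAt (hU.mem_nhds hp.2)).hasFDerivAt
  · filter_upwards [hU.mem_nhds hx] with y hy using h.tendsto_at hy

end UniformLimit

section Taylor

/-- The `m`-th Taylor coefficient of a function of one complex variable at `0`. -/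
noncomputable def taylorCoeff (m : ℕ) (g : ℂ → ℂ) : ℂ := (m.factorial : ℂ)⁻¹ * iteratedDeriv m g 0

theorem taylorCoeff_comp_mul (m : ℕ) (g : ℂ → ℂ) (a : ℂ) :
    taylorCoeff m (fun t => g (a * t)) = a ^ m * taylorCoeff m g := by
  have iteratedDeriv_comp_mul :
      iteratedDeriv m (fun t => g (a * t)) = fun t => a ^ m * iteratedDeriv m g (a * t) := by
    induction m with
    | zero => simp only [iteratedDeriv_zero, pow_zero, one_mul]
    | succ m ih =>
      ext t
      rw [iteratedDeriv_succ, ih, deriv_const_mul_field, deriv_comp_mul_left, ← iteratedDeriv_succ,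
        smul_eq_mul, pow_succ, mul_assoc]
  simp only [taylorCoeff, iteratedDeriv_comp_mul, mul_zero, mul_left_comm]

theorem taylorCoeff_one (g : ℂ → ℂ) : taylorCoeff 1 g = deriv g 0 := by
  rw [taylorCoeff, iteratedDeriv_one, Nat.factorial_one, Nat.cast_one, inv_one, one_mul]

variable {g : ℂ → ℂ} {M : ℝ}

theorem norm_taylorCoeff_le (hg : DifferentiableOn ℂ g (ball 0 1))
    (hM : ∀ t ∈ ball (0 : ℂ) 1, ‖g t‖ ≤ M) (m : ℕ) : ‖taylorCoeff m g‖ ≤ M := by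
  have cauchy_bound (ρ : ℝ) (hρ : ρ ∈ Set.Ioo (0 : ℝ) 1) : ‖taylorCoeff m g‖ ≤ M / ρ ^ m := by
    have hs : closedBall (0 : ℂ) ρ ⊆ ball 0 1 := closedBall_subset_ball hρ.2
    rw [taylorCoeff, norm_mul, norm_inv, Complex.norm_natCast,
      inv_mul_le_iff₀ (by exact_mod_cast m.factorial_pos), ← mul_div_assoc]
    exact Complex.norm_iteratedDeriv_le_of_forall_mem_sphere_norm_le m hρ.1
      ((hg.mono hs).diffContOnCl_ball le_rfl) fun z hz => hM z (hs (sphere_subset_closedBall hz))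
  have hlim : Tendsto (fun ρ : ℝ => M / ρ ^ m) (𝓝[<] 1) (𝓝 M) := by
    have hcont : ContinuousAt (fun ρ : ℝ => M / ρ ^ m) 1 :=
      continuousAt_const.div (continuousAt_id.pow m) (by simp)
    simpa using hcont.tendsto.mono_left nhdsWithin_le_nhds
  exact ge_of_tendsto hlim (mem_of_superset (Ioo_mem_nhdsLT one_pos) cauchy_bound)

theorem norm_sub_sum_taylorCoeff_le (hg : DifferentiableOn ℂ g (ball 0 1))
    (hM : ∀ t ∈ ball (0 : ℂ) 1, ‖g t‖ ≤ M) (m : ℕ) {t : ℂ} (ht : ‖t‖ < 1) :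
    ‖g t - ∑ j ∈ Finset.range m, t ^ j * taylorCoeff j g‖ ≤ M * ‖t‖ ^ m / (1 - ‖t‖) := by
  have hsum : HasSum (fun j => t ^ j * taylorCoeff j g) (g t) := by
    refine (Complex.hasSum_taylorSeries_on_ball hg (mem_ball_zero_iff.2 ht)).congr_fun fun j => ?_
    rw [smul_eq_mul, smul_eq_mul, sub_zero, mul_left_comm, taylorCoeff]
  rw [← ((hasSum_nat_add_iff' m).2 hsum).tsum_eq]
  refine tsum_of_norm_bounded ((hasSum_geometric_of_lt_one (norm_nonneg _) ht).mul_left _)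
    fun j => ?_
  calc ‖t ^ (j + m) * taylorCoeff (j + m) g‖ = ‖t‖ ^ m * ‖t‖ ^ j * ‖taylorCoeff (j + m) g‖ := by
        rw [norm_mul, norm_pow, pow_add, mul_comm (‖t‖ ^ j)]
    _ ≤ ‖t‖ ^ m * ‖t‖ ^ j * M := by gcongr; exact norm_taylorCoeff_le hg hM (j + m)
    _ = M * ‖t‖ ^ m * ‖t‖ ^ j := by ring

theorem norm_div_pow_sub_taylorCoeff_le (hg : DifferentiableOn ℂ g (ball 0 1))
    (hM : ∀ t ∈ ball (0 : ℂ) 1, ‖g t‖ ≤ M) (m : ℕ) {t : ℂ} (ht : ‖t‖ < 1) (ht0 : t ≠ 0) :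
    ‖(g t - ∑ j ∈ Finset.range m, t ^ j * taylorCoeff j g) / t ^ m - taylorCoeff m g‖ ≤
      M * ‖t‖ / (1 - ‖t‖) := by
  rw [div_sub' (pow_ne_zero m ht0), sub_sub, ← Finset.sum_range_succ, norm_div, norm_pow,
    div_le_iff₀ (by positivity), div_mul_eq_mul_div, mul_assoc, ← pow_succ']
  exact norm_sub_sum_taylorCoeff_le hg hM (m + 1) ht

theorem tendsto_mul_norm_div_one_sub_norm (M : ℝ) :
    Tendsto (fun t : ℂ => M * ‖t‖ / (1 - ‖t‖)) (𝓝[≠] 0) (𝓝 0) := by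
  have hcont : ContinuousAt (fun t : ℂ => M * ‖t‖ / (1 - ‖t‖)) 0 :=
    ContinuousAt.div (by fun_prop) (by fun_prop) (by simp)
  simpa using hcont.tendsto.mono_left nhdsWithin_le_nhds

variable {E : Type*} [NormedAddCommGroup E] [NormedSpace ℂ E] {U : Set E}

-- The coefficient is the uniform limit as `t → 0` of the Taylor remainder divided by `t ^ m`.
theorem differentiableOn_taylorCoeff (hU : IsOpen U) {g : E → ℂ → ℂ}
    (hgU : ∀ t ∈ ball (0 : ℂ) 1, DifferentiableOn ℂ (fun y => g y t) U)
    (hg : ∀ y ∈ U, DifferentiableOn ℂ (g y) (ball 0 1))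
    (hM : ∀ y ∈ U, ∀ t ∈ ball (0 : ℂ) 1, ‖g y t‖ ≤ M) (m : ℕ) :
    DifferentiableOn ℂ (fun y => taylorCoeff m (g y)) U := by
  induction m using Nat.strong_induction_on with
  | _ m ih =>
    have hlt : ∀ᶠ t : ℂ in 𝓝[≠] 0, t ∈ ball (0 : ℂ) 1 :=
      nhdsWithin_le_nhds (ball_mem_nhds 0 one_pos)
    refine differentiableOn_of_tendstoUniformlyOn (l := 𝓝[≠] (0 : ℂ)) hU
      (F := fun t y => (g y t - ∑ j ∈ Finset.range m, t ^ j * taylorCoeff j (g y)) / t ^ m) ?_ ?_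
    · filter_upwards [hlt] with t ht
      have hsum : DifferentiableOn ℂ
          (fun y => ∑ j ∈ Finset.range m, t ^ j * taylorCoeff j (g y)) U :=
        DifferentiableOn.fun_sum fun j hj => (ih j (Finset.mem_range.1 hj)).const_mul _
      simpa only [div_eq_inv_mul] using ((hgU t ht).fun_sub hsum).const_mul _
    · rw [Metric.tendstoUniformlyOn_iff]
      intro η hη
      filter_upwards [hlt, self_mem_nhdsWithin,
        (tendsto_mul_norm_div_one_sub_norm M).eventually (gt_mem_nhds hη)] with t ht ht0 htη y hy
      rw [dist_comm, dist_eq_norm]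
      exact (norm_div_pow_sub_taylorCoeff_le (hg y hy) (hM y hy) m (mem_ball_zero_iff.1 ht)
        ht0).trans_lt htη

theorem differentiableOn_fderiv_apply {u : E → ℂ} (hU : IsOpen U) (hu : DifferentiableOn ℂ u U)
    (v : E) : DifferentiableOn ℂ (fun z => fderiv ℂ u z v) U := by
  intro x hx
  obtain ⟨ε, hε, hball⟩ : ∃ ε > 0, ball x ε ⊆ U ∩ {y | ‖u y‖ < ‖u x‖ + 1} :=
    Metric.mem_nhds_iff.1 <| inter_mem (hU.mem_nhds hx) <|
      (hu.differentiableAt (hU.mem_nhds hx)).continuousAt.norm.eventually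
        (gt_mem_nhds (lt_add_one _))
  obtain ⟨δ, hδ, hδv⟩ : ∃ δ : ℝ, 0 < δ ∧ ‖v‖ * δ < ε / 2 :=
    exists_pos_mul_lt (half_pos hε) ‖v‖
  have hmem : ∀ y ∈ ball x (ε / 2), ∀ t ∈ ball (0 : ℂ) 1, y + t • (δ : ℂ) • v ∈ ball x ε := by
    intro y hy t ht
    have hshift : ‖t • (δ : ℂ) • v‖ ≤ ‖v‖ * δ := by
      rw [norm_smul, norm_smul, Complex.norm_of_nonneg hδ.le, mul_comm ‖v‖]
      exact mul_le_of_le_one_left (by positivity) (mem_ball_zero_iff.1 ht).le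
    rw [mem_ball, dist_eq_norm, add_sub_right_comm]
    linarith [norm_add_le (y - x) (t • (δ : ℂ) • v), mem_ball_iff_norm.1 hy]
  have hderiv : ∀ y ∈ ball x (ε / 2),
      fderiv ℂ u y v = (δ : ℂ)⁻¹ * taylorCoeff 1 fun t => u (y + t • (δ : ℂ) • v) := by
    intro y hy
    have hyU : y ∈ U := (hball (ball_subset_ball (half_le_self hε.le) hy)).1
    have hline : HasDerivAt (fun t : ℂ => u (y + t • (δ : ℂ) • v)) (fderiv ℂ u y ((δ : ℂ) • v)) 0 :=
      (hu.differentiableAt (hU.mem_nhds hyU)).hasFDerivAt.hasLineDerivAt _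
    rw [taylorCoeff_one, hline.deriv, map_smul, smul_eq_mul,
      inv_mul_cancel_left₀ (by exact_mod_cast hδ.ne')]
  have hdiff : DifferentiableOn ℂ (fun y => taylorCoeff 1 fun t => u (y + t • (δ : ℂ) • v))
      (ball x (ε / 2)) :=
    differentiableOn_taylorCoeff isOpen_ball
      (fun t ht => hu.comp (by fun_prop) fun y hy => (hball (hmem y hy t ht)).1)
      (fun y hy => hu.comp (by fun_prop) fun t ht => (hball (hmem y hy t ht)).1)
      (fun y hy t ht => (hball (hmem y hy t ht)).2.le) 1
  exact (((hdiff.const_mul _).congr hderiv).differentiableAt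
    (ball_mem_nhds x (half_pos hε))).differentiableWithinAt

/-- The homogeneous component of degree `m` in the expansion of `u` at `0`. -/
noncomputable def homogComponent (m : ℕ) (u : E → ℂ) (z : E) : ℂ :=
  taylorCoeff m fun t : ℂ => u (t • z)

theorem homogComponent_smul (m : ℕ) (u : E → ℂ) (a : ℂ) (z : E) :
    homogComponent m u (a • z) = a ^ m * homogComponent m u z := by
  simp only [homogComponent, smul_smul, mul_comm _ a]
  exact taylorCoeff_comp_mul m (fun t => u (t • z)) a

theorem smul_mem_ball_zero {z : E} {ρ : ℝ} (hz : z ∈ ball (0 : E) ρ) {t : ℂ} (ht : ‖t‖ ≤ 1) :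
    t • z ∈ ball (0 : E) ρ := by
  rw [mem_ball_zero_iff, norm_smul] at *
  exact (mul_le_of_le_one_left (norm_nonneg _) ht).trans_lt hz

variable {u : E → ℂ}

theorem differentiableOn_comp_smul (hu : DifferentiableOn ℂ u (ball 0 1)) {z : E}
    (hz : z ∈ ball (0 : E) 1) : DifferentiableOn ℂ (fun t : ℂ => u (t • z)) (ball 0 1) :=
  hu.comp (by fun_prop) fun _ ht => smul_mem_ball_zero hz (mem_ball_zero_iff.1 ht).le

theorem differentiableOn_homogComponent (hu : DifferentiableOn ℂ u (ball 0 1))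
    (hM : ∀ z ∈ ball (0 : E) 1, ‖u z‖ ≤ M) (m : ℕ) :
    DifferentiableOn ℂ (homogComponent m u) (ball 0 1) :=
  differentiableOn_taylorCoeff isOpen_ball
    (fun _ ht => hu.comp (by fun_prop) fun _ hz =>
      smul_mem_ball_zero hz (mem_ball_zero_iff.1 ht).le)
    (fun _ hz => differentiableOn_comp_smul hu hz)
    (fun _ hz _ ht => hM _ (smul_mem_ball_zero hz (mem_ball_zero_iff.1 ht).le)) m

theorem differentiable_homogComponent (hu : DifferentiableOn ℂ u (ball 0 1))
    (hM : ∀ z ∈ ball (0 : E) 1, ‖u z‖ ≤ M) (m : ℕ) : Differentiable ℂ (homogComponent m u) := by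
  intro z
  obtain ⟨t, ht, htz⟩ := exists_pos_mul_lt one_pos ‖z‖
  have ht0 : (t : ℂ) ≠ 0 := by exact_mod_cast ht.ne'
  have hmem : (t : ℂ) • z ∈ ball (0 : E) 1 := by
    rwa [mem_ball_zero_iff, norm_smul, Complex.norm_of_nonneg ht.le, mul_comm]
  have hscale :
      homogComponent m u = fun y => ((t : ℂ) ^ m)⁻¹ * homogComponent m u ((t : ℂ) • y) := by
    ext y
    rw [homogComponent_smul, inv_mul_cancel_left₀ (pow_ne_zero m ht0)]
  rw [hscale]
  exact (((differentiableOn_homogComponent hu hM m).differentiableAt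
    (isOpen_ball.mem_nhds hmem)).comp z (by fun_prop)).const_mul _

theorem norm_sub_sum_homogComponent_le (hu : DifferentiableOn ℂ u (ball 0 1))
    (hM : ∀ z ∈ ball (0 : E) 1, ‖u z‖ ≤ M) (m : ℕ) {z : E} (hz : z ∈ ball (0 : E) 1) {t : ℂ}
    (ht : ‖t‖ < 1) :
    ‖u (t • z) - ∑ j ∈ Finset.range m, t ^ j * homogComponent j u z‖ ≤
      M * ‖t‖ ^ m / (1 - ‖t‖) :=
  norm_sub_sum_taylorCoeff_le (differentiableOn_comp_smul hu hz)
    (fun _ ht => hM _ (smul_mem_ball_zero hz (mem_ball_zero_iff.1 ht).le)) m ht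

end Taylor

/-! ### Homogeneous polynomials -/

section Homogeneous

variable {E : Type*} [NormedAddCommGroup E] [NormedSpace ℂ E] {g : E → ℂ} {m : ℕ}

theorem fderiv_smul_of_homogeneous (h : ∀ a : ℂ, a ≠ 0 → ∀ z, g (a • z) = a ^ (m + 1) * g z)
    {a : ℂ} (ha : a ≠ 0) (z v : E) : fderiv ℂ g (a • z) v = a ^ m * fderiv ℂ g z v := by
  have hderiv : a • fderiv ℂ g (a • z) = a ^ (m + 1) • fderiv ℂ g z := by
    rw [← fderiv_comp_smul (f := g), funext (h a ha)]
    exact congrFun (fderiv_const_smul_field (a ^ (m + 1))) z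
  refine mul_left_cancel₀ ha ?_
  rw [← mul_assoc, ← pow_succ']
  exact congrArg (fun L : E →L[ℂ] ℂ => L v) hderiv

theorem fderiv_apply_self_of_homogeneous (hg : Differentiable ℂ g)
    (h : ∀ a : ℂ, a ≠ 0 → ∀ z, g (a • z) = a ^ m * g z) (z : E) : fderiv ℂ g z z = m * g z := by
  have hray : HasDerivAt (fun t : ℂ => t • z) z 1 := by
    simpa using (hasDerivAt_id (1 : ℂ)).smul_const z
  have hchain : HasDerivAt (fun t : ℂ => g (t • z)) (fderiv ℂ g z z) 1 :=
    (hg z).hasFDerivAt.comp_hasDerivAt_of_eq 1 hray (one_smul ℂ z).symm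
  have hpow : HasDerivAt (fun t : ℂ => t ^ m * g z) (m * g z) 1 := by
    simpa using (hasDerivAt_pow m (1 : ℂ)).mul_const (g z)
  refine hchain.unique (hpow.congr_of_eventuallyEq ?_)
  filter_upwards [isOpen_ne.mem_nhds one_ne_zero] with t ht using h t ht z

theorem eq_apply_zero_of_forall_smul_eq (hg : Continuous g)
    (h : ∀ a : ℂ, a ≠ 0 → ∀ z, g (a • z) = g z) (z : E) : g z = g 0 := by
  have hray : Tendsto (fun t : ℂ => g (t • z)) (𝓝[≠] 0) (𝓝 (g 0)) := by
    have hcont : Continuous fun t : ℂ => g (t • z) := by fun_prop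
    simpa using (hcont.tendsto 0).mono_left nhdsWithin_le_nhds
  refine tendsto_nhds_unique (tendsto_const_nhds.congr' ?_) hray
  filter_upwards [self_mem_nhdsWithin] with t ht using (h t ht z).symm

end Homogeneous

section Polynomial

variable {d : ℕ}

/-- The monomial `x ^ α` as a function on `ℂ^d`. -/
noncomputable def monomialFn (α : Fin d → ℕ) (x : Cd d) : ℂ := ∏ i, x i ^ α i

/-- Homogeneous polynomials of degree `m`, as functions on `ℂ^d`. -/
noncomputable def homogPoly (d m : ℕ) : Submodule ℂ (Cd d → ℂ) :=
  Submodule.span ℂ {f | ∃ α : Fin d → ℕ, ∑ i, α i = m ∧ f = monomialFn α}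

theorem monomialFn_mem_homogPoly (α : Fin d → ℕ) : monomialFn α ∈ homogPoly d (∑ i, α i) :=
  Submodule.subset_span ⟨α, rfl, rfl⟩

theorem one_mem_homogPoly_zero : (1 : Cd d → ℂ) ∈ homogPoly d 0 :=
  Submodule.subset_span ⟨0, by simp, by ext; simp [monomialFn]⟩

theorem monomialFn_smul (α : Fin d → ℕ) (a : ℂ) (x : Cd d) :
    monomialFn α (a • x) = a ^ (∑ i, α i) * monomialFn α x := by
  simp only [monomialFn, PiLp.smul_apply, smul_eq_mul, mul_pow, Finset.prod_mul_distrib,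
    Finset.prod_pow_eq_pow_sum]

theorem monomialFn_add_single (α : Fin d → ℕ) (i : Fin d) (x : Cd d) :
    monomialFn (α + Pi.single i 1) x = x i * monomialFn α x := by
  have hsingle : ∏ j, x j ^ (Pi.single i 1 : Fin d → ℕ) j = x i := by
    rw [Finset.prod_eq_single i (fun j _ hj => by rw [Pi.single_eq_of_ne hj, pow_zero]) (by simp),
      Pi.single_eq_same, pow_one]
  simp only [monomialFn, Pi.add_apply, pow_add, Finset.prod_mul_distrib, hsingle, mul_comm]

theorem differentiable_monomialFn (α : Fin d → ℕ) : Differentiable ℂ (monomialFn α) := by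
  unfold monomialFn
  fun_prop

theorem coord_mul_mem_homogPoly {m : ℕ} {p : Cd d → ℂ} (hp : p ∈ homogPoly d m) (i : Fin d) :
    (fun x : Cd d => x i * p x) ∈ homogPoly d (m + 1) := by
  let mulCoord : (Cd d → ℂ) →ₗ[ℂ] (Cd d → ℂ) := LinearMap.mulLeft ℂ fun x => x i
  suffices homogPoly d m ≤ (homogPoly d (m + 1)).comap mulCoord from this hp
  refine Submodule.span_le.2 ?_
  rintro _ ⟨α, rfl, rfl⟩
  refine Submodule.subset_span ⟨α + Pi.single i 1, by simp [Finset.sum_add_distrib], ?_⟩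
  ext x
  exact (monomialFn_add_single α i x).symm

theorem differentiable_of_mem_span_monomialFn {p : Cd d → ℂ}
    (hp : p ∈ Submodule.span ℂ (Set.range (monomialFn (d := d)))) : Differentiable ℂ p := by
  induction hp using Submodule.span_induction with
  | mem f hf => obtain ⟨α, rfl⟩ := hf; exact differentiable_monomialFn α
  | zero => exact differentiable_const 0
  | add f g _ _ hf hg => exact hf.add hg
  | smul a f _ hf => exact hf.const_smul a

theorem homogPoly_le_span_range_monomialFn (m : ℕ) :
    homogPoly d m ≤ Submodule.span ℂ (Set.range (monomialFn (d := d))) :=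
  Submodule.span_mono fun _ ⟨α, _, hα⟩ => ⟨α, hα.symm⟩

theorem differentiable_of_mem_homogPoly {m : ℕ} {p : Cd d → ℂ} (hp : p ∈ homogPoly d m) :
    Differentiable ℂ p :=
  differentiable_of_mem_span_monomialFn (homogPoly_le_span_range_monomialFn m hp)

theorem apply_smul_of_mem_homogPoly {m : ℕ} {p : Cd d → ℂ} (hp : p ∈ homogPoly d m) (a : ℂ)
    (x : Cd d) : p (a • x) = a ^ m * p x := by
  induction hp using Submodule.span_induction with
  | mem f hf => obtain ⟨α, rfl, rfl⟩ := hf; exact monomialFn_smul α a x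
  | zero => exact (mul_zero _).symm
  | add f g _ _ hf hg => rw [Pi.add_apply, Pi.add_apply, hf, hg, mul_add]
  | smul b f _ hf => rw [Pi.smul_apply, Pi.smul_apply, hf, smul_eq_mul, smul_eq_mul, mul_left_comm]

theorem clm_apply_eq_sum_coord_mul (L : Cd d →L[ℂ] ℂ) (z : Cd d) :
    L z = ∑ i, z i * L (EuclideanSpace.single i 1) := by
  conv_lhs => rw [← (EuclideanSpace.basisFun (Fin d) ℂ).sum_repr z]
  simp only [map_sum, map_smul, EuclideanSpace.basisFun_repr, EuclideanSpace.basisFun_apply,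
    smul_eq_mul]

-- Induction on the degree: by Euler's identity `(m + 1) g z = ∑ i, z i ∂ᵢg z`.
theorem mem_homogPoly_of_homogeneous {m : ℕ} {g : Cd d → ℂ} (hg : Differentiable ℂ g)
    (h : ∀ a : ℂ, a ≠ 0 → ∀ z, g (a • z) = a ^ m * g z) : g ∈ homogPoly d m := by
  induction m generalizing g with
  | zero =>
    have hconst : g = g 0 • (1 : Cd d → ℂ) := by
      ext z
      rw [Pi.smul_apply, Pi.one_apply, smul_eq_mul, mul_one]
      exact eq_apply_zero_of_forall_smul_eq hg.continuous (by simpa using h) z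
    rw [hconst]
    exact Submodule.smul_mem _ _ one_mem_homogPoly_zero
  | succ m ih =>
    have partial_mem (i : Fin d) :
        (fun z => fderiv ℂ g z (EuclideanSpace.single i 1)) ∈ homogPoly d m :=
      ih (differentiableOn_univ.1
          (differentiableOn_fderiv_apply isOpen_univ hg.differentiableOn _))
        fun a ha z => fderiv_smul_of_homogeneous h ha z _
    have euler : g = ((m + 1 : ℕ) : ℂ)⁻¹ •
        ∑ i, fun z : Cd d => z i * fderiv ℂ g z (EuclideanSpace.single i 1) := by
      ext z
      rw [Pi.smul_apply, Finset.sum_apply, ← clm_apply_eq_sum_coord_mul,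
        fderiv_apply_self_of_homogeneous hg h, smul_eq_mul,
        inv_mul_cancel_left₀ (by exact_mod_cast m.succ_ne_zero)]
    rw [euler]
    exact Submodule.smul_mem _ _
      (Submodule.sum_mem _ fun i _ => coord_mul_mem_homogPoly (partial_mem i) i)

theorem comp_linearMap_mem_homogPoly {m : ℕ} {p : Cd d → ℂ} (hp : p ∈ homogPoly d m)
    (A : Cd d →ₗ[ℂ] Cd d) : (fun x => p (A x)) ∈ homogPoly d m :=
  mem_homogPoly_of_homogeneous
    ((differentiable_of_mem_homogPoly hp).comp A.toContinuousLinearMap.differentiable)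
    fun a _ z => by rw [map_smul, apply_smul_of_mem_homogPoly hp]

theorem homogComponent_mem_homogPoly {u : Cd d → ℂ} {M : ℝ} (hu : DifferentiableOn ℂ u (ball 0 1))
    (hM : ∀ z ∈ ball (0 : Cd d) 1, ‖u z‖ ≤ M) (m : ℕ) : homogComponent m u ∈ homogPoly d m :=
  mem_homogPoly_of_homogeneous (differentiable_homogComponent hu hM m)
    fun a _ z => homogComponent_smul m u a z

theorem exists_dilation_norm_sub_lt {E : Type*} [NormedAddCommGroup E] [NormedSpace ℂ E]
    {u : E → ℂ} (hu : UniformContinuousOn u (closedBall 0 1)) {ε : ℝ} (hε : 0 < ε) :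
    ∃ t : ℝ, 0 < t ∧ t < 1 ∧ ∀ z ∈ closedBall (0 : E) 1, ‖u z - u ((t : ℂ) • z)‖ < ε := by
  obtain ⟨δ, hδ, hδu⟩ := Metric.uniformContinuousOn_iff.1 hu ε hε
  obtain ⟨t, htδ, ht1⟩ := exists_between (max_lt one_pos (sub_lt_self 1 hδ))
  obtain ⟨ht0, htδ⟩ := max_lt_iff.1 htδ
  refine ⟨t, ht0, ht1, fun z hz => ?_⟩
  rw [mem_closedBall_zero_iff] at hz
  rw [← dist_eq_norm]
  refine hδu z (mem_closedBall_zero_iff.2 hz) _ (mem_closedBall_zero_iff.2 ?_) ?_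
  · rw [norm_smul, Complex.norm_of_nonneg ht0.le]
    exact mul_le_one₀ ht1.le (norm_nonneg z) hz
  · calc dist z ((t : ℂ) • z) = (1 - t) * ‖z‖ := by
          rw [dist_eq_norm, ← Complex.norm_of_nonneg (sub_nonneg.2 ht1.le), ← norm_smul,
            Complex.ofReal_sub, Complex.ofReal_one, sub_smul, one_smul]
      _ ≤ 1 - t := mul_le_of_le_one_right (by linarith) hz
      _ < δ := by linarith

theorem exists_mem_span_monomialFn_dilation_sub_le {u : Cd d → ℂ} {M : ℝ}
    (hu : DifferentiableOn ℂ u (ball 0 1)) (hM : ∀ z ∈ ball (0 : Cd d) 1, ‖u z‖ ≤ M) {t : ℝ}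
    (ht0 : 0 < t) (ht1 : t < 1) {ε : ℝ} (hε : 0 < ε) :
    ∃ p ∈ Submodule.span ℂ (Set.range (monomialFn (d := d))),
      ∀ z ∈ ball (0 : Cd d) 1, ‖u ((t : ℂ) • z) - p z‖ ≤ ε := by
  have hlim : Tendsto (fun m : ℕ => M * t ^ m / (1 - t)) atTop (𝓝 0) := by
    simpa using ((tendsto_pow_atTop_nhds_zero_of_lt_one ht0.le ht1).const_mul M).div_const (1 - t)
  obtain ⟨N, hN⟩ := (hlim.eventually (gt_mem_nhds hε)).exists
  have htn : ‖(t : ℂ)‖ = t := Complex.norm_of_nonneg ht0.le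
  refine ⟨∑ j ∈ Finset.range N, (t : ℂ) ^ j • homogComponent j u,
    Submodule.sum_mem _ fun j _ => Submodule.smul_mem _ _
      (homogPoly_le_span_range_monomialFn j (homogComponent_mem_homogPoly hu hM j)),
    fun z hz => ?_⟩
  have htrunc := norm_sub_sum_homogComponent_le hu hM N hz (htn.trans_lt ht1)
  rw [htn] at htrunc
  simpa only [Finset.sum_apply, Pi.smul_apply, smul_eq_mul] using htrunc.trans hN.le

theorem exists_mem_span_monomialFn_norm_sub_le {u : Cd d → ℂ} (hu : DiffContOnCl ℂ u (ball 0 1))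
    {ε : ℝ} (hε : 0 < ε) : ∃ p ∈ Submodule.span ℂ (Set.range (monomialFn (d := d))),
      ∀ z ∈ closedBall (0 : Cd d) 1, ‖u z - p z‖ ≤ ε := by
  have hcl : closure (ball (0 : Cd d) 1) = closedBall 0 1 := closure_ball _ one_ne_zero
  have hcont : ContinuousOn u (closedBall 0 1) := hcl ▸ hu.continuousOn
  have hcompact : IsCompact (closedBall (0 : Cd d) 1) := isCompact_closedBall _ _
  obtain ⟨M, hM⟩ := hcompact.exists_bound_of_continuousOn hcont
  obtain ⟨t, ht0, ht1, hdil⟩ := exists_dilation_norm_sub_lt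
    (hcompact.uniformContinuousOn_of_continuous hcont) (half_pos hε)
  obtain ⟨p, hp, hpt⟩ := exists_mem_span_monomialFn_dilation_sub_le hu.differentiableOn
    (fun z hz => hM z (ball_subset_closedBall hz)) ht0 ht1 (half_pos hε)
  have hball : ∀ z ∈ ball (0 : Cd d) 1, ‖u z - p z‖ ≤ ε := fun z hz => by
    linarith [norm_sub_le_norm_sub_add_norm_sub (u z) (u ((t : ℂ) • z)) (p z), hpt z hz,
      hdil z (ball_subset_closedBall hz)]
  refine ⟨p, hp, fun z hz => le_on_closure hball ?_ continuousOn_const (hcl.symm ▸ hz)⟩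
  rw [hcl]
  exact (hcont.sub (differentiable_of_mem_span_monomialFn hp).continuous.continuousOn).norm

end Polynomial

/-! ### The invariant measure on the unit sphere -/

section UnitSphere

open scoped Pointwise ComplexConjugate

variable {d e : ℕ}

/-- The normalised surface measure on the unit sphere of `ℂ^d`. -/
noncomputable def unitSphereMeasure (d : ℕ) : Measure (sphere (0 : Cd d) 1) :=
  ((volume : Measure (Cd d)).toSphere Set.univ)⁻¹ • (volume : Measure (Cd d)).toSphere

instance (e : ℕ) : IsProbabilityMeasure (unitSphereMeasure (e + 1)) where
  measure_univ := by
    rw [unitSphereMeasure, Measure.smul_apply, smul_eq_mul]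
    exact ENNReal.inv_mul_cancel (Measure.measure_univ_ne_zero.2 (Measure.toSphere_ne_zero _))
      (measure_ne_top _ _)

instance (d : ℕ) : (unitSphereMeasure d).IsOpenPosMeasure :=
  Measure.isOpenPosMeasure_smul _ (ENNReal.inv_ne_zero.2 (measure_ne_top _ _))

theorem integrable_unitSphereMeasure_of_continuous {F : Type*} [NormedAddCommGroup F]
    {f : sphere (0 : Cd (e + 1)) 1 → F} (hf : Continuous f) :
    Integrable f (unitSphereMeasure (e + 1)) :=
  hf.integrable_of_hasCompactSupport (HasCompactSupport.of_compactSpace _)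

/-- The action of a unitary map on the unit sphere. -/
noncomputable def sphereMap (U : Cd d ≃ₗᵢ[ℂ] Cd d) (x : sphere (0 : Cd d) 1) :
    sphere (0 : Cd d) 1 :=
  ⟨U x, by simp⟩

theorem continuous_sphereMap (U : Cd d ≃ₗᵢ[ℂ] Cd d) : Continuous (sphereMap U) :=
  (U.continuous.comp continuous_subtype_val).subtype_mk _

theorem image_preimage_sphereMap (U : Cd d ≃ₗᵢ[ℂ] Cd d) (s : Set (sphere (0 : Cd d) 1)) :
    ((↑) '' (sphereMap U ⁻¹' s) : Set (Cd d)) = U ⁻¹' ((↑) '' s) := by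
  ext y
  constructor
  · rintro ⟨x, hx, rfl⟩
    exact ⟨sphereMap U x, hx, rfl⟩
  · rintro ⟨x, hx, hxy⟩
    refine ⟨⟨y, by rw [mem_sphere_zero_iff_norm, ← U.norm_map, ← hxy, norm_eq_of_mem_sphere]⟩,
      ?_, rfl⟩
    exact Set.mem_preimage.2 ((Subtype.ext hxy : x = sphereMap U ⟨y, _⟩) ▸ hx)

-- The surface measure of `s` is a multiple of the volume of the cone `(0, 1) • s`, and unitary maps
-- preserve volume.
theorem map_sphereMap (U : Cd d ≃ₗᵢ[ℂ] Cd d) :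
    (unitSphereMeasure d).map (sphereMap U) = unitSphereMeasure d := by
  have hmeas : Measurable (sphereMap U) := (continuous_sphereMap U).measurable
  let V : Cd d ≃ₗᵢ[ℝ] Cd d := { U.toLinearEquiv.restrictScalars ℝ with norm_map' := U.norm_map }
  rw [unitSphereMeasure, Measure.map_smul]
  congr 1
  ext s hs
  have hcone : Set.Ioo (0 : ℝ) 1 • ((↑) '' (sphereMap U ⁻¹' s) : Set (Cd d)) =
      V ⁻¹' (Set.Ioo (0 : ℝ) 1 • ((↑) '' s : Set (Cd d))) := by
    rw [image_preimage_sphereMap]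
    ext y
    simp only [Set.mem_smul, Set.mem_preimage]
    constructor
    · rintro ⟨a, ha, x, hx, rfl⟩
      exact ⟨a, ha, V x, hx, (V.map_smul a x).symm⟩
    · rintro ⟨a, ha, x, hx, hxy⟩
      refine ⟨a, ha, V.symm x, ?_, by rw [← V.symm.map_smul, hxy, V.symm_apply_apply]⟩
      exact (V.apply_symm_apply x).symm ▸ hx
  rw [Measure.map_apply hmeas hs, Measure.toSphere_apply' _ (hmeas hs),
    Measure.toSphere_apply' _ hs, hcone]
  congr 1
  exact V.measurePreserving.measure_preimage_equiv (f := V.toHomeomorph.toMeasurableEquiv) _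

theorem integral_comp_unitary {F : Type*} [NormedAddCommGroup F] [NormedSpace ℝ F]
    (U : Cd d ≃ₗᵢ[ℂ] Cd d) {f : Cd d → F} (hf : Continuous f) :
    ∫ x : sphere (0 : Cd d) 1, f (U x) ∂unitSphereMeasure d =
      ∫ x : sphere (0 : Cd d) 1, f x ∂unitSphereMeasure d := by
  conv_rhs => rw [← map_sphereMap U]
  exact (integral_map (continuous_sphereMap U).aemeasurable
    (hf.comp continuous_subtype_val).aestronglyMeasurable_of_compactSpace).symm

theorem exists_orthonormalBasis_apply_zero_eq {x : Cd (e + 1)} (hx : ‖x‖ = 1) :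
    ∃ b : OrthonormalBasis (Fin (e + 1)) ℂ (Cd (e + 1)), b 0 = x := by
  have horth : Orthonormal ℂ (({0} : Set (Fin (e + 1))).domRestrict fun _ => x) :=
    ⟨fun _ => hx, fun i j hij => absurd (Subsingleton.elim i j) hij⟩
  obtain ⟨b, hb⟩ := horth.exists_orthonormalBasis_extension_of_card_eq (by simp)
  exact ⟨b, hb 0 rfl⟩

theorem exists_unitary_apply_eq {x y : Cd (e + 1)} (hx : ‖x‖ = 1) (hy : ‖y‖ = 1) :
    ∃ U : Cd (e + 1) ≃ₗᵢ[ℂ] Cd (e + 1), U x = y := by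
  obtain ⟨b, rfl⟩ := exists_orthonormalBasis_apply_zero_eq hx
  obtain ⟨b', rfl⟩ := exists_orthonormalBasis_apply_zero_eq hy
  exact ⟨b.equiv b' (Equiv.refl _), by simp⟩

theorem exists_norm_eq_one_and_eq_norm_smul {E : Type*} [NormedAddCommGroup E] [NormedSpace ℂ E]
    [Nontrivial E] (y : E) : ∃ x : E, ‖x‖ = 1 ∧ y = (‖y‖ : ℂ) • x := by
  rcases eq_or_ne y 0 with rfl | hy
  · obtain ⟨x, hx⟩ := exists_norm_eq E zero_le_one
    exact ⟨x, hx, by simp⟩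
  · have hy' : (‖y‖ : ℂ) ≠ 0 := by exact_mod_cast norm_ne_zero_iff.2 hy
    exact ⟨((‖y‖ : ℂ))⁻¹ • y, by rw [norm_smul, norm_inv, Complex.norm_real, norm_norm,
      inv_mul_cancel₀ (norm_ne_zero_iff.2 hy)], (smul_inv_smul₀ hy' y).symm⟩

end UnitSphere

/-! ### Monomials on the unit sphere -/

section Monomials

open scoped ComplexConjugate

variable {d e : ℕ}

theorem continuous_monomialFn (α : Fin d → ℕ) : Continuous (monomialFn α) :=
  (differentiable_monomialFn α).continuous

/-- Multiplication of the `i`-th coordinate by a number of modulus `1`. -/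
noncomputable def rotateCoord (i : Fin d) (a : ℂ) (ha : ‖a‖ = 1) : Cd d ≃ₗᵢ[ℂ] Cd d :=
  LinearIsometryEquiv.piLpCongrRight 2 fun j =>
    if j = i then
      { LinearEquiv.smulOfNeZero ℂ ℂ a (norm_ne_zero_iff.1 (ha ▸ one_ne_zero)) with
        norm_map' := fun z => by change ‖a • z‖ = ‖z‖; rw [norm_smul, ha, one_mul] }
    else LinearIsometryEquiv.refl ℂ ℂ

theorem rotateCoord_apply (i : Fin d) {a : ℂ} (ha : ‖a‖ = 1) (x : Cd d) (j : Fin d) :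
    rotateCoord i a ha x j = (if j = i then a else 1) * x j := by
  rcases eq_or_ne j i with rfl | hj
  · simp [rotateCoord]
  · simp [rotateCoord, hj]

theorem monomialFn_rotateCoord (α : Fin d → ℕ) (i : Fin d) {a : ℂ} (ha : ‖a‖ = 1) (x : Cd d) :
    monomialFn α (rotateCoord i a ha x) = a ^ α i * monomialFn α x := by
  simp only [monomialFn, rotateCoord_apply, mul_pow, Finset.prod_mul_distrib]
  simp

theorem exists_norm_eq_one_and_pow_succ_eq_neg_one (k : ℕ) :
    ∃ a : ℂ, ‖a‖ = 1 ∧ a ^ (k + 1) = -1 := by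
  refine ⟨Complex.exp ((Real.pi / (k + 1) : ℝ) * Complex.I), Complex.norm_exp_ofReal_mul_I _, ?_⟩
  rw [← Complex.exp_nat_mul, ← Complex.exp_pi_mul_I]
  congr 1
  push_cast
  field_simp

-- Rotating the `i`-th coordinate by a suitable angle changes the sign of the integrand.
theorem integral_conj_monomialFn_mul_monomialFn_of_lt {α β : Fin d → ℕ} {i : Fin d}
    (hi : α i < β i) :
    ∫ x : sphere (0 : Cd d) 1, conj (monomialFn α x) * monomialFn β x ∂unitSphereMeasure d = 0 := by
  obtain ⟨k, hk⟩ := Nat.exists_eq_add_of_lt hi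
  obtain ⟨a, ha, hak⟩ := exists_norm_eq_one_and_pow_succ_eq_neg_one k
  have hphase : conj a ^ α i * a ^ β i = -1 := by
    rw [hk, add_assoc, pow_add, ← mul_assoc, ← mul_pow, Complex.conj_mul', ha, hak]
    simp
  have hrot (x : Cd d) :
      conj (monomialFn α (rotateCoord i a ha x)) * monomialFn β (rotateCoord i a ha x) =
        -(conj (monomialFn α x) * monomialFn β x) := by
    rw [monomialFn_rotateCoord, monomialFn_rotateCoord, map_mul, map_pow]
    linear_combination (conj (monomialFn α x) * monomialFn β x) * hphase
  have hinv := integral_comp_unitary (rotateCoord i a ha)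
    (f := fun x => conj (monomialFn α x) * monomialFn β x)
    ((Complex.continuous_conj.comp (continuous_monomialFn α)).mul (continuous_monomialFn β))
  simp only [hrot, integral_neg] at hinv
  exact self_eq_neg.1 hinv.symm

theorem integral_conj_monomialFn_mul_monomialFn {α β : Fin d → ℕ} (h : α ≠ β) :
    ∫ x : sphere (0 : Cd d) 1, conj (monomialFn α x) * monomialFn β x ∂unitSphereMeasure d = 0 := by
  obtain ⟨i, hi⟩ := Function.ne_iff.1 h
  rcases lt_or_gt_of_ne hi with hi | hi
  · exact integral_conj_monomialFn_mul_monomialFn_of_lt hi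
  · have hconj := congrArg conj (integral_conj_monomialFn_mul_monomialFn_of_lt hi)
    rw [← integral_conj, map_zero] at hconj
    simpa [mul_comm] using hconj

/-- The square of the `L²`-norm of a monomial on the unit sphere. -/
noncomputable def monomialNormSq (α : Fin d → ℕ) : ℝ :=
  ∫ x : sphere (0 : Cd d) 1, ‖monomialFn α x‖ ^ 2 ∂unitSphereMeasure d

theorem monomialNormSq_pos (α : Fin (e + 1) → ℕ) : 0 < monomialNormSq α := by
  let y : Cd (e + 1) := WithLp.toLp 2 fun _ => 1
  obtain ⟨x, hx, hxy⟩ := exists_norm_eq_one_and_eq_norm_smul y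
  have hxα : monomialFn α x ≠ 0 := by
    have hy : monomialFn α y = 1 := by simp [monomialFn, y]
    rw [hxy, monomialFn_smul] at hy
    exact right_ne_zero_of_mul_eq_one hy
  have hcont : Continuous fun x : sphere (0 : Cd (e + 1)) 1 => ‖monomialFn α x‖ ^ 2 :=
    ((continuous_monomialFn α).comp continuous_subtype_val).norm.pow 2
  exact hcont.integral_pos_of_hasCompactSupport_nonneg_nonzero
    (x := ⟨x, mem_sphere_zero_iff_norm.2 hx⟩) (HasCompactSupport.of_compactSpace _)
    (fun _ => sq_nonneg _) (pow_ne_zero 2 (norm_ne_zero_iff.2 hxα))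

/-- Monomials, normalised in `L²` of the unit sphere. -/
noncomputable def unitMonomial (α : Fin d → ℕ) (x : Cd d) : ℂ :=
  ((√(monomialNormSq α))⁻¹ : ℝ) * monomialFn α x

theorem unitMonomial_mem_homogPoly (α : Fin d → ℕ) : unitMonomial α ∈ homogPoly d (∑ i, α i) :=
  Submodule.smul_mem _ (((√(monomialNormSq α))⁻¹ : ℝ) : ℂ) (monomialFn_mem_homogPoly α)

theorem differentiable_unitMonomial (α : Fin d → ℕ) : Differentiable ℂ (unitMonomial α) :=
  differentiable_of_mem_homogPoly (unitMonomial_mem_homogPoly α)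

theorem continuous_unitMonomial (α : Fin d → ℕ) : Continuous (unitMonomial α) :=
  (differentiable_unitMonomial α).continuous

theorem unitMonomial_smul (α : Fin d → ℕ) (a : ℂ) (x : Cd d) :
    unitMonomial α (a • x) = a ^ (∑ i, α i) * unitMonomial α x :=
  apply_smul_of_mem_homogPoly (unitMonomial_mem_homogPoly α) a x

theorem monomialFn_eq_smul_unitMonomial (α : Fin (e + 1) → ℕ) :
    monomialFn α = (√(monomialNormSq α) : ℂ) • unitMonomial α := by
  ext x
  have h : (√(monomialNormSq α) : ℂ) ≠ 0 := by
    exact_mod_cast (Real.sqrt_pos.2 (monomialNormSq_pos α)).ne'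
  rw [Pi.smul_apply, unitMonomial, smul_eq_mul, Complex.ofReal_inv, mul_inv_cancel_left₀ h]

theorem integral_conj_unitMonomial_mul_unitMonomial (α β : Fin (e + 1) → ℕ) :
    ∫ x : sphere (0 : Cd (e + 1)) 1, conj (unitMonomial α x) * unitMonomial β x
      ∂unitSphereMeasure (e + 1) = if α = β then 1 else 0 := by
  have hscale (x : Cd (e + 1)) : conj (unitMonomial α x) * unitMonomial β x =
      ((√(monomialNormSq α))⁻¹ * (√(monomialNormSq β))⁻¹ : ℝ) *
        (conj (monomialFn α x) * monomialFn β x) := by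
    simp only [unitMonomial, map_mul, Complex.conj_ofReal, Complex.ofReal_mul]
    ring
  simp only [hscale, integral_const_mul]
  split_ifs with h
  · subst h
    have hint : ∫ x : sphere (0 : Cd (e + 1)) 1, conj (monomialFn α x) * monomialFn α x
        ∂unitSphereMeasure (e + 1) = (monomialNormSq α : ℂ) := by
      rw [monomialNormSq, ← integral_complex_ofReal]
      simp only [Complex.conj_mul', Complex.ofReal_pow]
    have hpos := monomialNormSq_pos α
    rw [hint, ← Complex.ofReal_mul, ← mul_inv, Real.mul_self_sqrt hpos.le,
      inv_mul_cancel₀ hpos.ne', Complex.ofReal_one]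
  · rw [integral_conj_monomialFn_mul_monomialFn h, mul_zero]

theorem card_finAntidiagonal_succ (e m : ℕ) :
    (Finset.finAntidiagonal (e + 1) m).card = (m + e).choose e := by
  have hsym : (Finset.finAntidiagonal (e + 1) m).card = Fintype.card (Sym (Fin (e + 1)) m) :=
    Finset.card_eq_of_equiv_fintype
      ((Equiv.subtypeEquivRight fun _ => Finset.mem_finAntidiagonal).trans
        (Sym.equivNatSumOfFintype (Fin (e + 1)) m).symm)
  rw [hsym, Sym.card_sym_eq_choose, Fintype.card_fin, show e + 1 + m - 1 = m + e by omega,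
    Nat.choose_symm_add]

theorem mem_span_unitMonomial_of_mem_homogPoly {m : ℕ} {p : Cd (e + 1) → ℂ}
    (hp : p ∈ homogPoly (e + 1) m) :
    p ∈ Submodule.span ℂ (unitMonomial '' (Finset.finAntidiagonal (e + 1) m : Set _)) := by
  refine Submodule.span_le.2 ?_ hp
  rintro _ ⟨α, hα, rfl⟩
  rw [monomialFn_eq_smul_unitMonomial]
  exact Submodule.smul_mem _ _
    (Submodule.subset_span (Set.mem_image_of_mem _ (Finset.mem_finAntidiagonal.2 hα)))

theorem exists_eq_sum_unitMonomial {m : ℕ} {p : Cd (e + 1) → ℂ} (hp : p ∈ homogPoly (e + 1) m) :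
    ∃ a : (Fin (e + 1) → ℕ) → ℂ,
      ∀ x, p x = ∑ α ∈ Finset.finAntidiagonal (e + 1) m, a α * unitMonomial α x := by
  obtain ⟨a, ha⟩ := (Submodule.mem_span_image_finset_iff_exists_fun' ℂ).1
    (mem_span_unitMonomial_of_mem_homogPoly hp)
  exact ⟨a, fun x => by simp [← ha]⟩

theorem integral_norm_sum_unitMonomial_sq (s : Finset (Fin (e + 1) → ℕ))
    (a : (Fin (e + 1) → ℕ) → ℂ) :
    ∫ x : sphere (0 : Cd (e + 1)) 1, ‖∑ α ∈ s, a α * unitMonomial α x‖ ^ 2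
      ∂unitSphereMeasure (e + 1) = ∑ α ∈ s, ‖a α‖ ^ 2 := by
  have hexpand (x : Cd (e + 1)) : ((‖∑ α ∈ s, a α * unitMonomial α x‖ ^ 2 : ℝ) : ℂ) =
      ∑ α ∈ s, ∑ β ∈ s, (conj (a α) * a β) * (conj (unitMonomial α x) * unitMonomial β x) := by
    rw [Complex.ofReal_pow, ← Complex.conj_mul', map_sum, Finset.sum_mul_sum]
    simp only [map_mul, mul_mul_mul_comm]
  have hint (α β : Fin (e + 1) → ℕ) : Integrable (fun x : sphere (0 : Cd (e + 1)) 1 =>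
      (conj (a α) * a β) * (conj (unitMonomial α x) * unitMonomial β x))
      (unitSphereMeasure (e + 1)) := by
    have hcont (γ : Fin (e + 1) → ℕ) :
        Continuous fun x : sphere (0 : Cd (e + 1)) 1 => unitMonomial γ x :=
      (continuous_unitMonomial γ).comp continuous_subtype_val
    exact integrable_unitSphereMeasure_of_continuous
      (continuous_const.mul ((Complex.continuous_conj.comp (hcont α)).mul (hcont β)))
  refine Complex.ofReal_injective ?_
  rw [← integral_complex_ofReal]
  simp only [hexpand]
  rw [integral_finsetSum _ fun α _ => integrable_finsetSum _ fun β _ => hint α β,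
    Complex.ofReal_sum]
  refine Finset.sum_congr rfl fun α hα => ?_
  rw [integral_finsetSum _ fun β _ => hint α β]
  simp only [integral_const_mul, integral_conj_unitMonomial_mul_unitMonomial, mul_ite, mul_one,
    mul_zero, Finset.sum_ite_eq, if_pos hα, Complex.conj_mul', Complex.ofReal_pow]

end Monomials

/-! ### The reproducing kernel of the homogeneous polynomials -/

section Kernel

open scoped ComplexConjugate

variable {e m : ℕ}

/-- The reproducing kernel of the homogeneous polynomials of degree `m`, on the diagonal. -/
noncomputable def homogKernel {d : ℕ} (m : ℕ) (x : Cd d) : ℝ :=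
  ∑ α ∈ Finset.finAntidiagonal d m, ‖unitMonomial α x‖ ^ 2

/-- The section at `y` of the reproducing kernel of the homogeneous polynomials of degree `m`. -/
noncomputable def homogKernelSection {d : ℕ} (m : ℕ) (y x : Cd d) : ℂ :=
  ∑ α ∈ Finset.finAntidiagonal d m, conj (unitMonomial α y) * unitMonomial α x

theorem homogKernel_nonneg {d : ℕ} (m : ℕ) (x : Cd d) : 0 ≤ homogKernel m x :=
  Finset.sum_nonneg fun _ _ => sq_nonneg _

theorem homogKernel_smul {d : ℕ} (m : ℕ) (a : ℂ) (y : Cd d) :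
    homogKernel m (a • y) = ‖a‖ ^ (2 * m) * homogKernel m y := by
  rw [homogKernel, homogKernel, Finset.mul_sum]
  refine Finset.sum_congr rfl fun α hα => ?_
  rw [unitMonomial_smul, Finset.mem_finAntidiagonal.1 hα, norm_mul, norm_pow]
  ring

theorem homogKernelSection_mem_homogPoly {d : ℕ} (m : ℕ) (y : Cd d) :
    homogKernelSection m y ∈ homogPoly d m := by
  have hsum : homogKernelSection m y =
      ∑ α ∈ Finset.finAntidiagonal d m, conj (unitMonomial α y) • unitMonomial α := by
    ext x
    simp [homogKernelSection]
  rw [hsum]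
  exact Submodule.sum_mem _ fun α hα => Submodule.smul_mem _ _
    (Finset.mem_finAntidiagonal.1 hα ▸ unitMonomial_mem_homogPoly α)

theorem homogKernelSection_self {d : ℕ} (m : ℕ) (y : Cd d) :
    homogKernelSection m y y = homogKernel m y := by
  simp only [homogKernelSection, homogKernel, Complex.conj_mul', Complex.ofReal_sum,
    Complex.ofReal_pow]

theorem integral_norm_homogKernelSection_sq (m : ℕ) (y : Cd (e + 1)) :
    ∫ x : sphere (0 : Cd (e + 1)) 1, ‖homogKernelSection m y x‖ ^ 2 ∂unitSphereMeasure (e + 1) =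
      homogKernel m y := by
  simp only [homogKernelSection, integral_norm_sum_unitMonomial_sq, homogKernel,
    RCLike.norm_conj]

theorem norm_sum_mul_sq_le {ι : Type*} (s : Finset ι) (a b : ι → ℂ) :
    ‖∑ i ∈ s, a i * b i‖ ^ 2 ≤ (∑ i ∈ s, ‖a i‖ ^ 2) * ∑ i ∈ s, ‖b i‖ ^ 2 := by
  have htri : ‖∑ i ∈ s, a i * b i‖ ≤ ∑ i ∈ s, ‖a i‖ * ‖b i‖ := by
    simpa only [norm_mul] using norm_sum_le s fun i => a i * b i
  exact (pow_le_pow_left₀ (norm_nonneg _) htri 2).trans (Finset.sum_mul_sq_le_sq_mul_sq _ _ _)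

theorem norm_sq_le_homogKernel_mul_integral {p : Cd (e + 1) → ℂ} (hp : p ∈ homogPoly (e + 1) m)
    (y : Cd (e + 1)) : ‖p y‖ ^ 2 ≤ homogKernel m y *
      ∫ x : sphere (0 : Cd (e + 1)) 1, ‖p x‖ ^ 2 ∂unitSphereMeasure (e + 1) := by
  obtain ⟨a, ha⟩ := exists_eq_sum_unitMonomial hp
  simp only [ha]
  rw [integral_norm_sum_unitMonomial_sq, mul_comm]
  exact norm_sum_mul_sq_le _ _ _

-- The section at `y`, transported by `U`, is a competitor in the extremal property at `U y`.
theorem homogKernel_le_homogKernel_unitary_apply (m : ℕ) (U : Cd (e + 1) ≃ₗᵢ[ℂ] Cd (e + 1))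
    (y : Cd (e + 1)) : homogKernel m y ≤ homogKernel m (U y) := by
  have hq := homogKernelSection_mem_homogPoly m y
  have hnorm : ∫ x : sphere (0 : Cd (e + 1)) 1, ‖homogKernelSection m y (U.symm x)‖ ^ 2
      ∂unitSphereMeasure (e + 1) = homogKernel m y :=
    (integral_comp_unitary U.symm
      ((differentiable_of_mem_homogPoly hq).continuous.norm.pow 2)).trans
      (integral_norm_homogKernelSection_sq m y)
  have hle : homogKernel m y * homogKernel m y ≤ homogKernel m (U y) * homogKernel m y := by
    have h := norm_sq_le_homogKernel_mul_integral (comp_linearMap_mem_homogPoly hq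
      (U.symm.toLinearEquiv : Cd (e + 1) →ₗ[ℂ] Cd (e + 1))) (U y)
    simp only [LinearEquiv.coe_coe, LinearIsometryEquiv.coe_toLinearEquiv, hnorm,
      U.symm_apply_apply, homogKernelSection_self, Complex.norm_of_nonneg (homogKernel_nonneg m y)]
      at h
    rwa [← sq]
  rcases (homogKernel_nonneg m y).eq_or_lt with h0 | h0
  · exact h0 ▸ homogKernel_nonneg m _
  · exact le_of_mul_le_mul_right hle h0

theorem homogKernel_eq_of_norm_eq_one (m : ℕ) {x y : Cd (e + 1)} (hx : ‖x‖ = 1) (hy : ‖y‖ = 1) :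
    homogKernel m x = homogKernel m y := by
  obtain ⟨U, hU⟩ := exists_unitary_apply_eq hx hy
  obtain ⟨V, hV⟩ := exists_unitary_apply_eq hy hx
  exact le_antisymm (hU ▸ homogKernel_le_homogKernel_unitary_apply m U x)
    (hV ▸ homogKernel_le_homogKernel_unitary_apply m V y)

theorem integral_homogKernel (e m : ℕ) :
    ∫ x : sphere (0 : Cd (e + 1)) 1, homogKernel m (x : Cd (e + 1)) ∂unitSphereMeasure (e + 1) =
      (m + e).choose e := by
  have hint (α : Fin (e + 1) → ℕ) : Integrable
      (fun x : sphere (0 : Cd (e + 1)) 1 => ‖unitMonomial α x‖ ^ 2) (unitSphereMeasure (e + 1)) :=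
    integrable_unitSphereMeasure_of_continuous
      (((continuous_unitMonomial α).comp continuous_subtype_val).norm.pow 2)
  have hone (α : Fin (e + 1) → ℕ) :
      ∫ x : sphere (0 : Cd (e + 1)) 1, ‖unitMonomial α x‖ ^ 2 ∂unitSphereMeasure (e + 1) = 1 := by
    simpa using integral_norm_sum_unitMonomial_sq {α} fun _ => 1
  simp only [homogKernel]
  rw [integral_finsetSum _ fun α _ => hint α]
  simp only [hone, Finset.sum_const, card_finAntidiagonal_succ, nsmul_eq_mul, mul_one]

-- The kernel is constant on the sphere, by unitary invariance, and its mean is the dimension.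
theorem homogKernel_of_norm_eq_one (m : ℕ) {y : Cd (e + 1)} (hy : ‖y‖ = 1) :
    homogKernel m y = (m + e).choose e := by
  have hconst (x : sphere (0 : Cd (e + 1)) 1) : homogKernel m (x : Cd (e + 1)) = homogKernel m y :=
    homogKernel_eq_of_norm_eq_one m (norm_eq_of_mem_sphere x) hy
  rw [← integral_homogKernel, integral_congr_ae (.of_forall hconst), integral_const,
    probReal_univ, one_smul]

theorem homogKernel_eq (m : ℕ) (y : Cd (e + 1)) :
    homogKernel m y = (m + e).choose e * ‖y‖ ^ (2 * m) := by
  obtain ⟨x, hx, hxy⟩ := exists_norm_eq_one_and_eq_norm_smul y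
  conv_lhs => rw [hxy]
  rw [homogKernel_smul, homogKernel_of_norm_eq_one m hx, Complex.norm_real, norm_norm, mul_comm]

end Kernel

/-! ### The monomial basis of the Hardy space -/

section HardyBasis

open scoped ComplexConjugate

variable {d e : ℕ}

/-- The affine coordinate that maps `ball c R` to the unit ball. -/
noncomputable def unitCoord (c : Cd d) (R : ℝ) (z : Cd d) : Cd d := (R : ℂ)⁻¹ • (z - c)

/-- The parametrisation of the sphere with centre `c` and radius `R` by the unit sphere. -/
noncomputable def sphereChart (c : Cd d) (R : ℝ) (x : sphere (0 : Cd d) 1) : Cd d :=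
  c + R • (x : Cd d)

variable {c : Cd d} {R : ℝ}

theorem unitCoord_add_smul (hR : R ≠ 0) (x : Cd d) : unitCoord c R (c + R • x) = x := by
  rw [unitCoord, add_sub_cancel_left, ← Complex.coe_smul,
    inv_smul_smul₀ (Complex.ofReal_ne_zero.2 hR)]

theorem add_smul_unitCoord (hR : R ≠ 0) (z : Cd d) : c + R • unitCoord c R z = z := by
  rw [unitCoord, ← Complex.coe_smul, smul_inv_smul₀ (Complex.ofReal_ne_zero.2 hR), add_sub_cancel]

theorem norm_unitCoord (hR : 0 < R) (z : Cd d) : ‖unitCoord c R z‖ = dist z c / R := by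
  rw [unitCoord, norm_smul, norm_inv, Complex.norm_of_nonneg hR.le, dist_eq_norm, div_eq_inv_mul]

theorem norm_unitCoord_lt_one (hR : 0 < R) {z : Cd d} (hz : z ∈ ball c R) :
    ‖unitCoord c R z‖ < 1 := by
  rwa [norm_unitCoord hR, div_lt_one hR]

theorem norm_unitCoord_le (hR : 0 < R) {r : ℝ} {z : Cd d} (hz : z ∈ closedBall c (r * R)) :
    ‖unitCoord c R z‖ ≤ r := by
  rwa [norm_unitCoord hR, div_le_iff₀ hR]

theorem differentiable_unitCoord : Differentiable ℂ (unitCoord c R) := by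
  unfold unitCoord
  fun_prop

theorem continuous_sphereChart : Continuous (sphereChart c R) := by
  unfold sphereChart
  fun_prop

theorem sphereChart_mem_sphere (hR : 0 ≤ R) (x : sphere (0 : Cd d) 1) :
    sphereChart c R x ∈ sphere c R := by
  rw [mem_sphere, sphereChart, dist_eq_norm, add_sub_cancel_left, norm_smul,
    norm_eq_of_mem_sphere, mul_one, Real.norm_of_nonneg hR]

theorem measurableEmbedding_sphereChart (hR : R ≠ 0) : MeasurableEmbedding (sphereChart c R) := by
  refine (continuous_sphereChart.isClosedEmbedding fun x y h => ?_).measurableEmbedding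
  have hxy := congrArg (unitCoord c R) h
  rw [sphereChart, sphereChart, unitCoord_add_smul hR, unitCoord_add_smul hR] at hxy
  exact Subtype.ext hxy

theorem sphereMeasure_eq_map (c : Cd d) (R : ℝ) :
    sphereMeasure c R = (unitSphereMeasure d).map (sphereChart c R) := rfl

instance (c : Cd (e + 1)) (R : ℝ) : IsProbabilityMeasure (sphereMeasure c R) := by
  rw [sphereMeasure_eq_map]
  exact Measure.isProbabilityMeasure_map continuous_sphereChart.aemeasurable

theorem ae_mem_sphere (hR : 0 < R) : ∀ᵐ z ∂sphereMeasure c R, z ∈ sphere c R := by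
  rw [sphereMeasure_eq_map, (measurableEmbedding_sphereChart hR.ne').ae_map_iff]
  exact .of_forall fun x => sphereChart_mem_sphere hR.le x

theorem integral_sphereMeasure (hR : R ≠ 0) {F : Type*} [NormedAddCommGroup F] [NormedSpace ℝ F]
    (f : Cd d → F) :
    ∫ z, f z ∂sphereMeasure c R = ∫ x, f (sphereChart c R x) ∂unitSphereMeasure d := by
  rw [sphereMeasure_eq_map, (measurableEmbedding_sphereChart hR).integral_map]

/-- The ball algebra: functions holomorphic on `ball c R` and continuous on its closure. Their
values outside the closed ball are arbitrary. -/
def ballAlgebra (c : Cd d) (R : ℝ) : Submodule ℂ (Cd d → ℂ) where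
  carrier := {u | DiffContOnCl ℂ u (ball c R)}
  zero_mem' := diffContOnCl_const
  add_mem' hu hv := hu.add hv
  smul_mem' a _ hu := hu.const_smul a

theorem continuousOn_closedBall_of_mem_ballAlgebra (hR : R ≠ 0) (u : ballAlgebra c R) :
    ContinuousOn u.1 (closedBall c R) :=
  closure_ball c hR ▸ u.2.continuousOn

theorem memLp_of_mem_ballAlgebra {c : Cd (e + 1)} (hR : 0 < R) (u : ballAlgebra c R) :
    MemLp u.1 2 (sphereMeasure c R) := by
  rw [sphereMeasure_eq_map, (measurableEmbedding_sphereChart hR.ne').memLp_map_measure_iff]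
  have hcont : Continuous (u.1 ∘ sphereChart c R) :=
    (continuousOn_closedBall_of_mem_ballAlgebra hR.ne' u).comp_continuous continuous_sphereChart
      fun x => sphere_subset_closedBall (sphereChart_mem_sphere hR.le x)
  exact hcont.memLp_of_hasCompactSupport (HasCompactSupport.of_compactSpace _)

variable {c : Cd (e + 1)}

/-- The boundary values of a function in the ball algebra, as an element of the Hardy space. -/
noncomputable def hardyClass (hR : 0 < R) : ballAlgebra c R →ₗ[ℂ] HardySpace c R where
  toFun u := ⟨(memLp_of_mem_ballAlgebra hR u).toLp u.1,
    Submodule.le_topologicalClosure _ ⟨u.1, u.2, MemLp.coeFn_toLp _⟩⟩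
  map_add' u v := Subtype.ext
    (MemLp.toLp_add (memLp_of_mem_ballAlgebra hR u) (memLp_of_mem_ballAlgebra hR v))
  map_smul' a u := Subtype.ext (MemLp.toLp_const_smul a (memLp_of_mem_ballAlgebra hR u))

theorem coeFn_hardyClass (hR : 0 < R) (u : ballAlgebra c R) :
    ((hardyClass hR u : Lp ℂ 2 (sphereMeasure c R)) : Cd (e + 1) → ℂ) =ᵐ[sphereMeasure c R] u.1 :=
  MemLp.coeFn_toLp (memLp_of_mem_ballAlgebra hR u)

theorem inner_hardyClass (hR : 0 < R) (u v : ballAlgebra c R) :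
    inner ℂ (hardyClass hR u) (hardyClass hR v) =
      ∫ x, conj (u.1 (sphereChart c R x)) * v.1 (sphereChart c R x)
        ∂unitSphereMeasure (e + 1) := by
  rw [← integral_sphereMeasure hR.ne' fun z => conj (u.1 z) * v.1 z, Submodule.coe_inner,
    L2.inner_def]
  refine integral_congr_ae ?_
  filter_upwards [coeFn_hardyClass hR u, coeFn_hardyClass hR v] with z hu hv
  rw [hu, hv, RCLike.inner_apply, mul_comm]

theorem norm_hardyClass_le (hR : 0 < R) {u : ballAlgebra c R} {M : ℝ} (hM0 : 0 ≤ M)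
    (hM : ∀ z ∈ sphere c R, ‖u.1 z‖ ≤ M) : ‖hardyClass hR u‖ ≤ M := by
  have h : ‖(hardyClass hR u : Lp ℂ 2 (sphereMeasure c R))‖ ≤ _ := Lp.norm_le_of_ae_bound hM0 (by
    filter_upwards [coeFn_hardyClass hR u, ae_mem_sphere hR] with z hz hzs
    exact hz ▸ hM z hzs)
  simpa [measureUnivNNReal] using h

theorem denseRange_hardyClass (hR : 0 < R) : DenseRange (hardyClass (c := c) hR) := by
  refine Metric.denseRange_iff.2 fun f ε hε => ?_
  have hf := f.2
  rw [← SetLike.mem_coe, Submodule.topologicalClosure_coe, Metric.mem_closure_iff] at hf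
  obtain ⟨g, ⟨u, hu, hgu⟩, hg⟩ := hf ε hε
  have hug : (hardyClass hR ⟨u, hu⟩ : Lp ℂ 2 (sphereMeasure c R)) = g :=
    Lp.ext ((coeFn_hardyClass hR ⟨u, hu⟩).trans hgu.symm)
  exact ⟨⟨u, hu⟩, by rwa [Subtype.dist_eq, hug]⟩

/-- The normalised monomials in the coordinate adapted to `ball c R`. -/
noncomputable def ballMonomial (c : Cd d) (R : ℝ) (α : Fin d → ℕ) : ballAlgebra c R :=
  ⟨fun z => unitMonomial α (unitCoord c R z),
    ((differentiable_unitMonomial α).comp differentiable_unitCoord).diffContOnCl⟩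

theorem ballMonomial_sphereChart (hR : R ≠ 0) (α : Fin (e + 1) → ℕ)
    (x : sphere (0 : Cd (e + 1)) 1) :
    (ballMonomial c R α).1 (sphereChart c R x) = unitMonomial α x :=
  congrArg (unitMonomial α) (unitCoord_add_smul hR x.1)

theorem exists_mem_span_ballMonomial_eq {p : Cd (e + 1) → ℂ}
    (hp : p ∈ Submodule.span ℂ (Set.range (monomialFn (d := e + 1)))) :
    ∃ q ∈ Submodule.span ℂ (Set.range (ballMonomial c R)), ∀ z, q.1 z = p (unitCoord c R z) := by
  have hle : Submodule.span ℂ (Set.range (monomialFn (d := e + 1))) ≤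
      ((Submodule.span ℂ (Set.range (ballMonomial c R))).map (ballAlgebra c R).subtype).comap
        (LinearMap.funLeft ℂ ℂ (unitCoord c R)) := by
    refine Submodule.span_le.2 ?_
    rintro _ ⟨α, rfl⟩
    refine ⟨(√(monomialNormSq α) : ℂ) • ballMonomial c R α,
      Submodule.smul_mem _ _ (Submodule.subset_span ⟨α, rfl⟩), ?_⟩
    rw [monomialFn_eq_smul_unitMonomial]
    rfl
  obtain ⟨q, hq, hqp⟩ := hle hp
  exact ⟨q, hq, fun z => congrFun hqp z⟩

theorem diffContOnCl_comp_add_smul {u : Cd d → ℂ} {c : Cd d} (hR : 0 < R)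
    (hu : DiffContOnCl ℂ u (ball c R)) :
    DiffContOnCl ℂ (fun x => u (c + R • x)) (ball (0 : Cd d) 1) := by
  have haff : Differentiable ℂ fun x : Cd d => c + (R : ℂ) • x := by fun_prop
  refine hu.comp haff.diffContOnCl fun x hx => ?_
  rw [mem_ball_zero_iff] at hx
  rw [mem_ball, dist_eq_norm, add_sub_cancel_left, norm_smul, Real.norm_of_nonneg hR.le]
  exact mul_lt_of_lt_one_right hR hx

theorem exists_mem_span_ballMonomial_norm_sub_le (hR : 0 < R) (u : ballAlgebra c R) {ε : ℝ}
    (hε : 0 < ε) : ∃ p ∈ Submodule.span ℂ (Set.range (ballMonomial c R)),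
      ∀ z ∈ closedBall c R, ‖u.1 z - p.1 z‖ ≤ ε := by
  obtain ⟨p, hp, hpu⟩ :=
    exists_mem_span_monomialFn_norm_sub_le (diffContOnCl_comp_add_smul hR u.2) hε
  obtain ⟨q, hq, hqp⟩ := exists_mem_span_ballMonomial_eq (c := c) (R := R) hp
  refine ⟨q, hq, fun z hz => ?_⟩
  have hz' : unitCoord c R z ∈ closedBall 0 1 :=
    mem_closedBall_zero_iff.2 (norm_unitCoord_le hR (by rwa [one_mul]))
  simpa only [hqp, add_smul_unitCoord hR.ne'] using hpu _ hz'

/-- The normalised monomials as elements of the Hardy space. -/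
noncomputable def hardyMonomial (c : Cd (e + 1)) (hR : 0 < R) (α : Fin (e + 1) → ℕ) :
    HardySpace c R :=
  hardyClass hR (ballMonomial c R α)

theorem orthonormal_hardyMonomial (hR : 0 < R) : Orthonormal ℂ (hardyMonomial c hR) := by
  classical
  refine orthonormal_iff_ite.2 fun α β => ?_
  rw [← integral_conj_unitMonomial_mul_unitMonomial α β, hardyMonomial, hardyMonomial,
    inner_hardyClass]
  simp only [ballMonomial_sphereChart hR.ne']

theorem hardyClass_mem_span_hardyMonomial (hR : 0 < R) {p : ballAlgebra c R}
    (hp : p ∈ Submodule.span ℂ (Set.range (ballMonomial c R))) :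
    hardyClass hR p ∈ Submodule.span ℂ (Set.range (hardyMonomial c hR)) := by
  have h := Submodule.mem_map_of_mem (f := hardyClass hR) hp
  rwa [Submodule.map_span, ← Set.range_comp] at h

theorem orthogonal_span_hardyMonomial (hR : 0 < R) :
    (Submodule.span ℂ (Set.range (hardyMonomial c hR)))ᗮ = ⊥ := by
  rw [← Submodule.topologicalClosure_eq_top_iff, eq_top_iff]
  intro f _
  rw [← SetLike.mem_coe, Submodule.topologicalClosure_coe, Metric.mem_closure_iff]
  intro ε hε
  obtain ⟨u, hfu⟩ := Metric.denseRange_iff.1 (denseRange_hardyClass hR) f (ε / 2) (half_pos hε)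
  obtain ⟨p, hp, hup⟩ := exists_mem_span_ballMonomial_norm_sub_le hR u (half_pos hε)
  have hclass : dist (hardyClass hR u) (hardyClass hR p) ≤ ε / 2 := by
    rw [dist_eq_norm, ← map_sub]
    exact norm_hardyClass_le hR (half_pos hε).le fun z hz => hup z (sphere_subset_closedBall hz)
  refine ⟨_, hardyClass_mem_span_hardyMonomial hR hp, ?_⟩
  linarith [dist_triangle f (hardyClass hR u) (hardyClass hR p)]

/-- The Hilbert basis of normalised monomials of the Hardy space. -/
noncomputable def hardyBasis (c : Cd (e + 1)) (hR : 0 < R) :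
    HilbertBasis (Fin (e + 1) → ℕ) ℂ (HardySpace c R) :=
  HilbertBasis.mkOfOrthogonalEqBot (orthonormal_hardyMonomial hR) (orthogonal_span_hardyMonomial hR)

theorem hardyBasis_apply (hR : 0 < R) (α : Fin (e + 1) → ℕ) :
    hardyBasis c hR α = hardyClass hR (ballMonomial c R α) := by
  rw [hardyBasis, HilbertBasis.coe_mkOfOrthogonalEqBot, hardyMonomial]

end HardyBasis

/-! ### Holomorphic extensions -/

section HolomorphicExtension

open scoped ComplexConjugate

variable {e : ℕ} {c : Cd (e + 1)} {R : ℝ}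

theorem sum_norm_unitMonomial_sq_le {r : ℝ} (hr1 : r < 1) {y : Cd (e + 1)} (hy : ‖y‖ ≤ r) (m : ℕ)
    (s : Finset (Fin (e + 1) → ℕ)) (hs : ∀ α ∈ s, m ≤ ∑ i, α i) :
    ∑ α ∈ s, ‖unitMonomial α y‖ ^ 2 ≤ kernelTail e r m := by
  classical
  have hr0 : 0 ≤ r := (norm_nonneg y).trans hy
  let N := s.sup (fun α => ∑ i, α i) + 1
  have hsub : s ⊆ (Finset.range N).biUnion fun j => Finset.finAntidiagonal (e + 1) (j + m) := by
    intro α hα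
    have hle : ∑ i, α i ≤ s.sup fun α => ∑ i, α i := Finset.le_sup (f := fun α => ∑ i, α i) hα
    have hge := hs α hα
    simp only [Finset.mem_biUnion, Finset.mem_range, Finset.mem_finAntidiagonal]
    exact ⟨∑ i, α i - m, by omega, by omega⟩
  have hdisj : (Finset.range N : Set ℕ).PairwiseDisjoint
      fun j => Finset.finAntidiagonal (e + 1) (j + m) := by
    refine fun i _ j _ hij => Finset.disjoint_left.2 fun α hi hj => hij ?_
    have := (Finset.mem_finAntidiagonal.1 hi).symm.trans (Finset.mem_finAntidiagonal.1 hj)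
    omega
  have hsum : Summable fun j : ℕ => ((j + m + e).choose e : ℝ) * r ^ (2 * (j + m)) :=
    (summable_nat_add_iff m).2 (hasSum_choose_mul_sq_pow e hr0 hr1).summable
  calc ∑ α ∈ s, ‖unitMonomial α y‖ ^ 2
      ≤ ∑ α ∈ (Finset.range N).biUnion fun j => Finset.finAntidiagonal (e + 1) (j + m),
          ‖unitMonomial α y‖ ^ 2 :=
        Finset.sum_le_sum_of_subset_of_nonneg hsub fun _ _ _ => by positivity
    _ = ∑ j ∈ Finset.range N, ((j + m + e).choose e : ℝ) * ‖y‖ ^ (2 * (j + m)) := by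
        rw [Finset.sum_biUnion hdisj]
        exact Finset.sum_congr rfl fun j _ => homogKernel_eq (j + m) y
    _ ≤ ∑ j ∈ Finset.range N, ((j + m + e).choose e : ℝ) * r ^ (2 * (j + m)) := by gcongr
    _ ≤ kernelTail e r m := hsum.sum_le_tsum _ fun _ _ => by positivity

/-- The reproducing kernel of the Hardy space: the Riesz representative of the evaluation at `z`
of the holomorphic extension. The series converges for `z ∈ ball c R` only. -/
noncomputable def hardyKernel (c : Cd (e + 1)) (hR : 0 < R) (z : Cd (e + 1)) : HardySpace c R :=
  ∑' α, conj ((ballMonomial c R α).1 z) • hardyBasis c hR α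

theorem memℓp_conj_ballMonomial (hR : 0 < R) {z : Cd (e + 1)} (hz : z ∈ ball c R) :
    Memℓp (fun α => conj ((ballMonomial c R α).1 z)) 2 := by
  refine memℓp_gen' (C := kernelTail e ‖unitCoord c R z‖ 0) fun s => ?_
  simp only [RCLike.norm_conj, ENNReal.toReal_ofNat, Real.rpow_ofNat]
  exact sum_norm_unitMonomial_sq_le (norm_unitCoord_lt_one hR hz) le_rfl 0 s
    fun _ _ => Nat.zero_le _

theorem inner_hardyKernel_hardyBasis (hR : 0 < R) {z : Cd (e + 1)} (hz : z ∈ ball c R)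
    (α : Fin (e + 1) → ℕ) :
    inner ℂ (hardyKernel c hR z) (hardyBasis c hR α) = (ballMonomial c R α).1 z := by
  have hsum := (hardyBasis c hR).hasSum_repr_symm ⟨_, memℓp_conj_ballMonomial hR hz⟩
  have hcoeff : inner ℂ (hardyBasis c hR α) (hardyKernel c hR z) =
      conj ((ballMonomial c R α).1 z) := by
    rw [hardyKernel, hsum.tsum_eq, ← HilbertBasis.repr_apply_apply,
      LinearIsometryEquiv.apply_symm_apply]
  rw [← inner_conj_symm (E := HardySpace c R), hcoeff, Complex.conj_conj]

/-- The value at `z` of the holomorphic extension of an element of the Hardy space; meaningful for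
`z ∈ ball c R`. -/
noncomputable def hardyExt (hR : 0 < R) (f : HardySpace c R) (z : Cd (e + 1)) : ℂ :=
  inner ℂ (hardyKernel c hR z) f

theorem hardyExt_add (hR : 0 < R) (f g : HardySpace c R) (z : Cd (e + 1)) :
    hardyExt hR (f + g) z = hardyExt hR f z + hardyExt hR g z :=
  inner_add_right _ _ _

theorem hardyExt_smul (hR : 0 < R) (a : ℂ) (f : HardySpace c R) (z : Cd (e + 1)) :
    hardyExt hR (a • f) z = a * hardyExt hR f z :=
  inner_smul_right (E := HardySpace c R) _ _ _

theorem hardyExt_sub (hR : 0 < R) (f g : HardySpace c R) (z : Cd (e + 1)) :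
    hardyExt hR (f - g) z = hardyExt hR f z - hardyExt hR g z :=
  inner_sub_right _ _ _

theorem tendsto_hardyExt (hR : 0 < R) {ι : Type*} {l : Filter ι} {f : ι → HardySpace c R}
    {g : HardySpace c R} (h : Tendsto f l (𝓝 g)) (z : Cd (e + 1)) :
    Tendsto (fun i => hardyExt hR (f i) z) l (𝓝 (hardyExt hR g z)) :=
  tendsto_const_nhds.inner h

theorem hasSum_hardyExt (hR : 0 < R) (f : HardySpace c R) {z : Cd (e + 1)} (hz : z ∈ ball c R) :
    HasSum (fun α => (ballMonomial c R α).1 z * inner ℂ (hardyBasis c hR α) f)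
      (hardyExt hR f z) := by
  simpa only [inner_hardyKernel_hardyBasis hR hz, hardyExt] using
    (hardyBasis c hR).hasSum_inner_mul_inner (hardyKernel c hR z) f

theorem norm_hardyExt_le (hR : 0 < R) {r : ℝ} (hr1 : r < 1) {z : Cd (e + 1)}
    (hz : ‖unitCoord c R z‖ ≤ r) (m : ℕ) (f : HardySpace c R)
    (hf : ∀ α : Fin (e + 1) → ℕ, ∑ i, α i < m → inner ℂ (hardyBasis c hR α) f = 0) :
    ‖hardyExt hR f z‖ ≤ √(kernelTail e r m) * ‖f‖ := by
  have hzB : z ∈ ball c R := by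
    simpa [norm_unitCoord hR, div_lt_one hR] using hz.trans_lt hr1
  have htail := kernelTail_nonneg e ((norm_nonneg _).trans hz) m
  refine le_of_tendsto (hasSum_hardyExt hR f hzB).norm (.of_forall fun s => ?_)
  have hdrop : ∑ α ∈ s, (ballMonomial c R α).1 z * inner ℂ (hardyBasis c hR α) f =
      ∑ α ∈ s with m ≤ ∑ i, α i, (ballMonomial c R α).1 z * inner ℂ (hardyBasis c hR α) f := by
    refine (Finset.sum_filter_of_ne fun α _ hα => ?_).symm
    contrapose! hα
    rw [hf α hα, mul_zero]
  rw [hdrop]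
  refine le_of_sq_le_sq ?_ (by positivity)
  rw [mul_pow, Real.sq_sqrt htail]
  refine (norm_sum_mul_sq_le _ _ _).trans ?_
  gcongr
  · exact sum_norm_unitMonomial_sq_le hr1 hz m _ fun α hα => (Finset.mem_filter.1 hα).2
  · exact (hardyBasis c hR).orthonormal.sum_inner_products_le f

theorem norm_hardyExt_le_of_norm_unitCoord_le (hR : 0 < R) {r : ℝ} (hr1 : r < 1)
    {z : Cd (e + 1)} (hz : ‖unitCoord c R z‖ ≤ r) (f : HardySpace c R) :
    ‖hardyExt hR f z‖ ≤ √(kernelTail e r 0) * ‖f‖ :=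
  norm_hardyExt_le hR hr1 hz 0 f fun _ h => absurd h (Nat.not_lt_zero _)

theorem hardyExt_hardyClass_of_mem_span (hR : 0 < R) {p : ballAlgebra c R}
    (hp : p ∈ Submodule.span ℂ (Set.range (ballMonomial c R))) {z : Cd (e + 1)}
    (hz : z ∈ ball c R) : hardyExt hR (hardyClass hR p) z = p.1 z := by
  have heq : Set.EqOn ((innerSL ℂ (hardyKernel c hR z)).toLinearMap ∘ₗ hardyClass hR)
      (LinearMap.proj z ∘ₗ (ballAlgebra c R).subtype) (Set.range (ballMonomial c R)) := by
    rintro _ ⟨α, rfl⟩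
    have := inner_hardyKernel_hardyBasis hR hz α
    rwa [hardyBasis_apply] at this
  exact LinearMap.eqOn_span heq hp

theorem tendsto_hardyClass (hR : 0 < R) {ι : Type*} {l : Filter ι} {u : ι → ballAlgebra c R}
    {v : ballAlgebra c R} (h : TendstoUniformlyOn (fun i => (u i).1) v.1 l (sphere c R)) :
    Tendsto (fun i => hardyClass hR (u i)) l (𝓝 (hardyClass hR v)) := by
  refine Metric.tendsto_nhds.2 fun ε hε => ?_
  filter_upwards [Metric.tendstoUniformlyOn_iff.1 h (ε / 2) (half_pos hε)] with i hi
  refine lt_of_le_of_lt ?_ (half_lt_self hε)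
  rw [dist_eq_norm, ← map_sub]
  refine norm_hardyClass_le hR (half_pos hε).le fun z hz => ?_
  rw [Submodule.coe_sub, Pi.sub_apply, ← dist_eq_norm, dist_comm]
  exact (hi z hz).le

theorem exists_seq_mem_span_ballMonomial_tendstoUniformlyOn (hR : 0 < R) (u : ballAlgebra c R) :
    ∃ p : ℕ → ballAlgebra c R, (∀ n, p n ∈ Submodule.span ℂ (Set.range (ballMonomial c R))) ∧
      TendstoUniformlyOn (fun n => (p n).1) u.1 atTop (closedBall c R) := by
  choose p hp hup using fun n : ℕ =>
    exists_mem_span_ballMonomial_norm_sub_le hR u (Nat.one_div_pos_of_nat (α := ℝ) (n := n))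
  refine ⟨p, hp, Metric.tendstoUniformlyOn_iff.2 fun ε hε => ?_⟩
  filter_upwards [tendsto_one_div_add_atTop_nhds_zero_nat.eventually_lt_const hε] with n hn z hz
  exact (dist_eq_norm _ _).trans_lt ((hup n z hz).trans_lt hn)

theorem hardyExt_hardyClass (hR : 0 < R) (u : ballAlgebra c R) {z : Cd (e + 1)}
    (hz : z ∈ ball c R) : hardyExt hR (hardyClass hR u) z = u.1 z := by
  obtain ⟨p, hp, hpu⟩ := exists_seq_mem_span_ballMonomial_tendstoUniformlyOn hR u
  have hclass := tendsto_hardyClass hR (hpu.mono sphere_subset_closedBall)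
  refine tendsto_nhds_unique (tendsto_hardyExt hR hclass z)
    ((hpu.tendsto_at (ball_subset_closedBall hz)).congr fun n => ?_)
  exact (hardyExt_hardyClass_of_mem_span hR (hp n) hz).symm

theorem exists_seq_tendsto_hardyClass (hR : 0 < R) (f : HardySpace c R) :
    ∃ u : ℕ → ballAlgebra c R, Tendsto (fun n => hardyClass hR (u n)) atTop (𝓝 f) := by
  obtain ⟨g, hg, hgf⟩ := mem_closure_iff_seq_limit.1 (denseRange_hardyClass hR f)
  choose u hu using hg
  exact ⟨u, by simpa only [hu] using hgf⟩

theorem tendsto_eLpNorm_sub_iff_tendsto_hardyClass (hR : 0 < R) (u : ℕ → ballAlgebra c R)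
    (f : HardySpace c R) :
    Tendsto (fun n => eLpNorm (fun z => (u n).1 z - f.1 z) 2 (sphereMeasure c R)) atTop (𝓝 0) ↔
      Tendsto (fun n => hardyClass hR (u n)) atTop (𝓝 f) := by
  have h := Lp.tendsto_Lp_iff_tendsto_eLpNorm'' (fi := atTop) (fun n => (u n).1)
    (fun n => memLp_of_mem_ballAlgebra hR (u n)) f.1 (Lp.memLp f.1)
  rw [Lp.toLp_coeFn] at h
  exact h.symm.trans (tendsto_subtype_rng (f := fun n => hardyClass hR (u n))).symm

theorem tendstoUniformlyOn_hardyExt (hR : 0 < R) {ι : Type*} {l : Filter ι}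
    {f : ι → HardySpace c R} {g : HardySpace c R} (h : Tendsto f l (𝓝 g)) {r : ℝ} (hr1 : r < 1) :
    TendstoUniformlyOn (fun i => hardyExt hR (f i)) (hardyExt hR g) l (ball c (r * R)) := by
  have hlim := (tendsto_iff_norm_sub_tendsto_zero.1 h).const_mul √(kernelTail e r 0)
  rw [mul_zero] at hlim
  refine Metric.tendstoUniformlyOn_iff.2 fun ε hε => ?_
  filter_upwards [hlim.eventually_lt_const hε] with i hi z hz
  rw [dist_comm, dist_eq_norm, ← hardyExt_sub]
  exact (norm_hardyExt_le_of_norm_unitCoord_le hR hr1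
    (norm_unitCoord_le hR (ball_subset_closedBall hz)) _).trans_lt hi

theorem differentiableOn_hardyExt (hR : 0 < R) (f : HardySpace c R) :
    DifferentiableOn ℂ (hardyExt hR f) (ball c R) := by
  intro z hz
  obtain ⟨r, hzr, hr1⟩ := exists_between (norm_unitCoord_lt_one hR hz)
  have hzr : z ∈ ball c (r * R) := by rwa [norm_unitCoord hR, div_lt_iff₀ hR] at hzr
  obtain ⟨u, hu⟩ := exists_seq_tendsto_hardyClass hR f
  have hsub : ball c (r * R) ⊆ ball c R :=
    ball_subset_ball (mul_le_of_le_one_left hR.le hr1.le)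
  have hdiff : ∀ n, DifferentiableOn ℂ (hardyExt hR (hardyClass hR (u n))) (ball c (r * R)) :=
    fun n => ((u n).2.differentiableOn.mono hsub).congr
      fun z hz => hardyExt_hardyClass hR (u n) (hsub hz)
  exact ((differentiableOn_of_tendstoUniformlyOn isOpen_ball (.of_forall hdiff)
    (tendstoUniformlyOn_hardyExt hR hu hr1)).differentiableAt
      (isOpen_ball.mem_nhds hzr)).differentiableWithinAt

theorem isHolomorphicExtension_iff (hR : 0 < R) (f : HardySpace c R) (F : Cd (e + 1) → ℂ) :
    IsHolomorphicExtension c R f F ↔ Set.EqOn F (hardyExt hR f) (ball c R) := by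
  constructor
  · rintro ⟨-, u, hu, hlim, hpt⟩ z hz
    have hclass := (tendsto_eLpNorm_sub_iff_tendsto_hardyClass hR (fun n => ⟨u n, hu n⟩) f).1 hlim
    exact tendsto_nhds_unique (hpt z hz) ((tendsto_hardyExt hR hclass z).congr
      fun n => hardyExt_hardyClass hR ⟨u n, hu n⟩ hz)
  · intro hF
    obtain ⟨u, hu⟩ := exists_seq_tendsto_hardyClass hR f
    refine ⟨(differentiableOn_hardyExt hR f).congr hF, fun n => (u n).1, fun n => (u n).2,
      (tendsto_eLpNorm_sub_iff_tendsto_hardyClass hR u f).2 hu, fun z hz => ?_⟩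
    rw [hF hz]
    exact (tendsto_hardyExt hR hu z).congr fun n => hardyExt_hardyClass hR (u n) hz

end HolomorphicExtension

/-! ### Bounded holomorphic functions -/

section BoundedHolomorphic

open AffineMap (homothety homothety_apply homothety_mul_apply)

variable {e : ℕ} {c : Cd (e + 1)} {R : ℝ}

theorem unitCoord_homothety (t : ℂ) (z : Cd (e + 1)) :
    unitCoord c R (homothety c t z) = t • unitCoord c R z := by
  rw [unitCoord, unitCoord, homothety_apply, vsub_eq_sub, vadd_eq_add, add_sub_cancel_right,
    smul_comm]

theorem differentiable_homothety (c : Cd (e + 1)) (t : ℂ) :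
    Differentiable ℂ (homothety c t : Cd (e + 1) → Cd (e + 1)) := by
  change Differentiable ℂ fun z => t • (z - c) + c
  fun_prop

theorem homothety_mem_ball (hR : 0 < R) {t : ℂ} (ht : ‖t‖ < 1) {z : Cd (e + 1)}
    (hz : z ∈ closedBall c R) : homothety c t z ∈ ball c R := by
  rw [mem_ball, dist_homothety_center, dist_comm]
  calc ‖t‖ * dist z c ≤ ‖t‖ * R := by gcongr; exact hz
    _ < R := mul_lt_of_lt_one_left hR ht

theorem exists_homothety_eq (hR : 0 < R) {w : Cd (e + 1)} (hw : w ∈ ball c R) :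
    ∃ t : ℂ, ‖t‖ < 1 ∧ ∃ z ∈ ball c R, homothety c t z = w := by
  obtain ⟨t, hwt, ht1⟩ := exists_between (norm_unitCoord_lt_one hR hw)
  have ht0 : 0 < t := (norm_nonneg _).trans_lt hwt
  have htC : (t : ℂ) ≠ 0 := Complex.ofReal_ne_zero.2 ht0.ne'
  have hnorm : ‖(t : ℂ)‖ = t := Complex.norm_of_nonneg ht0.le
  refine ⟨t, by rwa [hnorm], homothety c (t : ℂ)⁻¹ w, ?_, ?_⟩
  · rw [norm_unitCoord hR, div_lt_iff₀ hR] at hwt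
    rwa [mem_ball, dist_homothety_center, norm_inv, hnorm, inv_mul_lt_iff₀ ht0, dist_comm]
  · rw [← homothety_mul_apply, mul_inv_cancel₀ htC, AffineMap.homothety_one, AffineMap.id_apply]

theorem diffContOnCl_comp_homothety (hR : 0 < R) {t : ℂ} (ht : ‖t‖ < 1) {g : Cd (e + 1) → ℂ}
    (hg : DifferentiableOn ℂ g (ball c R)) :
    DiffContOnCl ℂ (fun z => g (homothety c t z)) (ball c R) :=
  DifferentiableOn.diffContOnCl_ball (U := closedBall c R)
    (hg.comp (differentiable_homothety c t).differentiableOn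
      fun _ hz => homothety_mem_ball hR ht hz) le_rfl

/-- The dilation `u ↦ (z ↦ u (c + t (z - c)))` of the ball algebra. -/
noncomputable def ballAlgebraDilation (hR : 0 < R) {t : ℂ} (ht : ‖t‖ < 1) :
    ballAlgebra c R →ₗ[ℂ] ballAlgebra c R where
  toFun u := ⟨fun z => u.1 (homothety c t z),
    diffContOnCl_comp_homothety hR ht u.2.differentiableOn⟩
  map_add' _ _ := rfl
  map_smul' _ _ := rfl

theorem tendstoUniformlyOn_ballAlgebraDilation (hR : 0 < R) {t : ℂ} (ht : ‖t‖ < 1) {ι : Type*}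
    {l : Filter ι} {u : ι → ballAlgebra c R} {v : ballAlgebra c R}
    (h : TendstoUniformlyOn (fun i => (u i).1) v.1 l (ball c R)) :
    TendstoUniformlyOn (fun i => (ballAlgebraDilation hR ht (u i)).1)
      (ballAlgebraDilation hR ht v).1 l (closedBall c R) :=
  fun V hV => (h V hV).mono fun _ hi _ hz => hi _ (homothety_mem_ball hR ht hz)

theorem ballMonomial_homothety (t : ℂ) (α : Fin (e + 1) → ℕ) (z : Cd (e + 1)) :
    (ballMonomial c R α).1 (homothety c t z) = t ^ (∑ i, α i) * (ballMonomial c R α).1 z := by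
  change unitMonomial α (unitCoord c R (homothety c t z)) = _
  rw [unitCoord_homothety, unitMonomial_smul]
  rfl

theorem ballAlgebraDilation_ballMonomial (hR : 0 < R) {t : ℂ} (ht : ‖t‖ < 1)
    (α : Fin (e + 1) → ℕ) :
    ballAlgebraDilation hR ht (ballMonomial c R α) = t ^ (∑ i, α i) • ballMonomial c R α :=
  Subtype.ext (funext (ballMonomial_homothety (c := c) (R := R) t α))

theorem inner_hardyBasis_ballAlgebraDilation_ballMonomial (hR : 0 < R) {t : ℂ} (ht : ‖t‖ < 1)
    (α β : Fin (e + 1) → ℕ) :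
    inner ℂ (hardyBasis c hR α) (hardyClass hR (ballAlgebraDilation hR ht (ballMonomial c R β))) =
      t ^ (∑ i, α i) * inner ℂ (hardyBasis c hR α) (hardyClass hR (ballMonomial c R β)) := by
  classical
  rw [ballAlgebraDilation_ballMonomial, map_smul, ← hardyBasis_apply,
    inner_smul_right (E := HardySpace c R), orthonormal_iff_ite.1 (hardyBasis c hR).orthonormal]
  split_ifs with h
  · rw [h]
  · rw [mul_zero, mul_zero]

theorem inner_hardyBasis_ballAlgebraDilation (hR : 0 < R) {t : ℂ} (ht : ‖t‖ < 1)
    (α : Fin (e + 1) → ℕ) (u : ballAlgebra c R) :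
    inner ℂ (hardyBasis c hR α) (hardyClass hR (ballAlgebraDilation hR ht u)) =
      t ^ (∑ i, α i) * inner ℂ (hardyBasis c hR α) (hardyClass hR u) := by
  let coeff : HardySpace c R →ₗ[ℂ] ℂ := (innerSL ℂ (hardyBasis c hR α)).toLinearMap
  let scaledCoeff : ballAlgebra c R →ₗ[ℂ] ℂ := t ^ (∑ i, α i) • coeff ∘ₗ hardyClass hR
  have hmonomial : Set.EqOn (coeff ∘ₗ hardyClass hR ∘ₗ ballAlgebraDilation hR ht) scaledCoeff
      (Set.range (ballMonomial c R)) := by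
    rintro _ ⟨β, rfl⟩
    exact inner_hardyBasis_ballAlgebraDilation_ballMonomial hR ht α β
  obtain ⟨p, hp, hpu⟩ := exists_seq_mem_span_ballMonomial_tendstoUniformlyOn hR u
  have hclass := tendsto_hardyClass hR (hpu.mono sphere_subset_closedBall)
  have hdilated : Tendsto (fun n => hardyClass hR (ballAlgebraDilation hR ht (p n))) atTop
      (𝓝 (hardyClass hR (ballAlgebraDilation hR ht u))) :=
    tendsto_hardyClass hR ((tendstoUniformlyOn_ballAlgebraDilation hR ht
      (hpu.mono ball_subset_closedBall)).mono sphere_subset_closedBall)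
  refine tendsto_nhds_unique (tendsto_const_nhds.inner hdilated)
    (((tendsto_const_nhds.inner hclass).const_mul _).congr fun n => ?_)
  exact (LinearMap.eqOn_span hmonomial (hp n)).symm

theorem norm_one_half_lt_one : ‖(1 / 2 : ℂ)‖ < 1 := by norm_num

theorem eq_zero_of_eqOn_hardyExt_zero (hR : 0 < R) {f : HardySpace c R}
    (h : Set.EqOn (hardyExt hR f) 0 (ball c R)) : f = 0 := by
  obtain ⟨u, hu⟩ := exists_seq_tendsto_hardyClass hR f
  have hmaps : ∀ z ∈ sphere c R, homothety c (1 / 2 : ℂ) z ∈ ball c (3 / 4 * R) := by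
    intro z hz
    rw [mem_ball, dist_homothety_center, dist_comm, mem_sphere.1 hz]
    norm_num
    linarith
  have hsub : ball c (3 / 4 * R) ⊆ ball c R := ball_subset_ball (by linarith)
  have hunif : TendstoUniformlyOn
      (fun n => (ballAlgebraDilation hR norm_one_half_lt_one (u n)).1) (0 : ballAlgebra c R).1
      atTop (sphere c R) := by
    refine ((((tendstoUniformlyOn_hardyExt hR hu (by norm_num : (3 / 4 : ℝ) < 1)).congr
      (.of_forall fun n z hz => hardyExt_hardyClass hR (u n) (hsub hz))).congr_right
      (h.mono hsub)).comp (homothety c (1 / 2 : ℂ))).mono hmaps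
  have hdilated := tendsto_hardyClass hR hunif
  rw [map_zero] at hdilated
  refine (hardyBasis c hR).repr.injective (lp.ext (funext fun α => ?_))
  have hlim := tendsto_nhds_unique (tendsto_const_nhds.inner (𝕜 := ℂ) hdilated)
    (((tendsto_const_nhds.inner hu).const_mul _).congr fun n =>
      (inner_hardyBasis_ballAlgebraDilation hR norm_one_half_lt_one α (u n)).symm)
  rw [inner_zero_right] at hlim
  rw [HilbertBasis.repr_apply_apply, map_zero]
  exact (mul_eq_zero.1 hlim.symm).resolve_left (pow_ne_zero _ (by norm_num))

theorem hardyExt_injective (hR : 0 < R) {f g : HardySpace c R}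
    (h : Set.EqOn (hardyExt hR f) (hardyExt hR g) (ball c R)) : f = g :=
  sub_eq_zero.1 <| eq_zero_of_eqOn_hardyExt_zero hR fun z hz => by
    rw [hardyExt_sub, h hz, sub_self, Pi.zero_apply]

/-- The boundary values of the dilated function `z ↦ g (c + t (z - c))`. -/
noncomputable def dilatedClass (hR : 0 < R) {g : Cd (e + 1) → ℂ}
    (hg : DifferentiableOn ℂ g (ball c R)) {t : ℂ} (ht : ‖t‖ < 1) : HardySpace c R :=
  hardyClass hR ⟨fun z => g (homothety c t z), diffContOnCl_comp_homothety hR ht hg⟩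

theorem inner_hardyBasis_dilatedClass_mul (hR : 0 < R) {g : Cd (e + 1) → ℂ}
    (hg : DifferentiableOn ℂ g (ball c R)) {s t : ℂ} (hs : ‖s‖ < 1) (ht : ‖t‖ < 1)
    (hst : ‖s * t‖ < 1) (α : Fin (e + 1) → ℕ) :
    inner ℂ (hardyBasis c hR α) (dilatedClass hR hg hst) =
      t ^ (∑ i, α i) * inner ℂ (hardyBasis c hR α) (dilatedClass hR hg hs) := by
  rw [dilatedClass, dilatedClass, ← inner_hardyBasis_ballAlgebraDilation hR ht]
  refine congrArg (fun u => inner ℂ (hardyBasis c hR α) (hardyClass hR u))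
    (Subtype.ext (funext fun z => ?_))
  exact congrArg g (homothety_mul_apply c s t z)

theorem exists_inner_hardyBasis_dilatedClass_eq (hR : 0 < R) {g : Cd (e + 1) → ℂ}
    (hg : DifferentiableOn ℂ g (ball c R)) : ∃ a : (Fin (e + 1) → ℕ) → ℂ,
      ∀ (t : ℂ) (ht : ‖t‖ < 1) (α : Fin (e + 1) → ℕ),
        inner ℂ (hardyBasis c hR α) (dilatedClass hR hg ht) = t ^ (∑ i, α i) * a α := by
  refine ⟨fun α => 2 ^ (∑ i, α i) *
    inner ℂ (hardyBasis c hR α) (dilatedClass hR hg norm_one_half_lt_one), fun t ht α => ?_⟩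
  have hst : ‖1 / 2 * t‖ < 1 := by
    rw [norm_mul]
    exact mul_lt_one_of_nonneg_of_lt_one_left (norm_nonneg _) norm_one_half_lt_one ht.le
  have hdil := inner_hardyBasis_dilatedClass_mul hR hg norm_one_half_lt_one ht hst α
  simp only [mul_comm (1 / 2 : ℂ) t] at hst hdil
  rw [inner_hardyBasis_dilatedClass_mul hR hg ht norm_one_half_lt_one hst] at hdil
  rw [mul_left_comm, ← hdil, ← mul_assoc, ← mul_pow, mul_one_div_cancel two_ne_zero, one_pow,
    one_mul]

theorem sum_norm_sq_le_of_inner_hardyBasis_dilatedClass_eq (hR : 0 < R) {g : Cd (e + 1) → ℂ}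
    (hg : DifferentiableOn ℂ g (ball c R)) {M : ℝ} (hM : ∀ z ∈ ball c R, ‖g z‖ ≤ M)
    {a : (Fin (e + 1) → ℕ) → ℂ}
    (ha : ∀ (t : ℂ) (ht : ‖t‖ < 1) (α : Fin (e + 1) → ℕ),
      inner ℂ (hardyBasis c hR α) (dilatedClass hR hg ht) = t ^ (∑ i, α i) * a α)
    (s : Finset (Fin (e + 1) → ℕ)) : ∑ α ∈ s, ‖a α‖ ^ 2 ≤ M ^ 2 := by
  have hM0 : 0 ≤ M := (norm_nonneg _).trans (hM c (mem_ball_self hR))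
  have hcont : Continuous fun t : ℂ => ∑ α ∈ s, ‖t ^ (∑ i, α i) * a α‖ ^ 2 := by fun_prop
  have hone : (1 : ℂ) ∈ closure (ball (0 : ℂ) 1) := by
    rw [closure_ball _ one_ne_zero, mem_closedBall_zero_iff, norm_one]
  have : (𝓝[ball (0 : ℂ) 1] 1).NeBot := mem_closure_iff_nhdsWithin_neBot.1 hone
  have hlim := (hcont.tendsto 1).mono_left (nhdsWithin_le_nhds (s := ball 0 1))
  simp only [one_pow, one_mul] at hlim
  refine le_of_tendsto hlim ?_
  filter_upwards [self_mem_nhdsWithin] with t ht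
  rw [mem_ball_zero_iff] at ht
  calc ∑ α ∈ s, ‖t ^ (∑ i, α i) * a α‖ ^ 2
      = ∑ α ∈ s, ‖inner ℂ (hardyBasis c hR α) (dilatedClass hR hg ht)‖ ^ 2 := by simp only [ha]
    _ ≤ ‖dilatedClass hR hg ht‖ ^ 2 := (hardyBasis c hR).orthonormal.sum_inner_products_le _
    _ ≤ M ^ 2 := by
      gcongr
      exact norm_hardyClass_le hR hM0 fun z hz =>
        hM _ (homothety_mem_ball hR ht (sphere_subset_closedBall hz))

theorem exists_hardyExt_eqOn_of_bounded (hR : 0 < R) {g : Cd (e + 1) → ℂ}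
    (hg : DifferentiableOn ℂ g (ball c R)) {M : ℝ} (hM : ∀ z ∈ ball c R, ‖g z‖ ≤ M) :
    ∃ G : HardySpace c R, ‖G‖ ≤ M ∧ Set.EqOn (hardyExt hR G) g (ball c R) := by
  obtain ⟨a, ha⟩ := exists_inner_hardyBasis_dilatedClass_eq hR hg
  have hsum : ∀ s : Finset (Fin (e + 1) → ℕ),
      ∑ α ∈ s, ‖a α‖ ^ (2 : ℝ≥0∞).toReal ≤ M ^ (2 : ℝ≥0∞).toReal := by
    simpa only [ENNReal.toReal_ofNat, Real.rpow_ofNat] using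
      sum_norm_sq_le_of_inner_hardyBasis_dilatedClass_eq hR hg hM ha
  let A : lp (fun _ : Fin (e + 1) → ℕ => ℂ) 2 := ⟨a, memℓp_gen' hsum⟩
  have hA : ∀ α, inner ℂ (hardyBasis c hR α) ((hardyBasis c hR).repr.symm A) = a α := fun α => by
    rw [← HilbertBasis.repr_apply_apply, LinearIsometryEquiv.apply_symm_apply]
  refine ⟨(hardyBasis c hR).repr.symm A, ?_, fun w hw => ?_⟩
  · rw [LinearIsometryEquiv.norm_map]
    exact lp.norm_le_of_forall_sum_le (by norm_num)
      ((norm_nonneg _).trans (hM c (mem_ball_self hR))) hsum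
  · obtain ⟨t, ht, z, hz, rfl⟩ := exists_homothety_eq hR hw
    have hterm : ∀ α, (ballMonomial c R α).1 (homothety c t z) *
        inner ℂ (hardyBasis c hR α) ((hardyBasis c hR).repr.symm A) =
          (ballMonomial c R α).1 z * inner ℂ (hardyBasis c hR α) (dilatedClass hR hg ht) := by
      intro α
      rw [hA, ha t ht, ballMonomial_homothety, mul_left_comm, mul_assoc]
    have hG := hasSum_hardyExt hR ((hardyBasis c hR).repr.symm A) hw
    simp only [hterm] at hG
    exact (hG.unique (hasSum_hardyExt hR _ hz)).trans (hardyExt_hardyClass hR _ hz)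

end BoundedHolomorphic

/-! ### Transfer operators -/

section Transfer

variable {d : ℕ} {c : Cd d} {R r : ℝ} {ι : Type*} {w : ι → Cd d → ℂ} {T : ι → Cd d → Cd d}
  {F G : Cd d → ℂ} {B : ℝ} {z : Cd d}

theorem norm_weight_le_toReal_iSup (hwsum : (∑' i, ⨆ z ∈ ball c R, ‖w i z‖ₑ) < ∞) (i : ι)
    (hz : z ∈ ball c R) : ‖w i z‖ ≤ (⨆ z ∈ ball c R, ‖w i z‖ₑ).toReal := by
  rw [← toReal_enorm]
  exact ENNReal.toReal_mono (ENNReal.ne_top_of_tsum_ne_top hwsum.ne i)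
    (le_iSup₂ (f := fun z _ => ‖w i z‖ₑ) z hz)

theorem summable_norm_weight (hwsum : (∑' i, ⨆ z ∈ ball c R, ‖w i z‖ₑ) < ∞)
    (hz : z ∈ ball c R) : Summable fun i => ‖w i z‖ :=
  .of_nonneg_of_le (fun _ => norm_nonneg _)
    (fun i => norm_weight_le_toReal_iSup hwsum i hz) (ENNReal.summable_toReal hwsum.ne)

theorem tsum_norm_weight_le_weightSup (hwsum : (∑' i, ⨆ z ∈ ball c R, ‖w i z‖ₑ) < ∞)
    (hz : z ∈ ball c R) : ∑' i, ‖w i z‖ ≤ weightSup c R w := by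
  have hfinite : (⨆ z ∈ ball c R, ∑' i, ‖w i z‖ₑ) < ∞ :=
    (iSup₂_le fun z hz =>
      ENNReal.tsum_le_tsum fun i => le_iSup₂ (f := fun z _ => ‖w i z‖ₑ) z hz).trans_lt hwsum
  calc ∑' i, ‖w i z‖ = (∑' i, ‖w i z‖ₑ).toReal := by
        simp only [ENNReal.tsum_toReal_eq fun _ => enorm_ne_top, toReal_enorm]
    _ ≤ weightSup c R w :=
        ENNReal.toReal_mono hfinite.ne (le_iSup₂ (f := fun z _ => ∑' i, ‖w i z‖ₑ) z hz)

theorem weightSup_nonneg : 0 ≤ weightSup c R w := ENNReal.toReal_nonneg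

theorem weightSup_pos (hwsum : (∑' i, ⨆ z ∈ ball c R, ‖w i z‖ₑ) < ∞)
    (h : ∃ i, ∃ z ∈ ball c R, w i z ≠ 0) : 0 < weightSup c R w := by
  obtain ⟨i, z, hz, hi⟩ := h
  calc 0 < ‖w i z‖ := norm_pos_iff.2 hi
    _ ≤ ∑' i, ‖w i z‖ := (summable_norm_weight hwsum hz).le_tsum i fun _ _ => norm_nonneg _
    _ ≤ weightSup c R w := tsum_norm_weight_le_weightSup hwsum hz

/-- The function `∑ i, w i · (F ∘ T i)`: the transfer operator acting on arbitrary functions, before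
it is restricted to the Hardy space. Where the series diverges, the value is `0`. -/
noncomputable def transfer (w : ι → Cd d → ℂ) (T : ι → Cd d → Cd d) (F : Cd d → ℂ) (z : Cd d) :
    ℂ :=
  ∑' i, w i z * F (T i z)

theorem transfer_congr (hT : ∀ i, Set.MapsTo (T i) (ball c R) (ball c R))
    (h : Set.EqOn F G (ball c R)) : Set.EqOn (transfer w T F) (transfer w T G) (ball c R) :=
  fun z hz => tsum_congr fun i => by rw [h (hT i hz)]

theorem closedBall_mul_subset_ball (hR : 0 < R) (hr1 : r < 1) :
    closedBall c (r * R) ⊆ ball c R :=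
  closedBall_subset_ball (mul_lt_of_lt_one_left hR hr1)

theorem norm_weight_mul_comp_le (hTr : ∀ i, Set.MapsTo (T i) (ball c R) (closedBall c (r * R)))
    (hB : ∀ z ∈ closedBall c (r * R), ‖F z‖ ≤ B) (hz : z ∈ ball c R) (i : ι) :
    ‖w i z * F (T i z)‖ ≤ ‖w i z‖ * B := by
  rw [norm_mul]
  exact mul_le_mul_of_nonneg_left (hB _ (hTr i hz)) (norm_nonneg _)

theorem summable_transfer (hwsum : (∑' i, ⨆ z ∈ ball c R, ‖w i z‖ₑ) < ∞)
    (hTr : ∀ i, Set.MapsTo (T i) (ball c R) (closedBall c (r * R)))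
    (hB : ∀ z ∈ closedBall c (r * R), ‖F z‖ ≤ B) (hz : z ∈ ball c R) :
    Summable fun i => w i z * F (T i z) :=
  .of_norm_bounded ((summable_norm_weight hwsum hz).mul_right B)
    (norm_weight_mul_comp_le hTr hB hz)

theorem norm_transfer_le (hwsum : (∑' i, ⨆ z ∈ ball c R, ‖w i z‖ₑ) < ∞)
    (hTr : ∀ i, Set.MapsTo (T i) (ball c R) (closedBall c (r * R)))
    (hB0 : 0 ≤ B) (hB : ∀ z ∈ closedBall c (r * R), ‖F z‖ ≤ B) (hz : z ∈ ball c R) :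
    ‖transfer w T F z‖ ≤ weightSup c R w * B :=
  (tsum_of_norm_bounded ((summable_norm_weight hwsum hz).hasSum.mul_right B)
    (norm_weight_mul_comp_le hTr hB hz)).trans
    (mul_le_mul_of_nonneg_right (tsum_norm_weight_le_weightSup hwsum hz) hB0)

theorem differentiableOn_transfer (hR : 0 < R) (hr1 : r < 1)
    (hw : ∀ i, DifferentiableOn ℂ (w i) (ball c R))
    (hwsum : (∑' i, ⨆ z ∈ ball c R, ‖w i z‖ₑ) < ∞)
    (hT : ∀ i, DifferentiableOn ℂ (T i) (ball c R))
    (hTr : ∀ i, Set.MapsTo (T i) (ball c R) (closedBall c (r * R)))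
    (hF : DifferentiableOn ℂ F (ball c R)) (hB : ∀ z ∈ closedBall c (r * R), ‖F z‖ ≤ B) :
    DifferentiableOn ℂ (transfer w T F) (ball c R) := by
  have hunif : TendstoUniformlyOn (fun (s : Finset ι) z => ∑ i ∈ s, w i z * F (T i z))
      (transfer w T F) atTop (ball c R) := by
    refine tendstoUniformlyOn_tsum
      ((ENNReal.summable_toReal hwsum.ne).mul_right B) fun i z hz => ?_
    rw [norm_mul]
    exact mul_le_mul (norm_weight_le_toReal_iSup hwsum i hz) (hB _ (hTr i hz))
      (norm_nonneg _) ENNReal.toReal_nonneg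
  exact differentiableOn_of_tendstoUniformlyOn isOpen_ball
    (.of_forall fun s => .fun_sum fun i _ => (hw i).fun_mul
      (hF.comp (hT i) fun z hz => closedBall_mul_subset_ball hR hr1 (hTr i hz))) hunif

end Transfer

section PolynomialSubspace

variable {e : ℕ} {c : Cd (e + 1)} {R : ℝ}

/-- The polynomials of degree less than `m`, as a subspace of the Hardy space. -/
noncomputable def polyDegreeLT (c : Cd (e + 1)) (hR : 0 < R) (m : ℕ) :
    Submodule ℂ (HardySpace c R) :=
  Submodule.span ℂ (hardyBasis c hR '' {α | ∑ i, α i < m})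

theorem coe_biUnion_finAntidiagonal (d m : ℕ) :
    (((Finset.range m).biUnion (Finset.finAntidiagonal d) : Finset (Fin d → ℕ)) :
      Set (Fin d → ℕ)) = {α | ∑ i, α i < m} := by
  ext α
  simp

instance (hR : 0 < R) (m : ℕ) : FiniteDimensional ℂ (polyDegreeLT c hR m) := by
  unfold polyDegreeLT
  rw [← coe_biUnion_finAntidiagonal]
  exact FiniteDimensional.span_of_finite ℂ ((Finset.finite_toSet _).image _)

theorem sum_range_choose_add (e m : ℕ) :
    ∑ j ∈ Finset.range m, (j + e).choose e = (m + e).choose (e + 1) := by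
  cases m with
  | zero => simp
  | succ m => rw [Nat.sum_range_add_choose, Nat.add_right_comm]

theorem finrank_polyDegreeLT_le (hR : 0 < R) (m : ℕ) :
    Module.finrank ℂ (polyDegreeLT c hR m) ≤ (m + e).choose (e + 1) := by
  classical
  rw [polyDegreeLT, ← coe_biUnion_finAntidiagonal, ← Finset.coe_image]
  calc Module.finrank ℂ (Submodule.span ℂ _)
      ≤ (Finset.image (hardyBasis c hR) _).card := finrank_span_finset_le_card _
    _ ≤ ((Finset.range m).biUnion (Finset.finAntidiagonal (e + 1))).card := Finset.card_image_le
    _ ≤ ∑ j ∈ Finset.range m, (Finset.finAntidiagonal (e + 1) j).card := Finset.card_biUnion_le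
    _ = (m + e).choose (e + 1) := by simp only [card_finAntidiagonal_succ, sum_range_choose_add]

theorem inner_hardyBasis_of_mem_orthogonal (hR : 0 < R) {m : ℕ} {f : HardySpace c R}
    (hf : f ∈ (polyDegreeLT c hR m)ᗮ) (α : Fin (e + 1) → ℕ) (hα : ∑ i, α i < m) :
    inner ℂ (hardyBasis c hR α) f = 0 :=
  (Submodule.mem_orthogonal _ _).1 hf _ (Submodule.subset_span ⟨α, hα, rfl⟩)

end PolynomialSubspace

section TransferOperator

variable {e : ℕ} {c : Cd (e + 1)} {R r : ℝ} {ι : Type*} {w : ι → Cd (e + 1) → ℂ}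
  {T : ι → Cd (e + 1) → Cd (e + 1)}

theorem isTransferOperator_iff (hR : 0 < R) (hT : ∀ i, Set.MapsTo (T i) (ball c R) (ball c R))
    {L : HardySpace c R → HardySpace c R} :
    IsTransferOperator c R w T L ↔
      ∀ f, Set.EqOn (hardyExt hR (L f)) (transfer w T (hardyExt hR f)) (ball c R) := by
  refine ⟨fun h f => ?_, fun h f => ⟨⟨_, (isHolomorphicExtension_iff hR f _).2 fun _ _ => rfl⟩,
    fun F hF => ?_⟩⟩
  · have hext := (h f).2 _ ((isHolomorphicExtension_iff hR f _).2 fun _ _ => rfl)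
    exact ((isHolomorphicExtension_iff hR (L f) _).1 hext).symm
  · have hFext := (isHolomorphicExtension_iff hR f F).1 hF
    exact (isHolomorphicExtension_iff hR (L f) _).2 ((transfer_congr hT hFext).trans (h f).symm)

theorem IsTransferOperator.unique (hR : 0 < R)
    (hT : ∀ i, Set.MapsTo (T i) (ball c R) (ball c R)) {L L' : HardySpace c R → HardySpace c R}
    (h : IsTransferOperator c R w T L) (h' : IsTransferOperator c R w T L') : L' = L :=
  funext fun f => hardyExt_injective hR
    (((isTransferOperator_iff hR hT).1 h' f).trans ((isTransferOperator_iff hR hT).1 h f).symm)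

theorem exists_hardyExt_eqOn_transfer (hR : 0 < R) (hr1 : r < 1)
    (hw : ∀ i, DifferentiableOn ℂ (w i) (ball c R))
    (hwsum : (∑' i, ⨆ z ∈ ball c R, ‖w i z‖ₑ) < ∞)
    (hT : ∀ i, DifferentiableOn ℂ (T i) (ball c R))
    (hTr : ∀ i, Set.MapsTo (T i) (ball c R) (closedBall c (r * R)))
    (m : ℕ) {f : HardySpace c R} (hf : f ∈ (polyDegreeLT c hR m)ᗮ) :
    ∃ G : HardySpace c R, ‖G‖ ≤ weightSup c R w * √(kernelTail e r m) * ‖f‖ ∧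
      Set.EqOn (hardyExt hR G) (transfer w T (hardyExt hR f)) (ball c R) := by
  have hB : ∀ z ∈ closedBall c (r * R), ‖hardyExt hR f z‖ ≤ √(kernelTail e r m) * ‖f‖ :=
    fun z hz => norm_hardyExt_le hR hr1 (norm_unitCoord_le hR hz) m f
      (inner_hardyBasis_of_mem_orthogonal hR hf)
  rw [mul_assoc]
  exact exists_hardyExt_eqOn_of_bounded hR
    (differentiableOn_transfer hR hr1 hw hwsum hT hTr (differentiableOn_hardyExt hR f) hB)
    fun z hz => norm_transfer_le hwsum hTr (by positivity) hB hz

end TransferOperator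

section TransferOperator

variable {e : ℕ} {c : Cd (e + 1)} {R r : ℝ} {ι : Type*} {w : ι → Cd (e + 1) → ℂ}
  {T : ι → Cd (e + 1) → Cd (e + 1)}

theorem isLinearMap_of_eqOn_transfer (hR : 0 < R) {L : HardySpace c R → HardySpace c R}
    (hL : ∀ f, Set.EqOn (hardyExt hR (L f)) (transfer w T (hardyExt hR f)) (ball c R))
    (hsum : ∀ f : HardySpace c R, ∀ z ∈ ball c R,
      Summable fun i => w i z * hardyExt hR f (T i z)) : IsLinearMap ℂ L where
  map_add f g := hardyExt_injective hR fun z hz => by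
    rw [hardyExt_add, hL _ hz, hL _ hz, hL _ hz]
    simp only [transfer, hardyExt_add, mul_add]
    exact (hsum f z hz).tsum_add (hsum g z hz)
  map_smul a f := hardyExt_injective hR fun z hz => by
    rw [hardyExt_smul, hL _ hz, hL _ hz]
    simp only [transfer, hardyExt_smul, mul_left_comm _ a]
    exact tsum_mul_left

theorem mem_orthogonal_polyDegreeLT_zero (hR : 0 < R) (f : HardySpace c R) :
    f ∈ (polyDegreeLT c hR 0)ᗮ := by
  simp [polyDegreeLT]

theorem exists_isTransferOperator (hR : 0 < R) (hr1 : r < 1)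
    (hw : ∀ i, DifferentiableOn ℂ (w i) (ball c R))
    (hwsum : (∑' i, ⨆ z ∈ ball c R, ‖w i z‖ₑ) < ∞)
    (hT : ∀ i, DifferentiableOn ℂ (T i) (ball c R))
    (hTr : ∀ i, Set.MapsTo (T i) (ball c R) (closedBall c (r * R))) :
    ∃ L : HardySpace c R →L[ℂ] HardySpace c R, IsTransferOperator c R w T L ∧
      ∀ m, ∀ f ∈ (polyDegreeLT c hR m)ᗮ,
        ‖L f‖ ≤ weightSup c R w * √(kernelTail e r m) * ‖f‖ := by
  choose L hLnorm hL using fun f : HardySpace c R =>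
    exists_hardyExt_eqOn_transfer hR hr1 hw hwsum hT hTr 0 (mem_orthogonal_polyDegreeLT_zero hR f)
  have hlinear : IsLinearMap ℂ L := isLinearMap_of_eqOn_transfer hR hL fun f z hz =>
    summable_transfer hwsum hTr (fun z hz =>
      norm_hardyExt_le_of_norm_unitCoord_le hR hr1 (norm_unitCoord_le hR hz) f) hz
  refine ⟨(hlinear.mk' L).mkContinuous _ hLnorm, (isTransferOperator_iff hR fun i z hz =>
    closedBall_mul_subset_ball hR hr1 (hTr i hz)).2 hL, fun m f hf => ?_⟩
  obtain ⟨G, hG, hGext⟩ := exists_hardyExt_eqOn_transfer hR hr1 hw hwsum hT hTr m hf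
  obtain rfl : G = L f := hardyExt_injective hR (hGext.trans (hL f).symm)
  exact hG

end TransferOperator

theorem isCompactOperator_of_norm_le_on_orthogonal {𝕜 E F : Type*} [RCLike 𝕜]
    [NormedAddCommGroup E] [InnerProductSpace 𝕜 E] [NormedAddCommGroup F] [NormedSpace 𝕜 F]
    [CompleteSpace F] (L : E →L[𝕜] F)
    (Q : ℕ → Submodule 𝕜 E) [∀ m, FiniteDimensional 𝕜 (Q m)] (s : ℕ → ℝ)
    (hs : Tendsto s atTop (𝓝 0)) (hs0 : ∀ m, 0 ≤ s m) (h : ∀ m, ∀ f ∈ (Q m)ᗮ, ‖L f‖ ≤ s m * ‖f‖) :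
    IsCompactOperator L := by
  let truncation (m : ℕ) : E →L[𝕜] F := L ∘L (Q m).subtypeL ∘L (Q m).orthogonalProjectionOnto
  have hcompact (m : ℕ) : IsCompactOperator (truncation m) := by
    have : ProperSpace (Q m) := FiniteDimensional.proper 𝕜 (Q m)
    exact (isCompactOperator_of_locallyCompactSpace_dom
      (Q m).orthogonalProjectionOnto).clm_comp (L ∘L (Q m).subtypeL)
  have hnorm (m : ℕ) : ‖L - truncation m‖ ≤ s m := by
    refine ContinuousLinearMap.opNorm_le_bound _ (hs0 m) fun f => ?_
    calc ‖(L - truncation m) f‖ = ‖L (f - (Q m).starProjection f)‖ := by rw [map_sub]; rfl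
      _ ≤ s m * ‖f - (Q m).starProjection f‖ :=
          h m _ ((Q m).sub_starProjection_mem_orthogonal f)
      _ ≤ s m * ‖f‖ := by
          rw [← (Q m).starProjection_orthogonal_val]
          exact mul_le_mul_of_nonneg_left ((Q m)ᗮ.norm_starProjection_apply_le f) (hs0 m)
  have hlim : Tendsto truncation atTop (𝓝 L) := by
    refine tendsto_iff_norm_sub_tendsto_zero.2
      (squeeze_zero (fun _ => norm_nonneg _) (fun m => ?_) hs)
    rw [norm_sub_rev]
    exact hnorm m
  exact isCompactOperator_of_tendsto hlim (.of_forall hcompact)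

section EigenvalueEstimate

variable {e : ℕ} {c : Cd (e + 1)} {R r : ℝ}

theorem hasWeylBound_approxBound (hR : 0 < R) {W : ℝ} {L : HardySpace c R →L[ℂ] HardySpace c R}
    (hL : ∀ m, ∀ f ∈ (polyDegreeLT c hR m)ᗮ, ‖L f‖ ≤ W * √(kernelTail e r m) * ‖f‖) :
    HasWeylBound (L : Module.End ℂ (HardySpace c R)) (approxBound e W r) := fun U _ hU =>
  norm_det_restrict_le_prod _ (fun k => polyDegreeLT c hR (degreeBelow e k))
    (fun k => (finrank_polyDegreeLT_le hR _).trans (choose_degreeBelow_le e k)) _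
    (fun k => hL (degreeBelow e k)) U hU

theorem isCompactOperator_of_norm_le_kernelTail (hR : 0 < R) {W : ℝ} (hW : 0 ≤ W)
    {L : HardySpace c R →L[ℂ] HardySpace c R}
    (hL : ∀ m, ∀ f ∈ (polyDegreeLT c hR m)ᗮ, ‖L f‖ ≤ W * √(kernelTail e r m) * ‖f‖) :
    IsCompactOperator L :=
  isCompactOperator_of_norm_le_on_orthogonal L (polyDegreeLT c hR) _
    (by simpa only [Real.sqrt_zero, mul_zero] using (tendsto_kernelTail e r).sqrt.const_mul W)
    (fun m => by positivity) hL

end EigenvalueEstimate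

theorem theorem1 {d : ℕ} (hd : 1 ≤ d) {ι : Type*} [Countable ι]
    (c : Cd d) (R : ℝ) (hR : 0 < R) (r : ℝ) (hr0 : 0 < r) (hr1 : r < 1)
    (w : ι → Cd d → ℂ) (T : ι → Cd d → Cd d)
    (hw : ∀ i, DifferentiableOn ℂ (w i) (ball c R))
    (hwsum : (∑' i, ⨆ z ∈ ball c R, ‖w i z‖ₑ) < ∞)
    (hT : ∀ i, DifferentiableOn ℂ (T i) (ball c R))
    (hTr : ∀ i, Set.MapsTo (T i) (ball c R) (closedBall c (r * R))) :
    ∃ L : HardySpace c R →L[ℂ] HardySpace c R,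
      IsTransferOperator c R w T L ∧
      (∀ L' : HardySpace c R → HardySpace c R, IsTransferOperator c R w T L' → L' = L) ∧
      IsCompactOperator L ∧
      (∃ ev : ℕ → ℂ, IsEigenvalueSequence (L : Module.End ℂ (HardySpace c R)) ev) ∧
      ∀ ev : ℕ → ℂ, IsEigenvalueSequence (L : Module.End ℂ (HardySpace c R)) ev →
        ∀ n : ℕ, 1 ≤ n →
          ‖ev (n - 1)‖ ≤ eigenvalueBound d (weightSup c R w) r n ∧
          ((∃ i, ∃ z ∈ ball c R, w i z ≠ 0) →
            ‖ev (n - 1)‖ < eigenvalueBound d (weightSup c R w) r n) ∧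
          (d = 1 →
            ‖ev (n - 1)‖ ≤ weightSup c R w / √(1 - r ^ 2) * r ^ (((n : ℝ) - 1) / 2)) := by
  obtain ⟨e, rfl⟩ : ∃ e, d = e + 1 := ⟨d - 1, (Nat.sub_add_cancel hd).symm⟩
  obtain ⟨L, hL, hLtail⟩ := exists_isTransferOperator hR hr1 hw hwsum hT hTr
  have hTball : ∀ i, Set.MapsTo (T i) (ball c R) (ball c R) := fun i z hz =>
    closedBall_mul_subset_ball hR hr1 (hTr i hz)
  have hW : 0 ≤ weightSup c R w := weightSup_nonneg
  have hweyl := hasWeylBound_approxBound hR hLtail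
  have hs0 := approxBound_nonneg (e := e) (r := r) hW
  have hs := tendsto_approxBound e (weightSup c R w) r
  refine ⟨L, hL, fun L' hL' => hL.unique hR hTball hL',
    isCompactOperator_of_norm_le_kernelTail hR hW hLtail,
    hweyl.exists_isEigenvalueSequence hs0 hs, fun ev hev n hn => ?_⟩
  have hpow := hweyl.norm_pow_le_prod hs0 (approxBound_antitone hW hr0.le hr1) hs hev (n - 1)
  rw [Nat.sub_add_cancel hn] at hpow
  refine ⟨le_eigenvalueBound hW hr0 hr1 hn (norm_nonneg _) hpow,
    fun hne => lt_eigenvalueBound (weightSup_pos hwsum hne) hr0 hr1 hn hpow, fun hd1 => ?_⟩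
  obtain rfl : e = 0 := Nat.succ_injective hd1
  exact le_of_pow_le_prod_approxBound_zero hW hr0 hr1 hn hpow
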